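/- Let $\pi:\mathcal{F}M\to M$ be a smooth fiber bundle (finite-dimensional smooth manifolds without boundary, $M$ Hausdorff) with model fiber $\mathcal{F}$, and let $\mathrm{Vert}\,\mathcal{F}M=\ker\pi_*\subseteq T\mathcal{F}M$ be its vertical tangent bundle, considered as a fiber bundle over $M$. A non-linear (Ehresmann) connection on a fiber bundle over $M$ is a smooth field of projections of the tangent spaces of its total space whose image at each point is the vertical tangent space. Let $P$ be such a connection on $\mathcal{F}M$. For a local section $f$ of $\mathcal{F}M$ and a vector field $X$ on $M$ put $(D_Xf)_p=P_{f(p)}(f_{*,p}X_p)$, a local section of $\mathrm{Vert}\,\mathcal{F}M$, and use the same definition for connections on $\mathrm{Vert}\,\mathcal{F}M\to M$. The curvature of $P$ is defined for vector fields $A,B$ on $\mathcal{F}M$ by $$R(A,B)=-P[(1-P)A,(1-P)B]-(1-P)[PA,PB].$$ Let $\Theta$ be the canonical involution $\Theta\big(\tfrac{d}{dt}|_0\tfrac{d}{d\varepsilon}|_0\gamma(t,\varepsilon)\big)=\tfrac{d}{dt}|_0\tfrac{d}{d\varepsilon}|_0\gamma(\varepsilon,t)$ and let $\Pi\big(\tfrac{d}{dt}|_0\tfrac{d}{d\varepsilon}|_0\gamma(t,\varepsilon)\big)=\tfrac{d}{d\varepsilon}|_0\gamma(0,\varepsilon)\oplus\tfrac{d}{dt}|_0\gamma(t,0)$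 be the double projection, both on $\mathrm{Vert}\,\mathrm{Vert}\,\mathcal{F}M$, where $\gamma$ runs through the smooth maps from $\mathbb{R}^2$ to the fibers of $\mathcal{F}M$. The fibers of $\Pi$ are affine spaces modelled on the fibers of $\mathrm{Vert}\,\mathcal{F}M$ (via vertical lifts). Then: 1. The value of $R(A,B)$ at a point depends only on the values of $A$ and $B$ at that point, so that $R_z(a,b)$ is defined for tangent vectors $a,b$ at $z\in\mathcal{F}M$, and $R(A,B)=-P[(1-P)A,(1-P)B]$. 2. There is a unique connection on $\mathrm{Vert}\,\mathcal{F}M\to M$, with directional derivative denoted by $D^{\mathrm{Vert}}$, such that $D^{\mathrm{Vert}}_X\big(\tfrac{d}{d\varepsilon}|_0f_\varepsilon\big)=\Theta\big(\tfrac{d}{d\varepsilon}|_0D_Xf_\varepsilon\big)$ for all vector fields $X$ on $M$ and all smooth one-parameter families $(f_\varepsilon)_{\varepsilon\in\mathbb{R}}$ of local sections of $\mathcal{F}M$. 3. (Curvature identity.) For all vector fields $X,Y$ on $M$ and every local section $f$ of $\mathcal{F}M$, the map $D^{\mathrm{Vert}}_XD_Yf$ takes values in $\mathrm{Vert}\,\mathrm{Vert}\,\mathcal{F}M$,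 $D^{\mathrm{Vert}}_XD_Yf$ and $\Theta(D^{\mathrm{Vert}}_YD_Xf)$ have the same image under $\Pi$, and, with their difference taken in the affine fibers of $\Pi$, $$R_{f(p)}(f_{*,p}X_p,f_{*,p}Y_p)=\big(D^{\mathrm{Vert}}_XD_Yf-\Theta(D^{\mathrm{Vert}}_YD_Xf)\big)_p-(D_{[X,Y]}f)_p$$ at every point $p$ of the domain of $f$. 4. (Local formula.) Let $(x^\mu;f^\alpha)$ be local coordinates of $\mathcal{F}M$ that complement local coordinates $(x^\mu)$ of $M$, and define the generalized Christoffel symbols by $P\big(\tfrac{\partial}{\partial x^\mu}\big)=\sum_\alpha\Gamma^\alpha_\mu\tfrac{\partial}{\partial f^\alpha}$. Then $R\big(\tfrac{\partial}{\partial x^\mu},\tfrac{\partial}{\partial x^\nu}\big)=\sum_\alpha R^\alpha_{\mu\nu}\tfrac{\partial}{\partial f^\alpha}$ with $$R^\alpha_{\mu\nu}=\frac{\partial\Gamma^\alpha_\nu}{\partial x^\mu}-\frac{\partial\Gamma^\alpha_\mu}{\partial x^\nu}+\sum_\beta\Big(\Gamma^\beta_\nu\frac{\partial\Gamma^\alpha_\mu}{\partial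 f^\beta}-\Gamma^\beta_\mu\frac{\partial\Gamma^\alpha_\nu}{\partial f^\beta}\Big).$$ -/

import Mathlib

open scoped Manifold ContDiff Topology
open Bundle

noncomputable section

namespace Ehresmann

/-! ### Velocities, tangent vectors to a subset, smooth vector fields -/

section General

variable {E : Type*} [NormedAddCommGroup E] [NormedSpace ℝ E]
  {H : Type*} [TopologicalSpace H] (I : ModelWithCorners ℝ E H)
  {N : Type*} [TopologicalSpace N] [ChartedSpace H N]

/-- The velocity `d/dt c(t)` of a curve, as a point of the tangent bundle. -/
def velocity (c : ℝ → N) (t : ℝ) : TangentBundle I N :=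
  ⟨c t, mfderiv 𝓘(ℝ, ℝ) I c t (1 : ℝ)⟩

/-- The tangent bundle of a submanifold `S ⊆ N`, as a subset of `TN`: the velocities at time `0`
of the smooth curves that run inside `S`. -/
def tangentSet (S : Set N) : Set (TangentBundle I N) :=
  {ξ | ∃ c : ℝ → N, ContMDiffAt 𝓘(ℝ, ℝ) I ∞ c 0 ∧ (∀ᶠ t in 𝓝 (0 : ℝ), c t ∈ S) ∧
    velocity I c 0 = ξ}

/-- A smooth vector field near the point `p`. -/
def IsSmoothVectorFieldAt [IsManifold I ∞ N] (X : ∀ p : N, TangentSpace I p) (p : N) : Prop :=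
  ContMDiffAt I I.tangent ∞ (fun q => (⟨q, X q⟩ : TangentBundle I N)) p

/-- A global smooth vector field. -/
def IsSmoothVectorField [IsManifold I ∞ N] (X : ∀ p : N, TangentSpace I p) : Prop :=
  ContMDiff I I.tangent ∞ (fun q => (⟨q, X q⟩ : TangentBundle I N))

/-- A (not necessarily smooth) field of endomorphisms of the tangent spaces of `N`. -/
abbrev EndField (N : Type*) [TopologicalSpace N] [ChartedSpace H N] :=
  ∀ y : N, TangentSpace I y →L[ℝ] TangentSpace I y

variable {I}

/-- The map `TN → TN` over the identity of `N` given by a field of endomorphisms. -/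
def EndField.toMap (P : EndField I N) (v : TangentBundle I N) : TangentBundle I N :=
  ⟨v.proj, P v.proj v.snd⟩

section CovDeriv

variable {E' : Type*} [NormedAddCommGroup E'] [NormedSpace ℝ E']
  {M : Type*} [TopologicalSpace M] [ChartedSpace E' M]

/-- The directional derivative `(D_X f)_p = P_{f(p)} (f_{*,p} X_p)` of a map `f : M → N` with
respect to a field of endomorphisms `P` of the tangent spaces of `N`, as a vector at `f(p)`. -/
def covDerivVec (P : EndField I N) (X : ∀ p : M, TangentSpace 𝓘(ℝ, E') p) (f : M → N) (p : M) :
    TangentSpace I (f p) :=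
  P (f p) (mfderiv 𝓘(ℝ, E') I f p (X p))

/-- The directional derivative `D_X f` as a map from `M` to the tangent bundle of `N`. -/
def covDeriv (P : EndField I N) (X : ∀ p : M, TangentSpace 𝓘(ℝ, E') p) (f : M → N) (p : M) :
    TangentBundle I N :=
  ⟨f p, covDerivVec P X f p⟩

end CovDeriv

end General

/-! ### The iterated tangent bundle -/

section IteratedTangent

variable {E : Type*} [NormedAddCommGroup E] [NormedSpace ℝ E]
  {Z : Type*} [TopologicalSpace Z] [ChartedSpace E Z] [IsManifold 𝓘(ℝ, E) ∞ Z]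

/-- The iterated tangent bundle `T(TZ)`. A point of it is `⟨⟨z, w⟩, (a, b)⟩`, where `w`, `a`, `b`
are the components with respect to the preferred chart of `Z` at `z`, i.e. `⟨z, w⟩ ∈ TZ` is the
base point and `(a, b)` are the components of a tangent vector to `TZ` at `⟨z, w⟩` in the induced
chart of `TZ`. -/
abbrev TT (E : Type*) [NormedAddCommGroup E] [NormedSpace ℝ E] (Z : Type*) [TopologicalSpace Z]
    [ChartedSpace E Z] [IsManifold 𝓘(ℝ, E) ∞ Z] :=
  TangentBundle (𝓘(ℝ, E).tangent) (TangentBundle 𝓘(ℝ, E) Z)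

/-- The canonical involution of `T(TZ)`, which in induced coordinates interchanges the two middle
components; see `canonicalFlip_velocity_velocity` for its characterization. -/
def canonicalFlip (ξ : TT E Z) : TT E Z :=
  ⟨⟨ξ.proj.proj, ξ.snd.1⟩, (ξ.proj.snd, ξ.snd.2)⟩

/-- The double projection `T(TZ) → TZ ⊕ TZ`, whose components are the base point and the image
under the differential of the projection `TZ → Z`. -/
def doubleProj (ξ : TT E Z) : TangentBundle 𝓘(ℝ, E) Z × TangentBundle 𝓘(ℝ, E) Z :=
  (ξ.proj, tangentMap (𝓘(ℝ, E).tangent) 𝓘(ℝ, E)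
    (TotalSpace.proj : TangentBundle 𝓘(ℝ, E) Z → Z) ξ)

/-- The difference `ξ - η` of two points in the same fiber of the double projection, an element of
the tangent space of `Z` on which this fiber is modelled; see `eq_add_affineDiff`. It is
only meaningful if `doubleProj ξ = doubleProj η`. -/
def affineDiff (ξ η : TT E Z) : TangentSpace 𝓘(ℝ, E) ξ.proj.proj :=
  ξ.snd.2 - η.snd.2

/-! Two facts that pin these definitions down without coordinates: `canonicalFlip` interchanges the
order of the derivatives of a map of two variables, and `affineDiff` is inverse to the vertical lift. -/

theorem velocity_eq {E H : Type*} [NormedAddCommGroup E] [NormedSpace ℝ E] [TopologicalSpace H]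
    (I : ModelWithCorners ℝ E H) {N : Type*} [TopologicalSpace N] [ChartedSpace H N]
    (c : ℝ → N) (t : ℝ) (hc : MDifferentiableAt 𝓘(ℝ, ℝ) I c t) :
    velocity I c t = ⟨c t, (fderiv ℝ (fun s => extChartAt I (c t) (c s)) t 1 : E)⟩ := by
  have h := hc.mfderiv
  simp only [writtenInExtChartAt, mfld_simps, fderivWithin_univ] at h
  rw [velocity, h]
  rfl

theorem extChartAt_tangent (v : TangentBundle 𝓘(ℝ, E) Z) (c : ℝ → Z) (t : ℝ)
    (hc : MDifferentiableAt 𝓘(ℝ, ℝ) 𝓘(ℝ, E) c t)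
    (h : c t ∈ (chartAt E v.proj).source) :
    extChartAt (𝓘(ℝ, E).tangent) v (velocity 𝓘(ℝ, E) c t) =
      (extChartAt 𝓘(ℝ, E) v.proj (c t),
        fderiv ℝ (fun s => extChartAt 𝓘(ℝ, E) v.proj (c s)) t 1) := by
  have h2 : mfderiv 𝓘(ℝ, ℝ) 𝓘(ℝ, E) (extChartAt 𝓘(ℝ, E) v.proj ∘ c) t
     = fderiv ℝ (fun s => extChartAt 𝓘(ℝ, E) v.proj (c s)) t := by
    rw [mfderiv_eq_fderiv]; rfl
  have h3 := mfderiv_comp (I := 𝓘(ℝ, ℝ)) (I' := 𝓘(ℝ, E)) (I'' := 𝓘(ℝ, E)) t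
    (mdifferentiableAt_extChartAt (I := 𝓘(ℝ, E)) h) hc
  rw [h2] at h3
  rw [h3]
  have h4 := TangentBundle.continuousLinearMapAt_trivializationAt (I := 𝓘(ℝ, E)) h
  apply Prod.ext
  · simp [velocity, mfld_simps]
  · change ((trivializationAt E (TangentSpace 𝓘(ℝ, E)) v.proj) (velocity 𝓘(ℝ, E) c t)).2 = _
    have h5 := congrArg (fun L : TangentSpace 𝓘(ℝ, E) (c t) →L[ℝ] E =>
      L (mfderiv 𝓘(ℝ, ℝ) 𝓘(ℝ, E) c t (1 : ℝ))) h4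
    refine Eq.trans ?_ h5
    have hm : c t ∈ (trivializationAt E (TangentSpace 𝓘(ℝ, E)) v.proj).baseSet := by simpa using h
    simp only [Trivialization.continuousLinearMapAt_apply]
    rw [Trivialization.coe_linearMapAt_of_mem _ hm]
    rfl

theorem velocity_velocity (γ : ℝ × ℝ → Z) (hγ : ContMDiff 𝓘(ℝ, ℝ × ℝ) 𝓘(ℝ, E) ∞ γ) :
    velocity (𝓘(ℝ, E).tangent) (fun t => velocity 𝓘(ℝ, E) (fun ε => γ (t, ε)) 0) 0 =
      ⟨⟨γ (0, 0), (fderiv ℝ (fun p => extChartAt 𝓘(ℝ, E) (γ (0, 0)) (γ p)) 0 (0, 1) : E)⟩,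
        ((fderiv ℝ (fun p => extChartAt 𝓘(ℝ, E) (γ (0, 0)) (γ p)) 0 (1, 0) : E),
          (fderiv ℝ (fderiv ℝ (fun p => extChartAt 𝓘(ℝ, E) (γ (0, 0)) (γ p))) 0 (1, 0) (0, 1)
            : E))⟩ := by
  set g : ℝ × ℝ → E := fun p => extChartAt 𝓘(ℝ, E) (γ (0, 0)) (γ p) with hg
  have hnear : ∀ᶠ p in 𝓝 (0 : ℝ × ℝ), γ p ∈ (chartAt E (γ (0, 0))).source :=
    hγ.continuous.continuousAt.eventually_mem
      ((chartAt E (γ (0, 0))).open_source.mem_nhds (mem_chart_source E (γ (0, 0))))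
  have hgs : ContDiffAt ℝ ∞ g 0 := by
    rw [← contMDiffAt_iff_contDiffAt]
    exact (contMDiffAt_extChartAt (I := 𝓘(ℝ, E)) (x := γ (0, 0))).comp (0 : ℝ × ℝ)
      (hγ.contMDiffAt)
  have hgd : ∀ᶠ p in 𝓝 (0 : ℝ × ℝ), DifferentiableAt ℝ g p := by
    filter_upwards [(hgs.of_le (m := 1) (by simp)).eventually (by simp)] with p hp
    exact hp.differentiableAt one_ne_zero
  have hline : Filter.Tendsto (fun t : ℝ => (t, (0 : ℝ))) (𝓝 0) (𝓝 0) := by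
    have : Continuous (fun t : ℝ => (t, (0 : ℝ))) := by fun_prop
    exact this.tendsto' _ _ rfl
  have hε : ∀ t : ℝ, MDifferentiableAt 𝓘(ℝ, ℝ) 𝓘(ℝ, E) (fun ε => γ (t, ε)) 0 := by
    intro t
    refine (hγ.mdifferentiable (by simp)).mdifferentiableAt.comp 0 ?_
    rw [mdifferentiableAt_iff_differentiableAt]
    fun_prop
  have hdε : ∀ t : ℝ, DifferentiableAt ℝ g (t, 0) →
      fderiv ℝ (fun ε => g (t, ε)) 0 1 = fderiv ℝ g (t, 0) (0, 1) := by
    intro t ht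
    have h1 : HasFDerivAt (fun ε : ℝ => (t, ε)) (ContinuousLinearMap.inr ℝ ℝ ℝ) 0 :=
      hasFDerivAt_prodMk_right t 0
    have h2 := (ht.hasFDerivAt.comp (0 : ℝ) h1).fderiv
    change fderiv ℝ (g ∘ fun ε => (t, ε)) 0 1 = _
    rw [h2]; simp
  set V : ℝ → TangentBundle 𝓘(ℝ, E) Z := fun t => velocity 𝓘(ℝ, E) (fun ε => γ (t, ε)) 0 with hV
  have hV0 : V 0 = ⟨γ (0, 0), (fderiv ℝ g 0 (0, 1) : E)⟩ := by
    rw [hV]; simp only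
    rw [velocity_eq _ _ _ (hε 0)]
    congr 1
    exact hdε 0 (hgd.self_of_nhds)
  have hext : ∀ᶠ t in 𝓝 (0 : ℝ), extChartAt (𝓘(ℝ, E).tangent) (V 0) (V t) =
      (g (t, 0), fderiv ℝ g (t, 0) (0, 1)) := by
    filter_upwards [hline.eventually hnear, hline.eventually hgd] with t h1 h2
    rw [← hdε t h2]
    exact extChartAt_tangent (V 0) (fun ε => γ (t, ε)) 0 (hε t) h1
  have hg' : ContDiffAt ℝ ∞ (fderiv ℝ g) 0 := hgs.fderiv_right (by simp)
  have hVd : MDifferentiableAt 𝓘(ℝ, ℝ) (𝓘(ℝ, E).tangent) V 0 := by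
    have h1 : ContMDiffAt 𝓘(ℝ, ℝ) (𝓘(ℝ, E).tangent) 1 V 0 := by
      rw [contMDiffAt_totalSpace]
      constructor
      · change ContMDiffAt 𝓘(ℝ, ℝ) 𝓘(ℝ, E) 1 (fun t : ℝ => γ (t, 0)) 0
        refine (hγ.of_le (by simp)).contMDiffAt.comp (0 : ℝ) ?_
        rw [contMDiffAt_iff_contDiffAt]
        fun_prop
      · rw [contMDiffAt_iff_contDiffAt]
        have h2 : ContDiffAt ℝ 1 (fun t : ℝ => fderiv ℝ g (t, 0) (0, 1)) 0 := by
          have h3 : ContDiffAt ℝ 1 (fderiv ℝ g) ((fun t : ℝ => (t, (0 : ℝ))) 0) :=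
            hg'.of_le (by simp)
          have h4 : ContDiffAt ℝ 1 (fun t : ℝ => (t, (0 : ℝ))) 0 := by fun_prop
          exact (ContDiffAt.comp (f := fun t : ℝ => (t, (0 : ℝ))) (0 : ℝ) h3 h4).clm_apply contDiffAt_const
        refine h2.congr_of_eventuallyEq ?_
        filter_upwards [hext] with t ht
        exact congrArg Prod.snd ht
    exact h1.mdifferentiableAt one_ne_zero
  rw [velocity_eq _ _ _ hVd]
  have hd : fderiv ℝ (fun t => extChartAt (𝓘(ℝ, E).tangent) (V 0) (V t)) 0 1 =
      (fderiv ℝ g 0 (1, 0), fderiv ℝ (fderiv ℝ g) 0 (1, 0) (0, 1)) := by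
    rw [Filter.EventuallyEq.fderiv_eq hext]
    have h1 : HasFDerivAt (fun t : ℝ => (t, (0 : ℝ))) (ContinuousLinearMap.inl ℝ ℝ ℝ) 0 :=
      hasFDerivAt_prodMk_left 0 0
    have ha : HasFDerivAt g (fderiv ℝ g 0) ((fun t : ℝ => (t, (0 : ℝ))) 0) :=
      hgd.self_of_nhds.hasFDerivAt
    have hb : HasFDerivAt (fderiv ℝ g) (fderiv ℝ (fderiv ℝ g) 0)
        ((fun t : ℝ => (t, (0 : ℝ))) 0) :=
      (hg'.differentiableAt (by simp)).hasFDerivAt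
    have h2 := (HasFDerivAt.comp (f := fun t : ℝ => (t, (0 : ℝ))) (0 : ℝ) ha h1).prodMk
      ((HasFDerivAt.comp (f := fun t : ℝ => (t, (0 : ℝ))) (0 : ℝ) hb h1).clm_apply (hasFDerivAt_const ((0 : ℝ), (1 : ℝ)) (0 : ℝ)))
    refine (congrArg (fun L : ℝ →L[ℝ] E × E => L 1) h2.fderiv).trans ?_
    simp
  rw [hd, hV0]

/-- The characterization of the canonical involution: it interchanges the order of the two
derivatives of a map `γ : ℝ² → Z`. -/
theorem canonicalFlip_velocity_velocity (γ : ℝ × ℝ → Z) (hγ : ContMDiff 𝓘(ℝ, ℝ × ℝ) 𝓘(ℝ, E) ∞ γ) :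
    canonicalFlip (velocity (𝓘(ℝ, E).tangent) (fun t => velocity 𝓘(ℝ, E) (fun ε => γ (t, ε)) 0) 0) =
      velocity (𝓘(ℝ, E).tangent) (fun t => velocity 𝓘(ℝ, E) (fun ε => γ (ε, t)) 0) 0 := by
  rw [velocity_velocity γ hγ]
  have hsw : ContMDiff 𝓘(ℝ, ℝ × ℝ) 𝓘(ℝ, ℝ × ℝ) ∞ (Prod.swap : ℝ × ℝ → ℝ × ℝ) := by
    rw [contMDiff_iff_contDiff]
    exact contDiff_snd.prodMk contDiff_fst
  refine Eq.trans ?_ (velocity_velocity (γ ∘ Prod.swap) (hγ.comp hsw)).symm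
  change _ = (⟨⟨γ (0, 0), _⟩, _⟩ : TT E Z)
  set g : ℝ × ℝ → E := fun p => extChartAt 𝓘(ℝ, E) (γ (0, 0)) (γ p) with hg
  have hgs : ContDiffAt ℝ ∞ g 0 := by
    rw [← contMDiffAt_iff_contDiffAt]
    exact (contMDiffAt_extChartAt (I := 𝓘(ℝ, E)) (x := γ (0, 0))).comp (0 : ℝ × ℝ)
      (hγ.contMDiffAt)
  set L : (ℝ × ℝ) ≃L[ℝ] (ℝ × ℝ) := ContinuousLinearEquiv.prodComm ℝ ℝ ℝ with hL
  have h1 : fderiv ℝ (g ∘ L) = fun p => (fderiv ℝ g (L p)).comp (L : (ℝ × ℝ) →L[ℝ] (ℝ × ℝ)) := by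
    funext p
    exact L.comp_right_fderiv
  have hL0 : L (0 : ℝ × ℝ) = 0 := map_zero L
  have hb : HasFDerivAt (fderiv ℝ g) (fderiv ℝ (fderiv ℝ g) 0) (L (0 : ℝ × ℝ)) := by
    rw [hL0]
    exact ((hgs.fderiv_right (m := ∞) (by simp)).differentiableAt (by simp)).hasFDerivAt
  have h2 := (hb.comp (0 : ℝ × ℝ) L.hasFDerivAt).clm_comp
    (hasFDerivAt_const (L : (ℝ × ℝ) →L[ℝ] (ℝ × ℝ)) (0 : ℝ × ℝ))
  have e1 : ∀ v, fderiv ℝ (g ∘ L) 0 v = fderiv ℝ g 0 (L v) := by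
    intro v
    rw [h1]
    simp only [hL0]
    rfl
  have e2 : fderiv ℝ (fderiv ℝ (g ∘ L)) 0 (1, 0) (0, 1) =
      fderiv ℝ (fderiv ℝ g) 0 (1, 0) (0, 1) := by
    rw [h1]
    have h3 := congrArg (fun A => A (1, 0) (0, 1)) h2.fderiv
    refine h3.trans ?_
    have hs : IsSymmSndFDerivAt ℝ g 0 :=
      hgs.isSymmSndFDerivAt (by simpa using ENat.LEInfty.out)
    rw [hs (1, 0) (0, 1)]
    simp [hL]
  change (⟨⟨γ (0, 0), (fderiv ℝ g 0 (1, 0) : E)⟩, ((fderiv ℝ g 0 (0, 1) : E),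
      (fderiv ℝ (fderiv ℝ g) 0 (1, 0) (0, 1) : E))⟩ : TT E Z) =
    ⟨⟨γ (0, 0), (fderiv ℝ (g ∘ L) 0 (0, 1) : E)⟩, ((fderiv ℝ (g ∘ L) 0 (1, 0) : E),
      (fderiv ℝ (fderiv ℝ (g ∘ L)) 0 (1, 0) (0, 1) : E))⟩
  rw [e1, e1, e2]
  rfl

theorem trivializationAt_self_apply (z : Z) (u : E) :
    ((trivializationAt E (TangentSpace 𝓘(ℝ, E)) z) (⟨z, u⟩ : TangentBundle 𝓘(ℝ, E) Z)).2 = u := by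
  exact (tangentBundleCore 𝓘(ℝ, E) Z).coordChange_self (achart E z) z (mem_chart_source E z) u

theorem velocity_vertical_line (z : Z) (w d : E) :
    velocity (𝓘(ℝ, E).tangent) (fun t : ℝ => (⟨z, (w + t • d : E)⟩ : TangentBundle 𝓘(ℝ, E) Z)) 0 =
      (⟨⟨z, w⟩, ((0 : E), d)⟩ : TT E Z) := by
  set c : ℝ → TangentBundle 𝓘(ℝ, E) Z := fun t => ⟨z, (w + t • d : E)⟩ with hc
  have hcd : MDifferentiableAt 𝓘(ℝ, ℝ) (𝓘(ℝ, E).tangent) c 0 := by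
    rw [mdifferentiableAt_totalSpace]
    refine ⟨mdifferentiableAt_const, ?_⟩
    rw [mdifferentiableAt_iff_differentiableAt]
    have : (fun t => ((trivializationAt E (TangentSpace 𝓘(ℝ, E)) (c 0).proj) (c t)).2) =
        fun t => w + t • d := funext fun t => trivializationAt_self_apply z _
    rw [this]
    fun_prop
  rw [velocity_eq _ _ _ hcd]
  have hz : c 0 = (⟨z, w⟩ : TangentBundle 𝓘(ℝ, E) Z) := by
    simp [hc]
  have hfd : fderiv ℝ (fun t => extChartAt (𝓘(ℝ, E).tangent) (c 0) (c t)) 0 1 = ((0 : E), d) := by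
    have : (fun t => extChartAt (𝓘(ℝ, E).tangent) (c 0) (c t)) =
        fun t => (extChartAt 𝓘(ℝ, E) z z, w + t • d) := by
      funext t
      refine Prod.ext rfl (trivializationAt_self_apply z _)
    rw [this]
    have h2 : HasFDerivAt (fun t : ℝ => (extChartAt 𝓘(ℝ, E) z z, w + t • d))
      ((0 : ℝ →L[ℝ] E).prod ((ContinuousLinearMap.id ℝ ℝ).smulRight d)) 0 :=
      (hasFDerivAt_const _ _).prodMk (((hasFDerivAt_id (0 : ℝ)).smul_const d).const_add _)
    rw [h2.fderiv]
    simp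
  rw [hfd, hz]

theorem mfderiv_proj (v : TangentBundle 𝓘(ℝ, E) Z) (ξ : TangentSpace (𝓘(ℝ, E).tangent) v) :
    mfderiv (𝓘(ℝ, E).tangent) 𝓘(ℝ, E)
      (TotalSpace.proj : TangentBundle 𝓘(ℝ, E) Z → Z) v ξ = ξ.1 := by
  have hd : MDifferentiableAt (𝓘(ℝ, E).tangent) 𝓘(ℝ, E)
      (TotalSpace.proj : TangentBundle 𝓘(ℝ, E) Z → Z) v :=
    (contMDiff_proj (TangentSpace 𝓘(ℝ, E)) (n := 1)).mdifferentiableAt one_ne_zero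
  rw [hd.mfderiv]
  have hw : writtenInExtChartAt (𝓘(ℝ, E).tangent) 𝓘(ℝ, E) v
      (TotalSpace.proj : TangentBundle 𝓘(ℝ, E) Z → Z) =ᶠ[𝓝 (extChartAt (𝓘(ℝ, E).tangent) v v)]
      Prod.fst := by
    filter_upwards [extChartAt_target_mem_nhds (I := 𝓘(ℝ, E).tangent) v] with y hy
    exact congrArg Prod.fst ((extChartAt (𝓘(ℝ, E).tangent) v).right_inv hy)
  have hr : Set.range (𝓘(ℝ, E).tangent) = Set.univ := (𝓘(ℝ, E).tangent).range_eq_univ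
  rw [hr, fderivWithin_univ, hw.fderiv_eq]
  exact congrArg (fun L : E × E →L[ℝ] E => L ξ) fderiv_fst

/-- The fibers of the double projection are affine spaces modelled on the tangent spaces of `Z`:
`ξ = η + vl(ξ - η)`, where `vl(d)` is the vertical lift of `d` at the common base point `v`, i.e.
the velocity of `t ↦ v + t d`. -/
theorem eq_add_affineDiff (v : TangentBundle 𝓘(ℝ, E) Z)
    (ξ η : TangentSpace (𝓘(ℝ, E).tangent) v)
    (h : doubleProj (⟨v, ξ⟩ : TT E Z) = doubleProj (⟨v, η⟩ : TT E Z)) :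
    (⟨v, ξ - η⟩ : TT E Z) = velocity (𝓘(ℝ, E).tangent)
      (fun t : ℝ => (⟨v.proj, v.snd + t • affineDiff (⟨v, ξ⟩ : TT E Z) ⟨v, η⟩⟩ :
        TangentBundle 𝓘(ℝ, E) Z)) 0 := by
  have hξ : (ξ : E × E).1 = (η : E × E).1 := by
    have h1 := congrArg Prod.snd h
    simp only [doubleProj, tangentMap] at h1
    rw [mfderiv_proj, mfderiv_proj] at h1
    exact eq_of_heq (TotalSpace.mk.inj h1).2
  refine Eq.trans ?_ (velocity_vertical_line (E := E) v.proj v.snd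
    (affineDiff (⟨v, ξ⟩ : TT E Z) ⟨v, η⟩)).symm
  refine congrArg (TotalSpace.mk v) ?_
  exact Prod.ext (sub_eq_zero.2 hξ) rfl
end IteratedTangent

/-! ### Fiber bundles, non-linear connections and their curvature -/

section Bundle

variable {EB : Type*} [NormedAddCommGroup EB] [NormedSpace ℝ EB]
  {M : Type*} [TopologicalSpace M] [ChartedSpace EB M] [IsManifold 𝓘(ℝ, EB) ∞ M]
  {EF : Type*} [NormedAddCommGroup EF] [NormedSpace ℝ EF]
  (F : Type*) [TopologicalSpace F] [ChartedSpace EF F] [IsManifold 𝓘(ℝ, EF) ∞ F]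
  {EZ : Type*} [NormedAddCommGroup EZ] [NormedSpace ℝ EZ]
  {Z : Type*} [TopologicalSpace Z] [ChartedSpace EZ Z] [IsManifold 𝓘(ℝ, EZ) ∞ Z]

/-- `pr : Z → M` is a smooth fiber bundle with model fiber `F`: it is smooth, and `M` is covered by
open sets `U` (the base sets of the trivializations `e`) with diffeomorphisms from `pr⁻¹(U)` onto
`U × F` over `U`. -/
structure IsSmoothFiberBundle (pr : Z → M) : Prop where
  smooth : ContMDiff 𝓘(ℝ, EZ) 𝓘(ℝ, EB) ∞ pr
  locally_trivial : ∀ p : M, ∃ e : Trivialization F pr, p ∈ e.baseSet ∧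
    ContMDiffOn 𝓘(ℝ, EZ) (𝓘(ℝ, EB).prod 𝓘(ℝ, EF)) ∞ e e.source ∧
    ContMDiffOn (𝓘(ℝ, EB).prod 𝓘(ℝ, EF)) 𝓘(ℝ, EZ) ∞ e.toOpenPartialHomeomorph.symm e.target

/-- The vertical tangent bundle `Vert Z = ker pr_*`, a submanifold of `TZ`, which is a fiber bundle
over `M` with projection `v ↦ pr v.proj`. -/
def verticalBundle (pr : Z → M) : Set (TangentBundle 𝓘(ℝ, EZ) Z) :=
  {v | mfderiv 𝓘(ℝ, EZ) 𝓘(ℝ, EB) pr v.proj v.snd = 0}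

/-- The tangent bundle `T(Vert Z)` of the vertical tangent bundle, a subset of `T(TZ)`. -/
def tangentVerticalBundle (pr : Z → M) : Set (TT EZ Z) :=
  tangentSet (𝓘(ℝ, EZ).tangent) (verticalBundle (EB := EB) pr)

/-- The iterated vertical tangent bundle `Vert Vert Z`: the vectors tangent to `Vert Z` that are
killed by the differential of the bundle projection `Vert Z → M`. Its fiber over `p` is
`T(T(Z_p))`, and on it `canonicalFlip` and `doubleProj` restrict to the involution and the double projection
of `T(T(Z_p))`. -/
def doubleVerticalBundle (pr : Z → M) : Set (TT EZ Z) :=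
  {ξ | ξ ∈ tangentVerticalBundle (EB := EB) pr ∧
    mfderiv (𝓘(ℝ, EZ).tangent) 𝓘(ℝ, EB)
      (fun v : TangentBundle 𝓘(ℝ, EZ) Z => pr v.proj) ξ.proj ξ.snd = 0}

/-- A non-linear (Ehresmann) connection on `pr : Z → M`: a smooth field `P` of projections of the
tangent spaces of `Z` whose images are the vertical tangent spaces. Smoothness of the section `P` of
the endomorphism bundle is expressed as smoothness of the associated bundle map `TZ → TZ`. -/
structure IsConnection (pr : Z → M) (P : EndField 𝓘(ℝ, EZ) Z) : Prop where
  smooth : ContMDiff (𝓘(ℝ, EZ).tangent) (𝓘(ℝ, EZ).tangent) ∞ P.toMap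
  idem : ∀ (z : Z) (v : TangentSpace 𝓘(ℝ, EZ) z), P z (P z v) = P z v
  range_eq : ∀ (z : Z) (v : TangentSpace 𝓘(ℝ, EZ) z),
    (∃ u, P z u = v) ↔ mfderiv 𝓘(ℝ, EZ) 𝓘(ℝ, EB) pr z v = 0

/-- A non-linear connection on the fiber bundle `Vert Z → M`: a smooth field of projections of the
tangent spaces of `Vert Z` whose images are the vertical tangent spaces of `Vert Z`. It is given by
endomorphisms of the larger spaces `T_v(TZ)`, only their restrictions to `T_v(Vert Z)` matter. -/
structure IsVerticalConnection (pr : Z → M) (Q : EndField (𝓘(ℝ, EZ).tangent)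
    (TangentBundle 𝓘(ℝ, EZ) Z)) : Prop where
  smooth : ContMDiffOn (𝓘(ℝ, EZ).tangent.tangent) (𝓘(ℝ, EZ).tangent.tangent) ∞ Q.toMap
    (tangentVerticalBundle (EB := EB) pr)
  idem : ∀ ξ ∈ tangentVerticalBundle (EB := EB) pr, Q.toMap (Q.toMap ξ) = Q.toMap ξ
  range_eq : ∀ η : TT EZ Z, η.proj ∈ verticalBundle (EB := EB) pr →
    ((∃ ξ ∈ tangentVerticalBundle (EB := EB) pr, Q.toMap ξ = η) ↔
      η ∈ doubleVerticalBundle (EB := EB) pr)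

/-- `f` is a smooth local section of `pr`, defined on the open set `U`. -/
structure IsLocalSection (pr : Z → M) (U : Set M) (f : M → Z) : Prop where
  isOpen : IsOpen U
  smooth : ContMDiffOn 𝓘(ℝ, EB) 𝓘(ℝ, EZ) ∞ f U
  proj_eq : ∀ p ∈ U, pr (f p) = p

/-- `(f ε)`, `ε ∈ ℝ`, is a smooth one-parameter family of local sections of `pr`, defined on the
open set `U`. -/
structure IsSectionFamily (pr : Z → M) (U : Set M) (f : ℝ → M → Z) : Prop where
  isOpen : IsOpen U
  smooth : ContMDiffOn (𝓘(ℝ, ℝ).prod 𝓘(ℝ, EB)) 𝓘(ℝ, EZ) ∞ (fun q : ℝ × M => f q.1 q.2)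
    (Set.univ ×ˢ U)
  proj_eq : ∀ ε, ∀ p ∈ U, pr (f ε p) = p

/-- The infinitesimal variation `d/dε|₀ f_ε` of a family of local sections. -/
def variation (f : ℝ → M → Z) (p : M) : TangentBundle 𝓘(ℝ, EZ) Z :=
  velocity 𝓘(ℝ, EZ) (fun ε => f ε p) 0

/-- `Q` is a connection on `Vert Z` that is induced by the connection `P` on `Z`:
`D^Q_X (d/dε|₀ f_ε) = Θ (d/dε|₀ D^P_X f_ε)` for all vector fields `X` on `M` and all smooth
one-parameter families of local sections. -/
structure IsInducedConnection (pr : Z → M) (P : EndField 𝓘(ℝ, EZ) Z)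
    (Q : EndField (𝓘(ℝ, EZ).tangent) (TangentBundle 𝓘(ℝ, EZ) Z)) : Prop
    extends IsVerticalConnection (EB := EB) pr Q where
  covDeriv_variation : ∀ X : (∀ p : M, TangentSpace 𝓘(ℝ, EB) p),
    IsSmoothVectorField 𝓘(ℝ, EB) X →
    ∀ (U : Set M) (f : ℝ → M → Z), IsSectionFamily (EB := EB) (EZ := EZ) pr U f → ∀ p ∈ U,
      covDeriv Q X (variation f) p =
        canonicalFlip (velocity (𝓘(ℝ, EZ).tangent) (fun ε => covDeriv P X (f ε) p) 0)

/-- `R(A, B) = -P[(1-P)A, (1-P)B] - (1-P)[PA, PB]` for vector fields `A`, `B`. -/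
def nijenhuis (P : EndField 𝓘(ℝ, EZ) Z) (A B : ∀ z : Z, TangentSpace 𝓘(ℝ, EZ) z) (z : Z) :
    TangentSpace 𝓘(ℝ, EZ) z :=
  -P z (VectorField.mlieBracket 𝓘(ℝ, EZ) (fun y => A y - P y (A y)) (fun y => B y - P y (B y)) z)
  - (VectorField.mlieBracket 𝓘(ℝ, EZ) (fun y => P y (A y)) (fun y => P y (B y)) z
    - P z (VectorField.mlieBracket 𝓘(ℝ, EZ) (fun y => P y (A y)) (fun y => P y (B y)) z))

/-- The value `R_z(a, b)` of the curvature tensor on tangent vectors at `z`, computed with smooth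
local extensions of `a` and `b` to vector fields. -/
def curvature (P : EndField 𝓘(ℝ, EZ) Z) (z : Z) (a b : TangentSpace 𝓘(ℝ, EZ) z) :
    TangentSpace 𝓘(ℝ, EZ) z :=
  nijenhuis P (FiberBundle.extend EZ a) (FiberBundle.extend EZ b) z

/-- The inner difference `D^Q_X D^P_Y f - Θ(D^Q_Y D^P_X f)` at the point `p`, taken in a fiber of the
double projection. -/
def covDerivCommutator (P : EndField 𝓘(ℝ, EZ) Z)
    (Q : EndField (𝓘(ℝ, EZ).tangent) (TangentBundle 𝓘(ℝ, EZ) Z))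
    (X Y : ∀ p : M, TangentSpace 𝓘(ℝ, EB) p) (f : M → Z) (p : M) : TangentSpace 𝓘(ℝ, EZ) (f p) :=
  affineDiff (covDeriv Q X (covDeriv P Y f) p) (canonicalFlip (covDeriv Q Y (covDeriv P X f) p))

/-- A smooth chart `φ = (x, f)` of `Z` lying over a smooth chart `x` of `M`. -/
structure IsFiberedChart (pr : Z → M) (φ : OpenPartialHomeomorph Z (EB × EF))
    (x : OpenPartialHomeomorph M EB) : Prop where
  smooth : ContMDiffOn 𝓘(ℝ, EZ) 𝓘(ℝ, EB × EF) ∞ φ φ.source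
  smooth_symm : ContMDiffOn 𝓘(ℝ, EB × EF) 𝓘(ℝ, EZ) ∞ φ.symm φ.target
  smooth_base : ContMDiffOn 𝓘(ℝ, EB) 𝓘(ℝ, EB) ∞ x x.source
  smooth_base_symm : ContMDiffOn 𝓘(ℝ, EB) 𝓘(ℝ, EB) ∞ x.symm x.target
  mapsTo : ∀ z ∈ φ.source, pr z ∈ x.source
  fst_eq : ∀ z ∈ φ.source, (φ z).1 = x (pr z)

/-- The coordinate vector field `∂/∂x` in the direction `u` of a chart `(x, f)` of `Z`, at the point
with coordinates `y`. -/
def coordVector (φ : OpenPartialHomeomorph Z (EB × EF)) (y : EB × EF) (u : EB) :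
    TangentSpace 𝓘(ℝ, EZ) (φ.symm y) :=
  mfderiv 𝓘(ℝ, EB × EF) 𝓘(ℝ, EZ) φ.symm y ((u, 0) : EB × EF)

/-- The Christoffel symbols `Γ_u(x, f)` of `P` in a chart `(x, f)`: the components with respect to
`f` of `P(∂/∂x)`, where `∂/∂x` is taken in the direction `u`. -/
def christoffel (P : EndField 𝓘(ℝ, EZ) Z) (φ : OpenPartialHomeomorph Z (EB × EF)) (y : EB × EF)
    (u : EB) : EF :=
  (show EB × EF from mfderiv 𝓘(ℝ, EZ) 𝓘(ℝ, EB × EF) φ (φ.symm y)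
    (P (φ.symm y) (coordVector φ y u))).2

end Bundle

end Ehresmann

end

open Ehresmann

/-!
In charts a connection `P` is a smooth matrix-valued function `K` with `K ∘ K = K` whose image at
each point is the kernel of `Dg`, where `g` is the bundle projection (`IsLocalConnection`).
Differentiating `K ∘ K = K` and `Dg ∘ K = 0` gives everything that is needed about `K`; the second
relation shows that `(D_{Ka} K) b - (D_{Kb} K) a` is vertical, i.e. that the vertical distribution
is involutive (`IsLocalConnection.apply_fderiv_sub`).

*Tensoriality and local formula.* By involutivity the second summand of the curvature vanishes. In
the first one the derivatives of the fields `A`, `B` drop out, because they are multiplied by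
`K(1 - K) = 0`; what remains is `localCurvature`, an expression in the values of `A` and `B`
(`IsConnection.chartVec_nijenhuis`). In a fibered chart, `K (u, c) = (0, Γ u + c)`, and this
expression becomes the formula for the coefficients (`IsFiberedChart.mfderiv_curvature`).

*The induced connection.* It is `Θ ∘ TP ∘ Θ`, in components
`(a, b) ↦ (K a, (D_w K) a + K b)` at the point `⟨z, w⟩` of `TZ` (`inducedConnection`). It is defined
with the preferred chart at each point; that all other charts give the same map follows by
differentiating the transformation law of `K` (`mfderiv_extChartAt_inducedConnection`), and this
yields smoothness. Vectors tangent to `Vert Z` are described by the equation of verticality and its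
linearization (`IsConnection.mem_tangentVerticalBundle_iff`); by the identities for `K` the induced
connection projects them onto the doubly vertical ones. That it differentiates variations of
sections as required is the symmetry of mixed partial derivatives
(`IsSectionFamily.covDeriv_inducedConnection`).

*Uniqueness.* A vertical vector `v` is the variation of a family of sections at a point `p`, and a
tangent vector at `p` extends to a global vector field by means of a bump function. Hence a vector
tangent to `Vert Z` at `v` is the sum of the derivative of a variation, on which every induced
connection has the prescribed value, and of a doubly vertical vector, which every connection on
`Vert Z` fixes (`IsInducedConnection.toMap_eq_of_variation`).

*Curvature identity.* By uniqueness the given connection may be replaced by `inducedConnection P`.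
Then both iterated derivatives of `f` are explicit in a chart (`IsConnection.covDeriv_covDeriv`), and
the identity reduces to `IsLocalConnection.localCurvature_eq`, where the second derivatives of `f`
contribute the derivative of `f` along the bracket `[X, Y]`.
-/

noncomputable section

namespace Ehresmann

/-! ### Connections on open subsets of a vector space -/

section Flat

variable {E : Type*} [NormedAddCommGroup E] [NormedSpace ℝ E]
  {B : Type*} [NormedAddCommGroup B] [NormedSpace ℝ B]

/-- A connection `K` on the map `g` in coordinates, near the point `y`: `K` is a smooth field of
projections whose image at each point is the kernel of the derivative of `g`. That the image is
the whole kernel is only recorded at `y` itself. -/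
structure IsLocalConnection (g : E → B) (K : E → E →L[ℝ] E) (y : E) : Prop where
  smooth_proj : ContDiffAt ℝ ∞ g y
  smooth : ContDiffAt ℝ ∞ K y
  idem : ∀ᶠ y' in 𝓝 y, ∀ v, K y' (K y' v) = K y' v
  vertical : ∀ᶠ y' in 𝓝 y, ∀ v, fderiv ℝ g y' (K y' v) = 0
  fix : ∀ v, fderiv ℝ g y v = 0 → K y v = v

/-- The curvature of a field of projections `K` on a vector space, in terms of the derivative
of `K`. -/
def localCurvature (K : E → E →L[ℝ] E) (y a b : E) : E :=
  K y (fderiv ℝ K y (a - K y a) b - fderiv ℝ K y (b - K y b) a)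

namespace IsLocalConnection

variable {g : E → B} {K : E → E →L[ℝ] E} {y : E} (h : IsLocalConnection g K y)
include h

theorem hasFDerivAt : HasFDerivAt K (fderiv ℝ K y) y :=
  (h.smooth.differentiableAt (by simp)).hasFDerivAt

theorem hasFDerivAt_fderiv_proj : HasFDerivAt (fderiv ℝ g) (fderiv ℝ (fderiv ℝ g) y) y :=
  ((h.smooth_proj.fderiv_right (m := ∞) (by simp)).differentiableAt (by simp)).hasFDerivAt

theorem idem_self (v : E) : K y (K y v) = K y v := h.idem.self_of_nhds v

theorem vertical_self (v : E) : fderiv ℝ g y (K y v) = 0 := h.vertical.self_of_nhds v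

/-- The derivative of `K ∘ K = K`. -/
theorem fderiv_idem (c v : E) :
    fderiv ℝ K y c (K y v) + K y (fderiv ℝ K y c v) = fderiv ℝ K y c v := by
  have h1 : HasFDerivAt (fun y' => K y' v) _ y := h.hasFDerivAt.clm_apply (hasFDerivAt_const v y)
  have h2 : HasFDerivAt (fun y' => K y' (K y' v)) _ y := h.hasFDerivAt.clm_apply h1
  have h3 : (fun y' => K y' (K y' v)) =ᶠ[𝓝 y] fun y' => K y' v := h.idem.mono fun y' hy => hy v
  have h4 := congrArg (fun A => A c) (h2.unique (h1.congr_of_eventuallyEq h3))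
  simpa [add_comm] using h4

/-- The derivative of `Dg ∘ K = 0`. -/
theorem fderiv_vertical (c v : E) :
    fderiv ℝ (fderiv ℝ g) y c (K y v) + fderiv ℝ g y (fderiv ℝ K y c v) = 0 := by
  have h1 : HasFDerivAt (fun y' => K y' v) _ y := h.hasFDerivAt.clm_apply (hasFDerivAt_const v y)
  have h2 : HasFDerivAt (fun y' => fderiv ℝ g y' (K y' v)) _ y :=
    h.hasFDerivAt_fderiv_proj.clm_apply h1
  have h3 : (fun y' => fderiv ℝ g y' (K y' v)) =ᶠ[𝓝 y] fun _ => (0 : B) :=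
    h.vertical.mono fun y' hy => hy v
  have h4 := congrArg (fun A => A c)
    (h2.unique ((hasFDerivAt_const (0 : B) y).congr_of_eventuallyEq h3))
  simpa [add_comm] using h4

theorem fderiv_fderiv_proj_symm (a b : E) :
    fderiv ℝ (fderiv ℝ g) y a b = fderiv ℝ (fderiv ℝ g) y b a :=
  (h.smooth_proj.isSymmSndFDerivAt (by simpa using ENat.LEInfty.out)) a b

/-- The vertical distribution is involutive: the bracket of the vertical fields `K a` and `K b` is
vertical. -/
theorem apply_fderiv_sub (a b : E) :
    K y (fderiv ℝ K y (K y a) b - fderiv ℝ K y (K y b) a) =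
      fderiv ℝ K y (K y a) b - fderiv ℝ K y (K y b) a := by
  refine h.fix _ ?_
  have h1 := h.fderiv_vertical (K y a) b
  have h2 := h.fderiv_vertical (K y b) a
  rw [h.fderiv_fderiv_proj_symm] at h1
  rw [map_sub, ← h1.trans h2.symm |> add_left_cancel, sub_self]

/-- If `w` is vertical, a solution `b` of the linearized equation of verticality along `a` differs
from the derivative of `K w` by a vertical vector. -/
theorem apply_sub_fderiv {w a b : E} (hw : fderiv ℝ g y w = 0)
    (hb : fderiv ℝ (fderiv ℝ g) y a w + fderiv ℝ g y b = 0) :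
    K y (b - fderiv ℝ K y a w) = b - fderiv ℝ K y a w := by
  refine h.fix _ ?_
  have h1 := h.fderiv_vertical a w
  rw [h.fix w hw] at h1
  rw [map_sub, ← h1.trans hb.symm |> add_left_cancel, sub_self]

/-- For vertical `a`, the solutions `b` of the linearized equation of verticality are fixed by the
second component of the induced connection. -/
theorem fderiv_apply_add_apply {w a b : E} (ha : fderiv ℝ g y a = 0)
    (hb : fderiv ℝ (fderiv ℝ g) y a w + fderiv ℝ g y b = 0) :
    fderiv ℝ K y w a + K y b = b := by
  rw [h.fderiv_fderiv_proj_symm] at hb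
  have h1 := h.apply_sub_fderiv ha hb
  have h2 := h.fderiv_idem w a
  rw [h.fix a ha] at h2
  rw [map_sub, add_eq_left.1 h2, sub_zero] at h1
  rw [h1]
  abel

/-- The vertical part of the bracket of two horizontal vector fields. -/
theorem apply_lieBracket_horizontal {A C : E → E} (hA : DifferentiableAt ℝ A y)
    (hC : DifferentiableAt ℝ C y) :
    K y (VectorField.lieBracket ℝ (fun y' => A y' - K y' (A y')) (fun y' => C y' - K y' (C y')) y) =
      - localCurvature K y (A y) (C y) := by
  have key : ∀ {A : E → E}, DifferentiableAt ℝ A y → ∀ c,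
      K y (fderiv ℝ (fun y' => A y' - K y' (A y')) y c) = - K y (fderiv ℝ K y c (A y)) := by
    intro A hA c
    have h1 := hA.hasFDerivAt.sub (h.hasFDerivAt.clm_apply hA.hasFDerivAt)
    have h2 : fderiv ℝ (fun y' => A y' - K y' (A y')) y = _ := h1.fderiv
    rw [h2]
    simp [h.idem_self]
  rw [VectorField.lieBracket, map_sub (K y), key hA, key hC, localCurvature, map_sub (K y)]
  abel

/-- The bracket of two vertical vector fields is vertical. -/
theorem apply_lieBracket_vertical {A C : E → E} (hA : DifferentiableAt ℝ A y)
    (hC : DifferentiableAt ℝ C y) :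
    K y (VectorField.lieBracket ℝ (fun y' => K y' (A y')) (fun y' => K y' (C y')) y) =
      VectorField.lieBracket ℝ (fun y' => K y' (A y')) (fun y' => K y' (C y')) y := by
  have key : ∀ {A : E → E}, DifferentiableAt ℝ A y → ∀ c,
      fderiv ℝ (fun y' => K y' (A y')) y c = fderiv ℝ K y c (A y) + K y (fderiv ℝ A y c) := by
    intro A hA c
    have h2 : fderiv ℝ (fun y' => K y' (A y')) y = _ :=
      (h.hasFDerivAt.clm_apply hA.hasFDerivAt).fderiv
    rw [h2]
    simp [add_comm]
  have h1 := h.apply_fderiv_sub (A y) (C y)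
  rw [VectorField.lieBracket, key hA, key hC]
  simp only [map_sub, map_add, h.idem_self] at h1 ⊢
  rw [add_sub_add_comm, h1]
  abel

/-- The curvature identity in components: the derivatives of a section along two vector fields
`X`, `Y` are `a`, `b`, the derivative of `b` along `X` is `s`, and that of `a` along `Y` is `t`. -/
theorem localCurvature_eq (a b s t : E) :
    localCurvature K y a b =
      (fderiv ℝ K y (K y b) a + K y (fderiv ℝ K y a b + K y s)) -
        (fderiv ℝ K y (K y a) b + K y (fderiv ℝ K y b a + K y t)) - K y (s - t) := by
  have h1 := h.apply_fderiv_sub a b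
  simp only [localCurvature, map_sub, map_add, h.idem_self, sub_apply] at h1 ⊢
  linear_combination (norm := module) (-1 : ℝ) • h1

end IsLocalConnection

/-- The commutator of the derivatives of `h` along two vector
fields is the derivative along their bracket. -/
theorem fderiv_apply_lieBracket {h : B → E} {X Y : B → B} {x : B} (hh : ContDiffAt ℝ ∞ h x)
    (hX : DifferentiableAt ℝ X x) (hY : DifferentiableAt ℝ Y x) :
    fderiv ℝ (fun x' => fderiv ℝ h x' (Y x')) x (X x) -
        fderiv ℝ (fun x' => fderiv ℝ h x' (X x')) x (Y x) =
      fderiv ℝ h x (VectorField.lieBracket ℝ X Y x) := by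
  have hd : HasFDerivAt (fderiv ℝ h) (fderiv ℝ (fderiv ℝ h) x) x :=
    ((hh.fderiv_right (m := ∞) (by simp)).differentiableAt (by simp)).hasFDerivAt
  have hs : fderiv ℝ (fderiv ℝ h) x (X x) (Y x) = fderiv ℝ (fderiv ℝ h) x (Y x) (X x) :=
    (hh.isSymmSndFDerivAt (by simpa using ENat.LEInfty.out)) _ _
  have key : ∀ {Y : B → B}, DifferentiableAt ℝ Y x → ∀ c,
      fderiv ℝ (fun x' => fderiv ℝ h x' (Y x')) x c =
        fderiv ℝ (fderiv ℝ h) x c (Y x) + fderiv ℝ h x (fderiv ℝ Y x c) := by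
    intro Y hY c
    have h2 : fderiv ℝ (fun x' => fderiv ℝ h x' (Y x')) x = _ :=
      (hd.clm_apply hY.hasFDerivAt).fderiv
    rw [h2]
    simp [add_comm]
  rw [key hX, key hY, hs, VectorField.lieBracket, map_sub]
  abel

end Flat

/-! ### Tangent vectors in charts -/

section Charts

variable {E : Type*} [NormedAddCommGroup E] [NormedSpace ℝ E]
  {Z : Type*} [TopologicalSpace Z] [ChartedSpace E Z]
  {E' : Type*} [NormedAddCommGroup E'] [NormedSpace ℝ E']

/-- A homeomorphism `φ` from an open subset of `Z` onto an open subset of a vector space that is a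
diffeomorphism. -/
structure IsSmoothChart (φ : OpenPartialHomeomorph Z E') : Prop where
  smooth : ContMDiffOn 𝓘(ℝ, E) 𝓘(ℝ, E') ∞ φ φ.source
  smooth_symm : ContMDiffOn 𝓘(ℝ, E') 𝓘(ℝ, E) ∞ φ.symm φ.target

theorem isSmoothChart_chartAt [IsManifold 𝓘(ℝ, E) ∞ Z] (z : Z) :
    IsSmoothChart (E := E) (chartAt E z) :=
  ⟨contMDiffOn_chart, contMDiffOn_chart_symm⟩

/-- The components of a tangent vector of `Z` in the chart `φ`. -/
def chartVec (φ : Z → E') (v : TangentBundle 𝓘(ℝ, E) Z) : E' :=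
  mfderiv 𝓘(ℝ, E) 𝓘(ℝ, E') φ v.proj v.snd

/-- The tangent vector at `φ⁻¹(y)` with the components `c` in the chart `φ`. -/
def ofChartVec (φ : OpenPartialHomeomorph Z E') (y c : E') : TangentBundle 𝓘(ℝ, E) Z :=
  ⟨φ.symm y, mfderiv 𝓘(ℝ, E') 𝓘(ℝ, E) φ.symm y c⟩

/-- The matrix, in the chart `φ`, of a field of endomorphisms of the tangent spaces. -/
def chartRep (P : EndField 𝓘(ℝ, E) Z) (φ : OpenPartialHomeomorph Z E') (y : E') : E' →L[ℝ] E' :=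
  (mfderiv 𝓘(ℝ, E) 𝓘(ℝ, E') φ (φ.symm y)).comp
    ((P (φ.symm y)).comp (mfderiv 𝓘(ℝ, E') 𝓘(ℝ, E) φ.symm y))

namespace IsSmoothChart

variable {φ : OpenPartialHomeomorph Z E'} (h : IsSmoothChart (E := E) φ)
include h

theorem mdifferentiable : φ.MDifferentiable 𝓘(ℝ, E) 𝓘(ℝ, E') :=
  ⟨h.smooth.mdifferentiableOn (by simp), h.smooth_symm.mdifferentiableOn (by simp)⟩

theorem contMDiffAt {z : Z} (hz : z ∈ φ.source) : ContMDiffAt 𝓘(ℝ, E) 𝓘(ℝ, E') ∞ φ z :=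
  h.smooth.contMDiffAt (φ.open_source.mem_nhds hz)

theorem contMDiffAt_symm {y : E'} (hy : y ∈ φ.target) :
    ContMDiffAt 𝓘(ℝ, E') 𝓘(ℝ, E) ∞ φ.symm y :=
  h.smooth_symm.contMDiffAt (φ.open_target.mem_nhds hy)

theorem mfderiv_symm_mfderiv {z : Z} (hz : z ∈ φ.source) (v : TangentSpace 𝓘(ℝ, E) z) :
    mfderiv 𝓘(ℝ, E') 𝓘(ℝ, E) φ.symm (φ z) (mfderiv 𝓘(ℝ, E) 𝓘(ℝ, E') φ z v) = v :=
  congrArg (fun A => A v) (h.mdifferentiable.symm_comp_deriv hz)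

theorem mfderiv_mfderiv_symm {y : E'} (hy : y ∈ φ.target) (c : E') :
    mfderiv 𝓘(ℝ, E) 𝓘(ℝ, E') φ (φ.symm y) (mfderiv 𝓘(ℝ, E') 𝓘(ℝ, E) φ.symm y c) = c :=
  congrArg (fun A => A c) (h.mdifferentiable.comp_symm_deriv hy)

theorem chartVec_ofChartVec {y : E'} (hy : y ∈ φ.target) (c : E') :
    chartVec φ (ofChartVec (E := E) φ y c) = c :=
  h.mfderiv_mfderiv_symm hy c

theorem ofChartVec_chartVec {v : TangentBundle 𝓘(ℝ, E) Z} (hv : v.proj ∈ φ.source) :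
    ofChartVec φ (φ v.proj) (chartVec φ v) = v := by
  obtain ⟨z, v⟩ := v
  have key : ∀ z', z' = z → ∀ v' : E, v' = v →
      (⟨z', v'⟩ : TangentBundle 𝓘(ℝ, E) Z) = ⟨z, v⟩ := by
    rintro _ rfl _ rfl; rfl
  exact key _ (φ.left_inv hv) _ (h.mfderiv_symm_mfderiv hv v)

/-- In a chart, a field of endomorphisms acts on components through its matrix. -/
theorem chartVec_toMap (P : EndField 𝓘(ℝ, E) Z) {v : TangentBundle 𝓘(ℝ, E) Z}
    (hv : v.proj ∈ φ.source) :
    chartVec φ (P.toMap v) = chartRep P φ (φ v.proj) (chartVec φ v) := by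
  obtain ⟨z, v⟩ := v
  change _ = mfderiv 𝓘(ℝ, E) 𝓘(ℝ, E') φ (φ.symm (φ z)) (P (φ.symm (φ z))
    (mfderiv 𝓘(ℝ, E') 𝓘(ℝ, E) φ.symm (φ z) (mfderiv 𝓘(ℝ, E) 𝓘(ℝ, E') φ z v)))
  rw [h.mfderiv_symm_mfderiv hv]
  have key : ∀ z', z' = z → ∀ v' : E, chartVec φ (P.toMap ⟨z, v'⟩) =
      mfderiv 𝓘(ℝ, E) 𝓘(ℝ, E') φ z' (P z' v') := by
    rintro _ rfl _; rfl
  exact key _ (φ.left_inv hv) v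

theorem contMDiffAt_chartVec [IsManifold 𝓘(ℝ, E) ∞ Z] {v : TangentBundle 𝓘(ℝ, E) Z}
    (hv : v.proj ∈ φ.source) :
    ContMDiffAt (𝓘(ℝ, E).tangent) 𝓘(ℝ, E') ∞ (chartVec φ : TangentBundle 𝓘(ℝ, E) Z → E') v := by
  have h1 := h.smooth.contMDiffOn_tangentMapWithin (m := ∞) (by simp)
    φ.open_source.uniqueMDiffOn
  have h2 : ContMDiffAt (𝓘(ℝ, E).tangent) (𝓘(ℝ, E').tangent) ∞
      (tangentMapWithin 𝓘(ℝ, E) 𝓘(ℝ, E') φ φ.source) v :=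
    h1.contMDiffAt ((φ.open_source.preimage (FiberBundle.continuous_proj E _)).mem_nhds hv)
  have h3 := (contMDiff_snd_tangentBundle_modelSpace (n := ∞) E' 𝓘(ℝ, E')).contMDiffAt.comp v h2
  refine h3.congr_of_eventuallyEq ?_
  filter_upwards [(φ.open_source.preimage (FiberBundle.continuous_proj E _)).mem_nhds hv] with w hw
  have h4 : mfderivWithin 𝓘(ℝ, E) 𝓘(ℝ, E') φ φ.source w.proj =
    mfderiv 𝓘(ℝ, E) 𝓘(ℝ, E') φ w.proj := mfderivWithin_of_isOpen φ.open_source hw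
  exact (congrArg (fun A => A w.snd) h4).symm

theorem contMDiffAt_ofChartVec [IsManifold 𝓘(ℝ, E) ∞ Z] {N : Type*} [TopologicalSpace N]
    {EN HN : Type*} [NormedAddCommGroup EN] [NormedSpace ℝ EN] [TopologicalSpace HN]
    [ChartedSpace HN N] {J : ModelWithCorners ℝ EN HN} {n : N} {a b : N → E'}
    (hy : a n ∈ φ.target) (ha : ContMDiffAt J 𝓘(ℝ, E') ∞ a n) (hb : ContMDiffAt J 𝓘(ℝ, E') ∞ b n) :
    ContMDiffAt J (𝓘(ℝ, E).tangent) ∞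
      (fun n => ofChartVec (E := E) φ (a n) (b n)) n := by
  have h1 := h.smooth_symm.contMDiffOn_tangentMapWithin (m := ∞) (by simp)
    φ.open_target.uniqueMDiffOn
  have h0 : ContMDiffAt J (𝓘(ℝ, E').tangent) ∞
      (fun n => (⟨a n, b n⟩ : TangentBundle 𝓘(ℝ, E') E')) n := by
    rw [contMDiffAt_totalSpace]
    refine ⟨ha, ?_⟩
    simpa using hb
  have hnh : {w : TangentBundle 𝓘(ℝ, E') E' | w.proj ∈ φ.target} ∈
      𝓝 (⟨a n, b n⟩ : TangentBundle 𝓘(ℝ, E') E') :=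
    (φ.open_target.preimage (FiberBundle.continuous_proj E' _)).mem_nhds hy
  have h2 : ContMDiffAt (𝓘(ℝ, E').tangent) (𝓘(ℝ, E).tangent) ∞
      (tangentMapWithin 𝓘(ℝ, E') 𝓘(ℝ, E) φ.symm φ.target) ⟨a n, b n⟩ :=
    h1.contMDiffAt hnh
  refine (h2.comp n h0).congr_of_eventuallyEq ?_
  filter_upwards [h0.continuousAt hnh] with m hm
  have h4 : mfderivWithin 𝓘(ℝ, E') 𝓘(ℝ, E) φ.symm φ.target (a m) =
    mfderiv 𝓘(ℝ, E') 𝓘(ℝ, E) φ.symm (a m) := mfderivWithin_of_isOpen φ.open_target hm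
  exact congrArg (fun A => (⟨φ.symm (a m), A (b m)⟩ : TangentBundle 𝓘(ℝ, E) Z)) h4.symm

theorem contDiffAt_chartRep [IsManifold 𝓘(ℝ, E) ∞ Z] [FiniteDimensional ℝ E']
    {P : EndField 𝓘(ℝ, E) Z}
    (hP : ContMDiff (𝓘(ℝ, E).tangent) (𝓘(ℝ, E).tangent) ∞ P.toMap) {y : E'} (hy : y ∈ φ.target) :
    ContDiffAt ℝ ∞ (chartRep P φ) y := by
  suffices ContDiffOn ℝ ∞ (chartRep P φ) φ.target from
    this.contDiffAt (φ.open_target.mem_nhds hy)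
  rw [contDiffOn_clm_apply]
  intro c y hy
  refine ContDiffAt.contDiffWithinAt ?_
  rw [← contMDiffAt_iff_contDiffAt]
  have h1 := h.contMDiffAt_ofChartVec (J := 𝓘(ℝ, E')) (n := y) (a := id) (b := fun _ => c) hy
    contMDiffAt_id contMDiffAt_const
  have h2 := hP.contMDiffAt.comp y h1
  have h3 := (h.contMDiffAt_chartVec (v := P.toMap (ofChartVec φ y c)) (φ.map_target hy)).comp y h2
  exact h3

theorem contMDiffAt_comp_chartVec [IsManifold 𝓘(ℝ, E) ∞ Z] {A : ∀ z : Z, TangentSpace 𝓘(ℝ, E) z}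
    {y : E'} (hy : y ∈ φ.target) (hA : IsSmoothVectorFieldAt 𝓘(ℝ, E) A (φ.symm y)) :
    ContDiffAt ℝ ∞
      (fun y => chartVec φ (⟨φ.symm y, A (φ.symm y)⟩ : TangentBundle 𝓘(ℝ, E) Z)) y := by
  rw [← contMDiffAt_iff_contDiffAt]
  exact (h.contMDiffAt_chartVec (v := ⟨φ.symm y, A (φ.symm y)⟩) (φ.map_target hy)).comp y
    (hA.comp y (h.contMDiffAt_symm hy))

end IsSmoothChart

section Preferred

omit [NormedSpace ℝ E] in
theorem symm_chartAt_self (z : Z) : (chartAt E z).symm (chartAt E z z) = z :=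
  (chartAt E z).left_inv (mem_chart_source E z)

variable [IsManifold 𝓘(ℝ, E) ∞ Z]

theorem trivializationAt_eq_chartVec (z : Z) {v : TangentBundle 𝓘(ℝ, E) Z}
    (hv : v.proj ∈ (chartAt E z).source) :
    (trivializationAt E (TangentSpace 𝓘(ℝ, E)) z v).2 = chartVec (chartAt E z) v := by
  have h4 := TangentBundle.continuousLinearMapAt_trivializationAt (I := 𝓘(ℝ, E)) hv
  have hm : v.proj ∈ (trivializationAt E (TangentSpace 𝓘(ℝ, E)) z).baseSet := by simpa using hv
  have h5 := congrArg (fun A => A v.snd) h4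
  simp only [Trivialization.continuousLinearMapAt_apply] at h5
  rw [Trivialization.coe_linearMapAt_of_mem _ hm] at h5
  exact h5

theorem mfderiv_chartAt_self (z : Z) (v : TangentSpace 𝓘(ℝ, E) z) :
    mfderiv 𝓘(ℝ, E) 𝓘(ℝ, E) (chartAt E z) z v = v :=
  congrArg (fun A => A v) (mfderiv_extChartAt_self (I := 𝓘(ℝ, E)) (x := z))

theorem chartVec_chartAt_self (z : Z) (v : TangentSpace 𝓘(ℝ, E) z) :
    chartVec (chartAt E z) ⟨z, v⟩ = v :=
  mfderiv_chartAt_self z v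

theorem chartRep_chartAt_self (P : EndField 𝓘(ℝ, E) Z) (z : Z) (v : E) :
    chartRep P (chartAt E z) (chartAt E z z) v = P z v := by
  have h := (isSmoothChart_chartAt (E := E) z).chartVec_toMap P (v := ⟨z, v⟩)
    (mem_chart_source E z)
  refine (congrArg _ (chartVec_chartAt_self z v)).symm.trans (h.symm.trans ?_)
  exact chartVec_chartAt_self z _

end Preferred

end Charts

/-! ### The curvature in a chart -/

section Curvature

variable {EB : Type*} [NormedAddCommGroup EB] [NormedSpace ℝ EB]
  {M : Type*} [TopologicalSpace M] [ChartedSpace EB M]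
  {EZ : Type*} [NormedAddCommGroup EZ] [NormedSpace ℝ EZ]
  {Z : Type*} [TopologicalSpace Z] [ChartedSpace EZ Z]
  {E' : Type*} [NormedAddCommGroup E'] [NormedSpace ℝ E']
  {B' : Type*} [NormedAddCommGroup B'] [NormedSpace ℝ B']

/-- The Lie bracket of vector fields may be computed in any chart. -/
theorem IsSmoothChart.chartVec_mlieBracket [IsManifold 𝓘(ℝ, EZ) ∞ Z] [FiniteDimensional ℝ E']
    {φ : OpenPartialHomeomorph Z E'} (h : IsSmoothChart (E := EZ) φ) {y : E'} (hy : y ∈ φ.target)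
    {V W : ∀ z : Z, TangentSpace 𝓘(ℝ, EZ) z} (hV : IsSmoothVectorFieldAt 𝓘(ℝ, EZ) V (φ.symm y))
    (hW : IsSmoothVectorFieldAt 𝓘(ℝ, EZ) W (φ.symm y)) :
    chartVec φ (⟨φ.symm y, VectorField.mlieBracket 𝓘(ℝ, EZ) V W (φ.symm y)⟩ :
        TangentBundle 𝓘(ℝ, EZ) Z) =
      VectorField.lieBracket ℝ
        (fun y => chartVec φ (⟨φ.symm y, V (φ.symm y)⟩ : TangentBundle 𝓘(ℝ, EZ) Z))
        (fun y => chartVec φ (⟨φ.symm y, W (φ.symm y)⟩ : TangentBundle 𝓘(ℝ, EZ) Z)) y := by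
  have hinv : ∀ y ∈ φ.target, ∀ v : TangentSpace 𝓘(ℝ, EZ) (φ.symm y),
      (mfderiv 𝓘(ℝ, E') 𝓘(ℝ, EZ) φ.symm y).inverse v =
        mfderiv 𝓘(ℝ, EZ) 𝓘(ℝ, E') φ (φ.symm y) v := by
    intro y hy v
    have h1 := h.mdifferentiable.symm_comp_deriv (φ.map_target hy)
    rw [φ.right_inv hy] at h1
    exact congrArg (fun A => A v)
      (ContinuousLinearMap.inverse_eq h1 (h.mdifferentiable.comp_symm_deriv hy))
  have hpull : ∀ V : (∀ z : Z, TangentSpace 𝓘(ℝ, EZ) z), ∀ y ∈ φ.target,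
      VectorField.mpullback 𝓘(ℝ, E') 𝓘(ℝ, EZ) φ.symm V y =
        chartVec φ (⟨φ.symm y, V (φ.symm y)⟩ : TangentBundle 𝓘(ℝ, EZ) Z) := by
    intro V y hy
    rw [VectorField.mpullback_apply, hinv y hy]
    rfl
  have : IsManifold 𝓘(ℝ, EZ) (minSmoothness ℝ 2) Z := by
    rw [minSmoothness_of_isRCLikeNormedField]
    infer_instance
  have key := VectorField.mpullback_mlieBracket (I := 𝓘(ℝ, E')) (n := ∞)
    (hV.mdifferentiableAt (by simp)) (hW.mdifferentiableAt (by simp))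
    (h.contMDiffAt_symm hy) (by simpa using ENat.LEInfty.out)
  rw [hpull _ y hy] at key
  rw [key, ← VectorField.mlieBracketWithin_univ,
    VectorField.mlieBracketWithin_eq_lieBracketWithin]
  refine (congrFun VectorField.lieBracketWithin_univ y).trans ?_
  have hev : ∀ᶠ y in 𝓝 y, y ∈ φ.target := φ.open_target.mem_nhds hy
  exact Filter.EventuallyEq.lieBracket_vectorField_eq (hev.mono (hpull V)) (hev.mono (hpull W))

/-- The derivative of a map between manifolds, written in charts. -/
theorem fderiv_comp_chart {φ : OpenPartialHomeomorph Z E'} (h : IsSmoothChart (E := EZ) φ)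
    {x : OpenPartialHomeomorph M B'} (hx : IsSmoothChart (E := EB) x) {pr : Z → M} {y : E'}
    (hpr : MDifferentiableAt 𝓘(ℝ, EZ) 𝓘(ℝ, EB) pr (φ.symm y)) (hy : y ∈ φ.target)
    (hxy : pr (φ.symm y) ∈ x.source) (c : E') :
    fderiv ℝ (x ∘ pr ∘ φ.symm) y c = mfderiv 𝓘(ℝ, EB) 𝓘(ℝ, B') x (pr (φ.symm y))
      (mfderiv 𝓘(ℝ, EZ) 𝓘(ℝ, EB) pr (φ.symm y) (mfderiv 𝓘(ℝ, E') 𝓘(ℝ, EZ) φ.symm y c)) := by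
  have h1 := (h.mdifferentiable.mdifferentiableAt_symm hy).hasMFDerivAt
  have h2 := (hx.mdifferentiable.mdifferentiableAt hxy).hasMFDerivAt
  have h3 := (h2.comp y (hpr.hasMFDerivAt.comp y h1)).mfderiv
  rw [mfderiv_eq_fderiv] at h3
  exact congrArg (fun A => A c) h3

/-- The components of the image of a tangent vector under the derivative of a map. -/
theorem IsSmoothChart.chartVec_mfderiv {φ : OpenPartialHomeomorph Z E'}
    (h : IsSmoothChart (E := EZ) φ) {x : OpenPartialHomeomorph M B'}
    (hx : IsSmoothChart (E := EB) x) {f : Z → M} {v : TangentBundle 𝓘(ℝ, EZ) Z}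
    (hf : MDifferentiableAt 𝓘(ℝ, EZ) 𝓘(ℝ, EB) f v.proj) (hv : v.proj ∈ φ.source)
    (hv' : f v.proj ∈ x.source) :
    chartVec x (⟨f v.proj, mfderiv 𝓘(ℝ, EZ) 𝓘(ℝ, EB) f v.proj v.snd⟩ : TangentBundle 𝓘(ℝ, EB) M) =
      fderiv ℝ (x ∘ f ∘ φ.symm) (φ v.proj) (chartVec φ v) := by
  have h1 := fderiv_comp_chart h hx (pr := f) (y := φ v.proj) (by rwa [φ.left_inv hv])
    (φ.map_source hv) (by rwa [φ.left_inv hv]) (chartVec φ v)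
  refine (h1.trans ?_).symm
  -- the right hand side of `h1` is a function of the vector with the components of `v`
  exact congrArg (fun u : TangentBundle 𝓘(ℝ, EZ) Z => (show B' from
    mfderiv 𝓘(ℝ, EB) 𝓘(ℝ, B') x (f u.proj)
        (mfderiv 𝓘(ℝ, EZ) 𝓘(ℝ, EB) f u.proj u.snd))) (h.ofChartVec_chartVec hv)

variable [IsManifold 𝓘(ℝ, EZ) ∞ Z]

namespace IsConnection

variable {pr : Z → M} {P : EndField 𝓘(ℝ, EZ) Z} (hP : IsConnection (EB := EB) pr P)
include hP

theorem toMap_toMap (v : TangentBundle 𝓘(ℝ, EZ) Z) : P.toMap (P.toMap v) = P.toMap v :=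
  congrArg (TotalSpace.mk v.proj) (hP.idem v.proj v.snd)

/-- In charts of the total space and of the base, a connection is a smooth field of projections
onto the kernel of the derivative of the bundle projection. -/
theorem isLocalConnection [FiniteDimensional ℝ E'] (hpr : ContMDiff 𝓘(ℝ, EZ) 𝓘(ℝ, EB) ∞ pr)
    {φ : OpenPartialHomeomorph Z E'} (h : IsSmoothChart (E := EZ) φ)
    {x : OpenPartialHomeomorph M B'} (hx : IsSmoothChart (E := EB) x) {y : E'} (hy : y ∈ φ.target)
    (hxy : pr (φ.symm y) ∈ x.source) :
    IsLocalConnection (x ∘ pr ∘ φ.symm) (chartRep P φ) y := by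
  have hd : ∀ {z}, MDifferentiableAt 𝓘(ℝ, EZ) 𝓘(ℝ, EB) pr z := fun {z} =>
    hpr.mdifferentiable (by simp) z
  have hpc : ContMDiffAt 𝓘(ℝ, E') 𝓘(ℝ, EB) ∞ (pr ∘ φ.symm) y :=
    hpr.contMDiffAt.comp y (h.contMDiffAt_symm hy)
  refine ⟨?_, h.contDiffAt_chartRep hP.smooth hy, ?_, ?_, ?_⟩
  · rw [← contMDiffAt_iff_contDiffAt]
    exact (hx.contMDiffAt hxy).comp y hpc
  · filter_upwards [φ.open_target.mem_nhds hy] with y hy c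
    have h1 := h.chartVec_toMap P (v := P.toMap (ofChartVec φ y c)) (φ.map_target hy)
    have h2 : φ (P.toMap (ofChartVec (E := EZ) φ y c)).proj = y := φ.right_inv hy
    rw [h2, hP.toMap_toMap] at h1
    exact h1.symm
  · filter_upwards [φ.open_target.mem_nhds hy,
      hpc.continuousAt.eventually_mem (x.open_source.mem_nhds hxy)] with y hy hxy c
    rw [fderiv_comp_chart h hx hd hy hxy]
    have h1 : mfderiv 𝓘(ℝ, E') 𝓘(ℝ, EZ) φ.symm y (chartRep P φ y c) =
        P (φ.symm y) (mfderiv 𝓘(ℝ, E') 𝓘(ℝ, EZ) φ.symm y c) := by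
      have h2 := h.mfderiv_symm_mfderiv (φ.map_target hy)
        (P (φ.symm y) (mfderiv 𝓘(ℝ, E') 𝓘(ℝ, EZ) φ.symm y c))
      rwa [φ.right_inv hy] at h2
    rw [h1, (hP.range_eq _ _).1 ⟨_, rfl⟩]
    exact map_zero _
  · intro c hc
    rw [fderiv_comp_chart h hx hd hy hxy] at hc
    have h1 := hx.mdifferentiable.mfderiv_injective hxy (hc.trans (map_zero _).symm)
    obtain ⟨u, hu⟩ := (hP.range_eq _ _).2 h1
    have h2 : P (φ.symm y) (mfderiv 𝓘(ℝ, E') 𝓘(ℝ, EZ) φ.symm y c) =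
        mfderiv 𝓘(ℝ, E') 𝓘(ℝ, EZ) φ.symm y c := by
      rw [← hu, hP.idem]
    exact (congrArg _ h2).trans (h.mfderiv_mfderiv_symm hy c)

theorem isSmoothVectorFieldAt {A : ∀ z : Z, TangentSpace 𝓘(ℝ, EZ) z} {z : Z}
    (hA : IsSmoothVectorFieldAt 𝓘(ℝ, EZ) A z) :
    IsSmoothVectorFieldAt 𝓘(ℝ, EZ) (fun z => P z (A z)) z :=
  hP.smooth.contMDiffAt.comp z hA

/-- The curvature of a connection in a chart of the total space, both for its definition and for
the expression `-P[(1-P)A, (1-P)B]`. -/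
theorem chartVec_nijenhuis [IsManifold 𝓘(ℝ, EB) ∞ M] [FiniteDimensional ℝ E']
    (hpr : ContMDiff 𝓘(ℝ, EZ) 𝓘(ℝ, EB) ∞ pr)
    {φ : OpenPartialHomeomorph Z E'} (h : IsSmoothChart (E := EZ) φ) {z : Z} (hz : z ∈ φ.source)
    {A B : ∀ z : Z, TangentSpace 𝓘(ℝ, EZ) z} (hA : IsSmoothVectorFieldAt 𝓘(ℝ, EZ) A z)
    (hB : IsSmoothVectorFieldAt 𝓘(ℝ, EZ) B z) :
    chartVec φ (⟨z, nijenhuis P A B z⟩ : TangentBundle 𝓘(ℝ, EZ) Z) =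
        localCurvature (chartRep P φ) (φ z) (chartVec φ (⟨z, A z⟩ : TangentBundle 𝓘(ℝ, EZ) Z))
          (chartVec φ (⟨z, B z⟩ : TangentBundle 𝓘(ℝ, EZ) Z)) ∧
      chartVec φ (⟨z, -P z (VectorField.mlieBracket 𝓘(ℝ, EZ)
          (fun y => A y - P y (A y)) (fun y => B y - P y (B y)) z)⟩ : TangentBundle 𝓘(ℝ, EZ) Z) =
        localCurvature (chartRep P φ) (φ z) (chartVec φ (⟨z, A z⟩ : TangentBundle 𝓘(ℝ, EZ) Z))
          (chartVec φ (⟨z, B z⟩ : TangentBundle 𝓘(ℝ, EZ) Z)) := by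
  obtain ⟨y, hy, rfl⟩ : ∃ y ∈ φ.target, φ.symm y = z :=
    ⟨φ z, φ.map_source hz, φ.left_inv hz⟩
  rw [φ.right_inv hy]
  have hK := hP.isLocalConnection hpr h (isSmoothChart_chartAt (E := EB) (pr (φ.symm y))) hy
    (mem_chart_source EB _)
  have hPA := hP.isSmoothVectorFieldAt hA
  have hPB := hP.isSmoothVectorFieldAt hB
  -- the components of `P W` in the chart
  have e0 : ∀ W : (∀ z : Z, TangentSpace 𝓘(ℝ, EZ) z), ∀ y ∈ φ.target,
      chartVec φ (⟨φ.symm y, P (φ.symm y) (W (φ.symm y))⟩ : TangentBundle 𝓘(ℝ, EZ) Z) =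
        chartRep P φ y (chartVec φ (⟨φ.symm y, W (φ.symm y)⟩ : TangentBundle 𝓘(ℝ, EZ) Z)) := by
    intro W y hy
    have h1 := h.chartVec_toMap P (v := ⟨φ.symm y, W (φ.symm y)⟩) (φ.map_target hy)
    rwa [φ.right_inv hy] at h1
  have hev : ∀ᶠ y in 𝓝 y, y ∈ φ.target := φ.open_target.mem_nhds hy
  have e1 : chartVec φ (⟨φ.symm y, VectorField.mlieBracket 𝓘(ℝ, EZ)
      (fun y => A y - P y (A y)) (fun y => B y - P y (B y)) (φ.symm y)⟩ :
        TangentBundle 𝓘(ℝ, EZ) Z) = _ :=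
    (h.chartVec_mlieBracket hy (hA.sub_section hPA) (hB.sub_section hPB)).trans
      (Filter.EventuallyEq.lieBracket_vectorField_eq
        (hev.mono fun y hy => (map_sub (mfderiv 𝓘(ℝ, EZ) 𝓘(ℝ, E') φ (φ.symm y)) _ _).trans
          (congrArg _ (e0 A y hy)))
        (hev.mono fun y hy => (map_sub (mfderiv 𝓘(ℝ, EZ) 𝓘(ℝ, E') φ (φ.symm y)) _ _).trans
          (congrArg _ (e0 B y hy))))
  have e2 : chartVec φ (⟨φ.symm y, VectorField.mlieBracket 𝓘(ℝ, EZ)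
      (fun y => P y (A y)) (fun y => P y (B y)) (φ.symm y)⟩ :
        TangentBundle 𝓘(ℝ, EZ) Z) = _ :=
    (h.chartVec_mlieBracket hy hPA hPB).trans
      (Filter.EventuallyEq.lieBracket_vectorField_eq (hev.mono (e0 A)) (hev.mono (e0 B)))
  have dA := (h.contMDiffAt_comp_chartVec hy hA).differentiableAt (by simp)
  have dB := (h.contMDiffAt_comp_chartVec hy hB).differentiableAt (by simp)
  have e3 := (e0 _ y hy).trans ((congrArg _ e1).trans (hK.apply_lieBracket_horizontal dA dB))
  have e4 := (e0 _ y hy).trans ((congrArg _ e2).trans (hK.apply_lieBracket_vertical dA dB))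
  have e5 := (map_neg (mfderiv 𝓘(ℝ, EZ) 𝓘(ℝ, E') φ (φ.symm y)) _).trans
    ((congrArg Neg.neg e3).trans (neg_neg _))
  refine ⟨?_, e5⟩
  refine (map_sub (mfderiv 𝓘(ℝ, EZ) 𝓘(ℝ, E') φ (φ.symm y)) _ _).trans ?_
  refine (congrArg₂ _ e5 ((map_sub (mfderiv 𝓘(ℝ, EZ) 𝓘(ℝ, E') φ (φ.symm y)) _ _).trans
    (congrArg₂ _ e2 e4))).trans ?_
  exact (congrArg _ (sub_self _)).trans (sub_zero _)

/-- The curvature tensor in a chart of the total space. -/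
theorem chartVec_curvature [IsManifold 𝓘(ℝ, EB) ∞ M] [FiniteDimensional ℝ EZ]
    [FiniteDimensional ℝ E']
    (hpr : ContMDiff 𝓘(ℝ, EZ) 𝓘(ℝ, EB) ∞ pr)
    {φ : OpenPartialHomeomorph Z E'} (h : IsSmoothChart (E := EZ) φ) {z : Z} (hz : z ∈ φ.source)
    (a b : TangentSpace 𝓘(ℝ, EZ) z) :
    chartVec φ (⟨z, curvature P z a b⟩ : TangentBundle 𝓘(ℝ, EZ) Z) =
      localCurvature (chartRep P φ) (φ z) (chartVec φ (⟨z, a⟩ : TangentBundle 𝓘(ℝ, EZ) Z))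
        (chartVec φ (⟨z, b⟩ : TangentBundle 𝓘(ℝ, EZ) Z)) := by
  have h1 := (hP.chartVec_nijenhuis hpr h hz
    (FiberBundle.contMDiffAt_extend 𝓘(ℝ, EZ) EZ (k := ∞) a)
    (FiberBundle.contMDiffAt_extend 𝓘(ℝ, EZ) EZ (k := ∞) b)).1
  rw [FiberBundle.extend_apply_self, FiberBundle.extend_apply_self] at h1
  exact h1

/-- The curvature is a tensor, given by the vertical part of the bracket of horizontal fields: all
three expressions have the same components in a chart. -/
theorem nijenhuis_eq [IsManifold 𝓘(ℝ, EB) ∞ M] [FiniteDimensional ℝ EZ]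
    (hpr : ContMDiff 𝓘(ℝ, EZ) 𝓘(ℝ, EB) ∞ pr) {z : Z}
    {A B : ∀ z : Z, TangentSpace 𝓘(ℝ, EZ) z} (hA : IsSmoothVectorFieldAt 𝓘(ℝ, EZ) A z)
    (hB : IsSmoothVectorFieldAt 𝓘(ℝ, EZ) B z) :
    nijenhuis P A B z = curvature P z (A z) (B z) ∧
      curvature P z (A z) (B z) =
        -P z (VectorField.mlieBracket 𝓘(ℝ, EZ)
          (fun y => A y - P y (A y)) (fun y => B y - P y (B y)) z) := by
  have hc := isSmoothChart_chartAt (E := EZ) z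
  have h1 := hP.chartVec_nijenhuis hpr hc (mem_chart_source EZ z) hA hB
  have h2 := hP.chartVec_curvature hpr hc (mem_chart_source EZ z) (A z) (B z)
  have hinj := hc.mdifferentiable.mfderiv_injective (mem_chart_source EZ z)
  exact ⟨hinj (h1.1.trans h2.symm), hinj (h2.trans h1.2.symm)⟩

end IsConnection

end Curvature

/-! ### Christoffel symbols -/

section Christoffel

variable {EB : Type*} [NormedAddCommGroup EB] [NormedSpace ℝ EB]
  {M : Type*} [TopologicalSpace M] [ChartedSpace EB M]
  {EF : Type*} [NormedAddCommGroup EF] [NormedSpace ℝ EF]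
  {EZ : Type*} [NormedAddCommGroup EZ] [NormedSpace ℝ EZ]
  {Z : Type*} [TopologicalSpace Z] [ChartedSpace EZ Z]
  {pr : Z → M} {φ : OpenPartialHomeomorph Z (EB × EF)} {x : OpenPartialHomeomorph M EB}

namespace IsFiberedChart

variable (h : IsFiberedChart (EZ := EZ) pr φ x)
include h

theorem isSmoothChart : IsSmoothChart (E := EZ) φ := ⟨h.smooth, h.smooth_symm⟩

theorem isSmoothChart_base : IsSmoothChart (E := EB) x := ⟨h.smooth_base, h.smooth_base_symm⟩

theorem proj_symm_mem {y : EB × EF} (hy : y ∈ φ.target) : pr (φ.symm y) ∈ x.source :=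
  h.mapsTo _ (φ.map_target hy)

/-- In a fibered chart the bundle projection is the first projection. -/
theorem proj_symm_eq {y : EB × EF} (hy : y ∈ φ.target) : x (pr (φ.symm y)) = y.1 := by
  rw [← h.fst_eq _ (φ.map_target hy), φ.right_inv hy]

theorem fderiv_proj {y : EB × EF} (hy : y ∈ φ.target) :
    fderiv ℝ (x ∘ pr ∘ φ.symm) y = ContinuousLinearMap.fst ℝ EB EF := by
  have h1 : x ∘ pr ∘ φ.symm =ᶠ[𝓝 y] Prod.fst := by
    filter_upwards [φ.open_target.mem_nhds hy] with y hy using h.proj_symm_eq hy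
  rw [h1.fderiv_eq, fderiv_fst]

variable [IsManifold 𝓘(ℝ, EB) ∞ M] [IsManifold 𝓘(ℝ, EZ) ∞ Z] [FiniteDimensional ℝ EB]
  [FiniteDimensional ℝ EF] {P : EndField 𝓘(ℝ, EZ) Z}

omit [IsManifold 𝓘(ℝ, EB) ∞ M] in
/-- The matrix of a connection in a fibered chart is given by the Christoffel symbols. -/
theorem chartRep_apply (hP : IsConnection (EB := EB) pr P)
    (hpr : ContMDiff 𝓘(ℝ, EZ) 𝓘(ℝ, EB) ∞ pr) {y : EB × EF} (hy : y ∈ φ.target) :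
    (∀ u : EB, chartRep P φ y (u, 0) = (0, christoffel P φ y u)) ∧
      ∀ c : EF, chartRep P φ y (0, c) = (0, c) := by
  have hK := hP.isLocalConnection hpr h.isSmoothChart h.isSmoothChart_base hy (h.proj_symm_mem hy)
  have h1 := hK.vertical_self
  have h2 := hK.fix
  rw [h.fderiv_proj hy] at h1 h2
  exact ⟨fun u => Prod.ext (h1 (u, 0)) rfl, fun c => h2 (0, c) rfl⟩

/-- The components of the curvature in a fibered chart. -/
theorem mfderiv_curvature [FiniteDimensional ℝ EZ] (hP : IsConnection (EB := EB) pr P)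
    (hpr : ContMDiff 𝓘(ℝ, EZ) 𝓘(ℝ, EB) ∞ pr) {y : EB × EF} (hy : y ∈ φ.target) (u v : EB) :
    mfderiv 𝓘(ℝ, EZ) 𝓘(ℝ, EB × EF) φ (φ.symm y)
        (curvature P (φ.symm y) (coordVector φ y u) (coordVector φ y v)) =
      ((0, fderiv ℝ (fun y' => christoffel P φ y' v) y (u, 0)
        - fderiv ℝ (fun y' => christoffel P φ y' u) y (v, 0)
        + (fderiv ℝ (fun y' => christoffel P φ y' u) y (0, christoffel P φ y v)
          - fderiv ℝ (fun y' => christoffel P φ y' v) y (0, christoffel P φ y u))) :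
        EB × EF) := by
  have hK := hP.isLocalConnection hpr h.isSmoothChart h.isSmoothChart_base hy (h.proj_symm_mem hy)
  have h1 := hP.chartVec_curvature hpr h.isSmoothChart (φ.map_target hy) (coordVector φ y u)
    (coordVector φ y v)
  have hc : ∀ u : EB, chartVec φ (⟨φ.symm y, coordVector φ y u⟩ : TangentBundle 𝓘(ℝ, EZ) Z) =
      (u, 0) := fun u => h.isSmoothChart.chartVec_ofChartVec hy (u, 0)
  rw [hc, hc, φ.right_inv hy] at h1
  have hd : ∀ (c : EB × EF) (v : EB), fderiv ℝ (chartRep P φ) y c (v, 0) =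
      (0, fderiv ℝ (fun y' => christoffel P φ y' v) y c) := by
    intro c v
    have e1 : HasFDerivAt (fun y' => chartRep P φ y' (v, 0)) _ y :=
      hK.hasFDerivAt.clm_apply (hasFDerivAt_const (v, (0 : EF)) y)
    have e2 : (fun y' => ((0 : EB), christoffel P φ y' v)) =ᶠ[𝓝 y]
        fun y' => chartRep P φ y' (v, 0) := by
      filter_upwards [φ.open_target.mem_nhds hy] with y hy
      exact ((h.chartRep_apply hP hpr hy).1 v).symm
    have e3 := e1.congr_of_eventuallyEq e2
    have e4 := congrArg (fun A => A c) ((hasFDerivAt_const (0 : EB) y).prodMk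
      e3.snd.differentiableAt.hasFDerivAt |>.unique e3)
    simpa using e4.symm
  have hh : ∀ u : EB, (u, (0 : EF)) - chartRep P φ y (u, 0) =
      (u, 0) - (0, christoffel P φ y u) := fun u => by
    rw [(h.chartRep_apply hP hpr hy).1]
  refine h1.trans ?_
  rw [localCurvature, hd, hd, hh, hh, Prod.mk_sub_mk, sub_zero, (h.chartRep_apply hP hpr hy).2,
    map_sub, map_sub]
  refine Prod.ext rfl ?_
  simp only
  abel

end IsFiberedChart

end Christoffel

/-! ### Maps into the tangent bundle and the charts of the iterated tangent bundle -/

section TangentCharts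

variable {E : Type*} [NormedAddCommGroup E] [NormedSpace ℝ E]
  {Z : Type*} [TopologicalSpace Z] [ChartedSpace E Z] [IsManifold 𝓘(ℝ, E) ∞ Z]
  {N : Type*} [TopologicalSpace N]

theorem extChartAt_tangent_eq (v₀ : TangentBundle 𝓘(ℝ, E) Z) {v : TangentBundle 𝓘(ℝ, E) Z}
    (hv : v.proj ∈ (chartAt E v₀.proj).source) :
    extChartAt (𝓘(ℝ, E).tangent) v₀ v =
      (chartAt E v₀.proj v.proj, chartVec (chartAt E v₀.proj) v) :=
  Prod.ext (by simp [mfld_simps]) (trivializationAt_eq_chartVec v₀.proj hv)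

/-- A map into the tangent bundle is smooth if its base point and its components in the preferred
chart are. -/
theorem contMDiffAt_tangentBundle {EN HN : Type*} [NormedAddCommGroup EN] [NormedSpace ℝ EN]
    [TopologicalSpace HN] [ChartedSpace HN N] {J : ModelWithCorners ℝ EN HN}
    {V : N → TangentBundle 𝓘(ℝ, E) Z} {n : N}
    (h1 : ContMDiffAt J 𝓘(ℝ, E) ∞ (fun m => (V m).proj) n)
    (h2 : ContMDiffAt J 𝓘(ℝ, E) ∞ (fun m => chartVec (chartAt E (V n).proj) (V m)) n) :
    ContMDiffAt J (𝓘(ℝ, E).tangent) ∞ V n := by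
  rw [contMDiffAt_totalSpace]
  refine ⟨h1, h2.congr_of_eventuallyEq ?_⟩
  filter_upwards [h1.continuousAt.eventually_mem
    ((chartAt E (V n).proj).open_source.mem_nhds (mem_chart_source E _))] with m hm
  exact trivializationAt_eq_chartVec _ hm

/-- The derivative of a map into the tangent bundle, in terms of the derivatives of the components
in the preferred charts. -/
theorem mfderiv_tangentBundle {EN : Type*} [NormedAddCommGroup EN] [NormedSpace ℝ EN]
    [ChartedSpace EN N] {V : N → TangentBundle 𝓘(ℝ, E) Z} {n : N}
    (hV : MDifferentiableAt 𝓘(ℝ, EN) (𝓘(ℝ, E).tangent) V n) (X : TangentSpace 𝓘(ℝ, EN) n) :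
    mfderiv 𝓘(ℝ, EN) (𝓘(ℝ, E).tangent) V n X =
      ((fderiv ℝ (fun s => chartAt E (V n).proj (V ((chartAt EN n).symm s)).proj)
          (chartAt EN n n) X,
        fderiv ℝ (fun s => chartVec (chartAt E (V n).proj) (V ((chartAt EN n).symm s)))
          (chartAt EN n n) X) : E × E) := by
  have h1 := hV.mfderiv
  have h2 := hV.differentiableWithinAt_writtenInExtChartAt
  have hc : ContinuousAt (fun s => (V ((chartAt EN n).symm s)).proj) (chartAt EN n n) := by
    have e1 : ContinuousAt (fun m => (V m).proj) n :=
      (FiberBundle.continuous_proj E (TangentSpace 𝓘(ℝ, E))).continuousAt.comp hV.continuousAt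
    refine ContinuousAt.comp (g := fun m => (V m).proj) (f := (chartAt EN n).symm) ?_
      ((chartAt EN n).continuousAt_symm (mem_chart_target EN n))
    rwa [(chartAt EN n).left_inv (mem_chart_source EN n)]
  have h3 : writtenInExtChartAt 𝓘(ℝ, EN) (𝓘(ℝ, E).tangent) n V =ᶠ[𝓝 (chartAt EN n n)]
      fun s => (chartAt E (V n).proj (V ((chartAt EN n).symm s)).proj,
        chartVec (chartAt E (V n).proj) (V ((chartAt EN n).symm s))) := by
    have := hc.eventually_mem ((chartAt E (V n).proj).open_source.mem_nhds (by
      rw [(chartAt EN n).left_inv (mem_chart_source EN n)]; exact mem_chart_source E _))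
    filter_upwards [this] with s hs
    exact extChartAt_tangent_eq (V n) hs
  have hr : Set.range (𝓘(ℝ, EN)) = Set.univ := (𝓘(ℝ, EN)).range_eq_univ
  rw [hr, fderivWithin_univ] at h1
  rw [hr, differentiableWithinAt_univ] at h2
  have h4 := h3.differentiableAt_iff.1 h2
  rw [h1]
  refine (congrArg (fun A => A X) (h3.fderiv_eq.trans
    (DifferentiableAt.fderiv_prodMk h4.fst h4.snd))).trans ?_
  rfl

/-- The pushforward of a tangent vector under a map into the tangent bundle, as a point of the
iterated tangent bundle. -/
theorem mk_mfderiv_eq {EN : Type*} [NormedAddCommGroup EN] [NormedSpace ℝ EN]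
    [ChartedSpace EN N] {V : N → TangentBundle 𝓘(ℝ, E) Z} {n : N} {v : TangentBundle 𝓘(ℝ, E) Z}
    (hV : ContMDiffAt 𝓘(ℝ, EN) (𝓘(ℝ, E).tangent) ∞ V n) (hv : V n = v)
    (X : TangentSpace 𝓘(ℝ, EN) n) :
    (⟨V n, mfderiv 𝓘(ℝ, EN) (𝓘(ℝ, E).tangent) V n X⟩ : TT E Z) =
      ⟨v, ((fderiv ℝ (fun s => chartAt E v.proj (V ((chartAt EN n).symm s)).proj)
          (chartAt EN n n) X,
        fderiv ℝ (fun s => chartVec (chartAt E v.proj) (V ((chartAt EN n).symm s)))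
          (chartAt EN n n) X) : E × E)⟩ := by
  subst hv
  exact congrArg (TotalSpace.mk (V n)) (mfderiv_tangentBundle (hV.mdifferentiableAt (by simp)) X)

/-- The velocity of a curve in the tangent bundle. -/
theorem velocity_tangentBundle {c : ℝ → TangentBundle 𝓘(ℝ, E) Z} {t : ℝ}
    {v : TangentBundle 𝓘(ℝ, E) Z} (hc : ContMDiffAt 𝓘(ℝ, ℝ) (𝓘(ℝ, E).tangent) ∞ c t)
    (hv : c t = v) :
    velocity (𝓘(ℝ, E).tangent) c t =
      ⟨v, ((fderiv ℝ (fun s => chartAt E v.proj (c s).proj) t 1,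
        fderiv ℝ (fun s => chartVec (chartAt E v.proj) (c s)) t 1) : E × E)⟩ :=
  mk_mfderiv_eq hc hv (1 : ℝ)

omit [IsManifold 𝓘(ℝ, E) ∞ Z] in
/-- The change of components of a tangent vector between two charts. -/
theorem IsSmoothChart.chartVec_change {E₁ E₂ : Type*} [NormedAddCommGroup E₁] [NormedSpace ℝ E₁]
    [NormedAddCommGroup E₂] [NormedSpace ℝ E₂] {φ : OpenPartialHomeomorph Z E₁}
    {φ' : OpenPartialHomeomorph Z E₂} (h : IsSmoothChart (E := E) φ)
    (h' : IsSmoothChart (E := E) φ') {v : TangentBundle 𝓘(ℝ, E) Z} (hv : v.proj ∈ φ.source)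
    (hv' : v.proj ∈ φ'.source) :
    chartVec φ' v = fderiv ℝ (φ' ∘ φ.symm) (φ v.proj) (chartVec φ v) := by
  obtain ⟨z, v⟩ := v
  obtain ⟨y, hy, rfl⟩ : ∃ y ∈ φ.target, φ.symm y = z :=
    ⟨φ z, φ.map_source hv, φ.left_inv hv⟩
  have e1 := (h'.mdifferentiable.mdifferentiableAt hv').hasMFDerivAt
  have e2 := (h.mdifferentiable.mdifferentiableAt_symm hy).hasMFDerivAt
  have e3 := (e1.comp y e2).mfderiv
  rw [mfderiv_eq_fderiv] at e3
  have e4 := h.mfderiv_symm_mfderiv (φ.map_target hy) v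
  rw [φ.right_inv hy] at e4
  have e5 := congrArg (mfderiv 𝓘(ℝ, E) 𝓘(ℝ, E₂) φ' (φ.symm y)) e4
  have e6 : φ (⟨φ.symm y, v⟩ : TangentBundle 𝓘(ℝ, E) Z).proj = y := φ.right_inv hy
  rw [e6]
  exact e5.symm.trans (congrArg (fun A : E₁ →L[ℝ] E₂ => A (chartVec φ ⟨φ.symm y, v⟩)) e3).symm

omit [IsManifold 𝓘(ℝ, E) ∞ Z] in
theorem IsSmoothChart.contDiffAt_change {E₁ E₂ : Type*} [NormedAddCommGroup E₁] [NormedSpace ℝ E₁]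
    [NormedAddCommGroup E₂] [NormedSpace ℝ E₂] {φ : OpenPartialHomeomorph Z E₁}
    {φ' : OpenPartialHomeomorph Z E₂} (h : IsSmoothChart (E := E) φ)
    (h' : IsSmoothChart (E := E) φ') {y : E₁} (hy : y ∈ φ.target)
    (hy' : φ.symm y ∈ φ'.source) :
    ContDiffAt ℝ ∞ (φ' ∘ φ.symm) y := by
  rw [← contMDiffAt_iff_contDiffAt]
  exact (h'.contMDiffAt hy').comp y (h.contMDiffAt_symm hy)

/-- The components, in the chart of `TZ` over the chart of `Z` at `z₀`, of the vector
`(a, b)`. -/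
theorem mfderiv_extChartAt_tangent (v₀ : TangentBundle 𝓘(ℝ, E) Z) {z : Z}
    (hz : z ∈ (chartAt E v₀.proj).source) (w a b : E) :
    mfderiv (𝓘(ℝ, E).tangent) 𝓘(ℝ, E × E) (extChartAt (𝓘(ℝ, E).tangent) v₀) ⟨z, w⟩
        ((a, b) : E × E) =
      ((fderiv ℝ (chartAt E v₀.proj ∘ (chartAt E z).symm) (chartAt E z z) a,
        fderiv ℝ (fderiv ℝ (chartAt E v₀.proj ∘ (chartAt E z).symm))
            (chartAt E z z) a w +
          fderiv ℝ (chartAt E v₀.proj ∘ (chartAt E z).symm) (chartAt E z z) b) :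
        E × E) := by
  set v : TangentBundle 𝓘(ℝ, E) Z := ⟨z, w⟩ with hv
  set φ := chartAt E z with hφ
  set φ₀ := chartAt E v₀.proj with hφ₀
  set τ := φ₀ ∘ φ.symm with hτ
  have hs : IsSmoothChart (E := E) φ := isSmoothChart_chartAt z
  have hs₀ : IsSmoothChart (E := E) φ₀ := isSmoothChart_chartAt v₀.proj
  have hvs : z ∈ φ.source := mem_chart_source E z
  have hd : MDifferentiableAt (𝓘(ℝ, E).tangent) 𝓘(ℝ, E × E)
      (extChartAt (𝓘(ℝ, E).tangent) v₀) v :=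
    mdifferentiableAt_extChartAt (by simpa [TangentBundle.mem_chart_source_iff] using hz)
  have hb : extChartAt (𝓘(ℝ, E).tangent) v v = (φ z, w) := by
    refine (extChartAt_tangent_eq v hvs).trans ?_
    exact congrArg (Prod.mk _) (chartVec_chartAt_self z w)
  have hcont : ContinuousAt (fun y => ((extChartAt (𝓘(ℝ, E).tangent) v).symm y).proj)
      (φ z, w) := by
    rw [← hb]
    exact (FiberBundle.continuous_proj E (TangentSpace 𝓘(ℝ, E))).continuousAt.comp
      (continuousAt_extChartAt_symm v)
  have hev : writtenInExtChartAt (𝓘(ℝ, E).tangent) 𝓘(ℝ, E × E) v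
      (extChartAt (𝓘(ℝ, E).tangent) v₀) =ᶠ[𝓝 (φ z, w)]
      fun q : E × E => (τ q.1, fderiv ℝ τ q.1 q.2) := by
    have t1 := extChartAt_target_mem_nhds (I := 𝓘(ℝ, E).tangent) v
    rw [hb] at t1
    have hl : ((extChartAt (𝓘(ℝ, E).tangent) v).symm (φ z, w)).proj = z := by
      rw [← hb, extChartAt_to_inv]
    filter_upwards [t1, hcont.eventually_mem (φ.open_source.mem_nhds (by rwa [hl])),
      hcont.eventually_mem (φ₀.open_source.mem_nhds (by rwa [hl]))] with q hq h1 h2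
    have h3 := (extChartAt (𝓘(ℝ, E).tangent) v).right_inv hq
    rw [extChartAt_tangent_eq v h1] at h3
    obtain ⟨h4, h5⟩ := Prod.ext_iff.1 h3
    change extChartAt (𝓘(ℝ, E).tangent) v₀ ((extChartAt (𝓘(ℝ, E).tangent) v).symm q) = _
    rw [extChartAt_tangent_eq v₀ h2]
    refine Prod.ext ?_ ?_
    · change φ₀ _ = φ₀ (φ.symm q.1)
      rw [← h4]
      exact congrArg φ₀ (φ.left_inv h1).symm
    · rw [← h4, ← h5]
      exact hs.chartVec_change hs₀ h1 h2
  have hτd : ContDiffAt ℝ ∞ τ (φ z) :=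
    hs.contDiffAt_change hs₀ (φ.map_source hvs) (by rwa [φ.left_inv hvs])
  have d1 : HasFDerivAt τ (fderiv ℝ τ (φ z)) ((φ z, w) : E × E).1 :=
    (hτd.differentiableAt (by simp)).hasFDerivAt
  have d2 : HasFDerivAt (fderiv ℝ τ) (fderiv ℝ (fderiv ℝ τ) (φ z))
      ((φ z, w) : E × E).1 :=
    ((hτd.fderiv_right (m := ∞) (by simp)).differentiableAt (by simp)).hasFDerivAt
  have d3 := (d1.comp _ hasFDerivAt_fst).prodMk
    ((d2.comp _ hasFDerivAt_fst).clm_apply hasFDerivAt_snd)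
  have hr : Set.range (𝓘(ℝ, E).tangent) = Set.univ := (𝓘(ℝ, E).tangent).range_eq_univ
  rw [hd.mfderiv, hr, fderivWithin_univ, hb, hev.fderiv_eq]
  refine (congrArg (fun A : E × E →L[ℝ] E × E => A (a, b)) d3.fderiv).trans ?_
  simp [add_comm]

end TangentCharts

/-! ### The induced connection on the vertical bundle -/

section Induced

variable {E : Type*} [NormedAddCommGroup E] [NormedSpace ℝ E]

/-- The matrix `(a, b) ↦ (K a, (D_w K) a + K b)` at the point `(y, w)` of the connection induced by
`K`: the tangent map `((y, a), (w, b)) ↦ ((y, K a), (w, (D_w K) a + K b))` of `K`, conjugated with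
the canonical involution. -/
def inducedMatrix (K : E → E →L[ℝ] E) (y w : E) : E × E →L[ℝ] E × E :=
  ((K y).comp (ContinuousLinearMap.fst ℝ E E)).prod
    ((fderiv ℝ K y w).comp (ContinuousLinearMap.fst ℝ E E) +
      (K y).comp (ContinuousLinearMap.snd ℝ E E))

theorem inducedMatrix_apply (K : E → E →L[ℝ] E) (y w a b : E) :
    inducedMatrix K y w (a, b) = (K y a, fderiv ℝ K y w a + K y b) := rfl

variable {Z : Type*} [TopologicalSpace Z] [ChartedSpace E Z]

/-- The connection on `Vert Z` induced by the connection `P` on `Z`, as a field of endomorphisms of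
the tangent spaces of `TZ`. It is given by its matrix with respect to the preferred chart at the
base point. -/
def inducedConnection [IsManifold 𝓘(ℝ, E) ∞ Z] (P : EndField 𝓘(ℝ, E) Z) :
    EndField (𝓘(ℝ, E).tangent) (TangentBundle 𝓘(ℝ, E) Z) := fun v =>
  inducedMatrix (chartRep P (chartAt E v.proj)) (chartAt E v.proj v.proj) v.snd

variable [IsManifold 𝓘(ℝ, E) ∞ Z] {P : EndField 𝓘(ℝ, E) Z}

theorem inducedConnection_toMap (z : Z) (w a b : E) :
    (inducedConnection P).toMap (⟨⟨z, w⟩, (a, b)⟩ : TT E Z) =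
      ⟨⟨z, w⟩, inducedMatrix (chartRep P (chartAt E z)) (chartAt E z z) w (a, b)⟩ := rfl

/-- The induced connection has the matrix `inducedMatrix` in all charts of `TZ` that come from
preferred charts of `Z`: its definition does not depend on the chart. -/
theorem mfderiv_extChartAt_inducedConnection [FiniteDimensional ℝ E]
    (hP : ContMDiff (𝓘(ℝ, E).tangent) (𝓘(ℝ, E).tangent) ∞ P.toMap)
    (v₀ v : TangentBundle 𝓘(ℝ, E) Z) (hv : v.proj ∈ (chartAt E v₀.proj).source)
    (ξ : TangentSpace (𝓘(ℝ, E).tangent) v) :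
    mfderiv (𝓘(ℝ, E).tangent) 𝓘(ℝ, E × E) (extChartAt (𝓘(ℝ, E).tangent) v₀) v
        (inducedConnection P v ξ) =
      inducedMatrix (chartRep P (chartAt E v₀.proj)) (chartAt E v₀.proj v.proj)
        (chartVec (chartAt E v₀.proj) v)
        (mfderiv (𝓘(ℝ, E).tangent) 𝓘(ℝ, E × E) (extChartAt (𝓘(ℝ, E).tangent) v₀) v ξ) := by
  obtain ⟨z, (w : E)⟩ := v
  obtain ⟨a, b⟩ : E × E := ξ
  refine (mfderiv_extChartAt_tangent v₀ hv w _ _).trans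
    (Eq.trans ?_ (congrArg _ (mfderiv_extChartAt_tangent v₀ hv w a b).symm))
  have hs : IsSmoothChart (E := E) (chartAt E z) := isSmoothChart_chartAt z
  have hs₀ : IsSmoothChart (E := E) (chartAt E v₀.proj) := isSmoothChart_chartAt v₀.proj
  have hz : z ∈ (chartAt E z).source := mem_chart_source E z
  have hw : chartVec (chartAt E v₀.proj) (⟨z, w⟩ : TangentBundle 𝓘(ℝ, E) Z) =
      fderiv ℝ (chartAt E v₀.proj ∘ (chartAt E z).symm) (chartAt E z z) w :=
    (hs.chartVec_change hs₀ (v := ⟨z, w⟩) hz hv).trans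
      (congrArg _ (chartVec_chartAt_self z w))
  have hyz : (chartAt E v₀.proj) z =
      (chartAt E v₀.proj ∘ (chartAt E z).symm) (chartAt E z z) :=
    congrArg _ ((chartAt E z).left_inv hz).symm
  rw [hw]
  simp only
  rw [hyz]
  have hvz : (chartAt E z).symm (chartAt E z z) ∈ (chartAt E v₀.proj).source := by
    rwa [(chartAt E z).left_inv hz]
  have hy : chartAt E z z ∈ (chartAt E z).target := mem_chart_target E z
  have hτ := hs.contDiffAt_change hs₀ hy hvz
  have hK := hs.contDiffAt_chartRep hP hy
  have hK₀ : ContDiffAt ℝ ∞ (chartRep P (chartAt E v₀.proj))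
      ((chartAt E v₀.proj ∘ (chartAt E z).symm) (chartAt E z z)) :=
    hs₀.contDiffAt_chartRep hP ((chartAt E v₀.proj).map_source hvz)
  -- the change of the matrix of `P` under a change of charts
  have hch : ∀ a : E, ∀ᶠ y in 𝓝 (chartAt E z z),
      chartRep P (chartAt E v₀.proj) ((chartAt E v₀.proj ∘ (chartAt E z).symm) y)
        (fderiv ℝ (chartAt E v₀.proj ∘ (chartAt E z).symm) y a) =
      fderiv ℝ (chartAt E v₀.proj ∘ (chartAt E z).symm) y (chartRep P (chartAt E z) y a) := by
    intro a
    filter_upwards [(chartAt E z).open_target.mem_nhds hy,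
      ((chartAt E z).continuousAt_symm hy).eventually_mem
        ((chartAt E v₀.proj).open_source.mem_nhds hvz)] with y hy hy'
    have e1 := hs.chartVec_change hs₀ (v := ofChartVec (chartAt E z) y a)
      ((chartAt E z).map_target hy) hy'
    have e2 := hs.chartVec_change hs₀ (v := P.toMap (ofChartVec (chartAt E z) y a))
      ((chartAt E z).map_target hy) hy'
    have e3 := hs₀.chartVec_toMap P (v := ofChartVec (chartAt E z) y a) hy'
    have e4 : chartAt E z (ofChartVec (E := E) (chartAt E z) y a).proj = y :=
      (chartAt E z).right_inv hy
    have e5 : chartAt E z (P.toMap (ofChartVec (E := E) (chartAt E z) y a)).proj = y :=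
      (chartAt E z).right_inv hy
    rw [e4, hs.chartVec_ofChartVec hy] at e1
    rw [e5] at e2
    rw [e1] at e3
    exact e3.symm.trans e2
  generalize chartAt E v₀.proj ∘ (chartAt E z).symm = τ at *
  generalize chartRep P (chartAt E v₀.proj) = K₀ at *
  generalize chartRep P (chartAt E z) = K at *
  generalize chartAt E z z = y at *
  -- differentiate the transformation law along `w`
  have d1 : HasFDerivAt τ (fderiv ℝ τ y) y := (hτ.differentiableAt (by simp)).hasFDerivAt
  have d2 : HasFDerivAt (fderiv ℝ τ) (fderiv ℝ (fderiv ℝ τ) y) y :=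
    ((hτ.fderiv_right (m := ∞) (by simp)).differentiableAt (by simp)).hasFDerivAt
  have d3 : HasFDerivAt K (fderiv ℝ K y) y := (hK.differentiableAt (by simp)).hasFDerivAt
  have d4 : HasFDerivAt K₀ (fderiv ℝ K₀ (τ y)) (τ y) :=
    (hK₀.differentiableAt (by simp)).hasFDerivAt
  have d5 := (d4.comp y d1).clm_apply (d2.clm_apply (hasFDerivAt_const a y))
  have d6 := d2.clm_apply (d3.clm_apply (hasFDerivAt_const a y))
  have e := congrArg (fun A => A w) (d5.unique (d6.congr_of_eventuallyEq (hch a)))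
  have e0 := fun a => (hch a).self_of_nhds
  have hsymm : ∀ u v, fderiv ℝ (fderiv ℝ τ) y u v = fderiv ℝ (fderiv ℝ τ) y v u := fun u v =>
    (hτ.isSymmSndFDerivAt (by simpa using ENat.LEInfty.out)) u v
  change K₀ (τ y) (fderiv ℝ τ y 0 + fderiv ℝ (fderiv ℝ τ) y w a) +
      fderiv ℝ K₀ (τ y) (fderiv ℝ τ y w) (fderiv ℝ τ y a) =
    fderiv ℝ τ y (K y 0 + fderiv ℝ K y w a) + fderiv ℝ (fderiv ℝ τ) y w (K y a) at e
  simp only [map_zero, zero_add] at e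
  change (fderiv ℝ τ y (K y a), fderiv ℝ (fderiv ℝ τ) y (K y a) w +
      fderiv ℝ τ y (fderiv ℝ K y w a + K y b)) =
    (K₀ (τ y) (fderiv ℝ τ y a), fderiv ℝ K₀ (τ y) (fderiv ℝ τ y w) (fderiv ℝ τ y a) +
      K₀ (τ y) (fderiv ℝ (fderiv ℝ τ) y a w + fderiv ℝ τ y b))
  refine Prod.ext (e0 a).symm ?_
  simp only [map_add]
  rw [e0 b, hsymm (K y a), hsymm a]
  linear_combination (norm := module) (-1 : ℝ) • e

/-- The induced connection is smooth. -/
theorem contMDiff_inducedConnection [FiniteDimensional ℝ E]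
    (hP : ContMDiff (𝓘(ℝ, E).tangent) (𝓘(ℝ, E).tangent) ∞ P.toMap) :
    ContMDiff (𝓘(ℝ, E).tangent.tangent) (𝓘(ℝ, E).tangent.tangent) ∞
      (inducedConnection P).toMap := by
  intro ξ₀
  set v₀ := ξ₀.proj with hv₀
  have hproj : ContMDiff (𝓘(ℝ, E).tangent.tangent) (𝓘(ℝ, E).tangent) ∞
      (fun ξ : TT E Z => ξ.proj) := contMDiff_proj _
  have htr : ∀ ξ : TT E Z, ξ.proj.proj ∈ (chartAt E v₀.proj).source →
      (trivializationAt (E × E) (TangentSpace (𝓘(ℝ, E).tangent)) v₀ ξ).2 =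
        mfderiv (𝓘(ℝ, E).tangent) 𝓘(ℝ, E × E) (extChartAt (𝓘(ℝ, E).tangent) v₀) ξ.proj ξ.snd := by
    intro ξ hξ
    have hξ' : ξ.proj ∈ (chartAt (ModelProd E E) v₀).source := by
      simpa [TangentBundle.mem_chart_source_iff] using hξ
    have h4 := TangentBundle.continuousLinearMapAt_trivializationAt (I := 𝓘(ℝ, E).tangent) hξ'
    have hm : ξ.proj ∈
        (trivializationAt (E × E) (TangentSpace (𝓘(ℝ, E).tangent)) v₀).baseSet := by
      simpa using hξ'
    have h5 := congrArg (fun A => A ξ.snd) h4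
    simp only [Trivialization.continuousLinearMapAt_apply] at h5
    rw [Trivialization.coe_linearMapAt_of_mem _ hm] at h5
    exact h5
  have h0 := (contMDiffAt_totalSpace (IB := 𝓘(ℝ, E).tangent) (F := E × E)
    (E := TangentSpace (𝓘(ℝ, E).tangent)) (f := fun ξ : TT E Z => ξ) (x₀ := ξ₀)
    (n := ∞) (IM := 𝓘(ℝ, E).tangent.tangent)).1 contMDiffAt_id
  rw [contMDiffAt_totalSpace]
  refine ⟨h0.1, ?_⟩
  have hs₀ : IsSmoothChart (E := E) (chartAt E v₀.proj) := isSmoothChart_chartAt v₀.proj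
  have hmem : v₀.proj ∈ (chartAt E v₀.proj).source := mem_chart_source E v₀.proj
  have hy := hs₀.contDiffAt_chartRep hP (mem_chart_target E v₀.proj)
  have hpp : ContMDiffAt (𝓘(ℝ, E).tangent.tangent) 𝓘(ℝ, E) ∞
      (fun ξ : TT E Z => chartAt E v₀.proj ξ.proj.proj) ξ₀ :=
    (hs₀.contMDiffAt hmem).comp ξ₀ ((contMDiff_proj (TangentSpace 𝓘(ℝ, E))).contMDiffAt.comp ξ₀
      hproj.contMDiffAt)
  have hw : ContMDiffAt (𝓘(ℝ, E).tangent.tangent) 𝓘(ℝ, E) ∞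
      (fun ξ : TT E Z => chartVec (chartAt E v₀.proj) ξ.proj) ξ₀ :=
    (hs₀.contMDiffAt_chartVec hmem).comp ξ₀ hproj.contMDiffAt
  have hab := h0.2
  have hK := ContMDiffAt.comp ξ₀ hy.contMDiffAt hpp
  have hK' := ContMDiffAt.comp ξ₀ (hy.fderiv_right (m := ∞) (by simp)).contMDiffAt hpp
  have ha : ContMDiffAt (𝓘(ℝ, E).tangent.tangent) 𝓘(ℝ, E) ∞ (fun ξ : TT E Z =>
      (trivializationAt (E × E) (TangentSpace (𝓘(ℝ, E).tangent)) v₀ ξ).2.1) ξ₀ :=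
    contDiff_fst.contMDiff.contMDiffAt.comp ξ₀ hab
  have hb : ContMDiffAt (𝓘(ℝ, E).tangent.tangent) 𝓘(ℝ, E) ∞ (fun ξ : TT E Z =>
      (trivializationAt (E × E) (TangentSpace (𝓘(ℝ, E).tangent)) v₀ ξ).2.2) ξ₀ :=
    contDiff_snd.contMDiff.contMDiffAt.comp ξ₀ hab
  refine ((hK.clm_apply ha).prodMk_space
    (((hK'.clm_apply hw).clm_apply ha).add (hK.clm_apply hb))).congr_of_eventuallyEq ?_
  have hnear : ∀ᶠ ξ : TT E Z in 𝓝 ξ₀, ξ.proj.proj ∈ (chartAt E v₀.proj).source :=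
    (((FiberBundle.continuous_proj E (TangentSpace 𝓘(ℝ, E))).comp
      hproj.continuous).continuousAt.eventually_mem
      ((chartAt E v₀.proj).open_source.mem_nhds hmem))
  filter_upwards [hnear] with ξ hξ
  refine (htr ((inducedConnection P).toMap ξ) hξ).trans
    ((mfderiv_extChartAt_inducedConnection hP v₀ ξ.proj hξ ξ.snd).trans ?_)
  exact congrArg _ (htr ξ hξ).symm

end Induced

/-! ### The tangent bundle of the vertical bundle -/

section Vertical

variable {EB : Type*} [NormedAddCommGroup EB] [NormedSpace ℝ EB]
  {M : Type*} [TopologicalSpace M] [ChartedSpace EB M]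
  {E : Type*} [NormedAddCommGroup E] [NormedSpace ℝ E]
  {Z : Type*} [TopologicalSpace Z] [ChartedSpace E Z]

/-- The bundle projection in the preferred charts around `z` and its image. -/
def projInChart (EB : Type*) [NormedAddCommGroup EB] [NormedSpace ℝ EB] [ChartedSpace EB M]
    (E : Type*) [NormedAddCommGroup E] [NormedSpace ℝ E] [ChartedSpace E Z] (pr : Z → M) (z : Z) :
    E → EB :=
  chartAt EB (pr z) ∘ pr ∘ (chartAt E z).symm

variable [IsManifold 𝓘(ℝ, EB) ∞ M] [IsManifold 𝓘(ℝ, E) ∞ Z] {pr : Z → M}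

theorem fderiv_projInChart (hpr : ContMDiff 𝓘(ℝ, E) 𝓘(ℝ, EB) ∞ pr) {z : Z}
    {v : TangentBundle 𝓘(ℝ, E) Z} (hv : v.proj ∈ (chartAt E z).source)
    (hv' : pr v.proj ∈ (chartAt EB (pr z)).source) :
    fderiv ℝ (projInChart EB E pr z) (chartAt E z v.proj) (chartVec (chartAt E z) v) =
      mfderiv 𝓘(ℝ, EB) 𝓘(ℝ, EB) (chartAt EB (pr z)) (pr v.proj)
        (mfderiv 𝓘(ℝ, E) 𝓘(ℝ, EB) pr v.proj v.snd) :=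
  ((isSmoothChart_chartAt (E := E) z).chartVec_mfderiv (isSmoothChart_chartAt (E := EB) (pr z))
    (hpr.mdifferentiable (by simp) _) hv hv').symm

/-- Verticality in charts. -/
theorem mem_verticalBundle_iff (hpr : ContMDiff 𝓘(ℝ, E) 𝓘(ℝ, EB) ∞ pr) {z : Z}
    {v : TangentBundle 𝓘(ℝ, E) Z} (hv : v.proj ∈ (chartAt E z).source)
    (hv' : pr v.proj ∈ (chartAt EB (pr z)).source) :
    v ∈ verticalBundle (EB := EB) pr ↔
      fderiv ℝ (projInChart EB E pr z) (chartAt E z v.proj) (chartVec (chartAt E z) v) = 0 := by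
  rw [fderiv_projInChart hpr hv hv']
  refine ⟨fun h => ?_, fun h => ?_⟩
  · exact (congrArg _ h).trans (map_zero _)
  · exact (isSmoothChart_chartAt (E := EB) (pr z)).mdifferentiable.mfderiv_injective hv'
      (h.trans (map_zero _).symm)

theorem fderiv_projInChart_self (hpr : ContMDiff 𝓘(ℝ, E) 𝓘(ℝ, EB) ∞ pr) (z : Z) (w : E) :
    fderiv ℝ (projInChart EB E pr z) (chartAt E z z) w = mfderiv 𝓘(ℝ, E) 𝓘(ℝ, EB) pr z w := by
  have h := fderiv_projInChart hpr (v := (⟨z, w⟩ : TangentBundle 𝓘(ℝ, E) Z))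
    (mem_chart_source E z) (mem_chart_source EB (pr z))
  rw [mfderiv_chartAt_self] at h
  exact (congrArg _ (chartVec_chartAt_self z w)).symm.trans h

theorem mem_doubleVerticalBundle_iff (hpr : ContMDiff 𝓘(ℝ, E) 𝓘(ℝ, EB) ∞ pr) (z : Z) (w a b : E) :
    (⟨⟨z, w⟩, (a, b)⟩ : TT E Z) ∈ doubleVerticalBundle (EB := EB) pr ↔
      (⟨⟨z, w⟩, (a, b)⟩ : TT E Z) ∈ tangentVerticalBundle (EB := EB) pr ∧
        fderiv ℝ (projInChart EB E pr z) (chartAt E z z) a = 0 := by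
  refine and_congr Iff.rfl ?_
  have h1 : HasMFDerivAt (𝓘(ℝ, E).tangent) 𝓘(ℝ, E)
      (TotalSpace.proj : TangentBundle 𝓘(ℝ, E) Z → Z) ⟨z, w⟩ _ :=
    ((contMDiff_proj (TangentSpace 𝓘(ℝ, E)) (n := 1)).mdifferentiableAt one_ne_zero).hasMFDerivAt
  have h2 : HasMFDerivAt 𝓘(ℝ, E) 𝓘(ℝ, EB) pr z _ :=
    (hpr.mdifferentiable (by simp) z).hasMFDerivAt
  have h3 := (h2.comp (⟨z, w⟩ : TangentBundle 𝓘(ℝ, E) Z) h1).mfderiv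
  have h4 : mfderiv (𝓘(ℝ, E).tangent) 𝓘(ℝ, EB)
      (fun v : TangentBundle 𝓘(ℝ, E) Z => pr v.proj) ⟨z, w⟩ (a, b) =
        mfderiv 𝓘(ℝ, E) 𝓘(ℝ, EB) pr z a :=
    (congrArg (fun A => A ((a, b) : E × E)) h3).trans
      (congrArg (mfderiv 𝓘(ℝ, E) 𝓘(ℝ, EB) pr z) (mfderiv_proj ⟨z, w⟩ ((a, b) : E × E)))
  rw [fderiv_projInChart_self hpr]
  exact Eq.congr_left h4

omit [NormedSpace ℝ EB] [IsManifold 𝓘(ℝ, EB) ∞ M] in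
theorem eventually_mem_charts {N : Type*} [TopologicalSpace N] (hpr : Continuous pr)
    {V : N → TangentBundle 𝓘(ℝ, E) Z} {n : N} {z : Z}
    (hV : ContinuousAt V n) (hz : (V n).proj = z) :
    ∀ᶠ m in 𝓝 n, (V m).proj ∈ (chartAt E z).source ∧
      pr (V m).proj ∈ (chartAt EB (pr z)).source := by
  subst hz
  have h1 : ContinuousAt (fun m => (V m).proj) n :=
    (FiberBundle.continuous_proj E (TangentSpace 𝓘(ℝ, E))).continuousAt.comp hV
  exact (h1.eventually_mem ((chartAt E _).open_source.mem_nhds (mem_chart_source E _))).and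
    ((hpr.continuousAt.comp h1).eventually_mem
      ((chartAt EB _).open_source.mem_nhds (mem_chart_source EB _)))

variable {P : EndField 𝓘(ℝ, E) Z} [FiniteDimensional ℝ E]

theorem IsConnection.isLocalConnection_chartAt (hP : IsConnection (EB := EB) pr P)
    (hpr : ContMDiff 𝓘(ℝ, E) 𝓘(ℝ, EB) ∞ pr) (z : Z) :
    IsLocalConnection (projInChart EB E pr z) (chartRep P (chartAt E z)) (chartAt E z z) :=
  hP.isLocalConnection hpr (isSmoothChart_chartAt z) (isSmoothChart_chartAt (pr z))
    (mem_chart_target E z)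
    (by rw [(chartAt E z).left_inv (mem_chart_source E z)]; exact mem_chart_source EB _)

/-- A vector tangent to the vertical bundle solves the linearized equation of verticality, and the
converse holds because a connection provides enough curves in the vertical bundle. -/
theorem IsConnection.mem_tangentVerticalBundle_iff (hP : IsConnection (EB := EB) pr P)
    (hpr : ContMDiff 𝓘(ℝ, E) 𝓘(ℝ, EB) ∞ pr) (z : Z) (w a b : E) :
    (⟨⟨z, w⟩, (a, b)⟩ : TT E Z) ∈ tangentVerticalBundle (EB := EB) pr ↔
      fderiv ℝ (projInChart EB E pr z) (chartAt E z z) w = 0 ∧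
        fderiv ℝ (fderiv ℝ (projInChart EB E pr z)) (chartAt E z z) a w +
          fderiv ℝ (projInChart EB E pr z) (chartAt E z z) b = 0 := by
  have hK := hP.isLocalConnection_chartAt hpr z
  have hs : IsSmoothChart (E := E) (chartAt E z) := isSmoothChart_chartAt z
  constructor
  · rintro ⟨c, hc, hcv, hξ⟩
    have h0 : c 0 = (⟨z, w⟩ : TangentBundle 𝓘(ℝ, E) Z) := congrArg TotalSpace.proj hξ
    have hev := eventually_mem_charts (EB := EB) hpr.continuous hc.continuousAt
      (congrArg TotalSpace.proj h0)
    have hα : ContDiffAt ℝ ∞ (fun s => chartAt E z (c s).proj) 0 := by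
      rw [← contMDiffAt_iff_contDiffAt]
      exact (hs.contMDiffAt hev.self_of_nhds.1).comp (0 : ℝ)
        ((contMDiff_proj (TangentSpace 𝓘(ℝ, E))).contMDiffAt.comp (0 : ℝ) hc)
    have hβ : ContDiffAt ℝ ∞ (fun s => chartVec (chartAt E z) (c s)) 0 := by
      rw [← contMDiffAt_iff_contDiffAt]
      exact (hs.contMDiffAt_chartVec hev.self_of_nhds.1).comp (0 : ℝ) hc
    rw [velocity_tangentBundle hc h0] at hξ
    have hab := eq_of_heq (TotalSpace.mk.inj hξ).2
    have ha : fderiv ℝ (fun s => chartAt E z (c s).proj) 0 1 = a := congrArg Prod.fst hab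
    have hb : fderiv ℝ (fun s => chartVec (chartAt E z) (c s)) 0 1 = b := congrArg Prod.snd hab
    have hα0 : chartAt E z (c 0).proj = chartAt E z z := by rw [h0]
    have hβ0 : chartVec (chartAt E z) (c 0) = w := by rw [h0]; exact chartVec_chartAt_self z w
    have hzero : (fun s => fderiv ℝ (projInChart EB E pr z) (chartAt E z (c s).proj)
        (chartVec (chartAt E z) (c s))) =ᶠ[𝓝 0] fun _ => (0 : EB) := by
      filter_upwards [hev, hcv] with s h1 h2
      exact (mem_verticalBundle_iff hpr h1.1 h1.2).1 h2
    have d1 := (hα.differentiableAt (by simp)).hasFDerivAt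
    have d2 := (hβ.differentiableAt (by simp)).hasFDerivAt
    have d3 : HasFDerivAt (fderiv ℝ (projInChart EB E pr z))
      (fderiv ℝ (fderiv ℝ (projInChart EB E pr z)) (chartAt E z z)) (chartAt E z (c 0).proj) := by
      rw [hα0]; exact hK.hasFDerivAt_fderiv_proj
    have d4 := ((d3.comp (0 : ℝ) d1).clm_apply d2).unique
      ((hasFDerivAt_const (0 : EB) (0 : ℝ)).congr_of_eventuallyEq hzero)
    have d5 := congrArg (fun A => A 1) d4
    have d6 := hzero.self_of_nhds
    simp only [hα0, hβ0] at d6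
    refine ⟨d6, ?_⟩
    simpa [hα0, hβ0, ha, hb, add_comm] using d5
  · rintro ⟨hw, hb⟩
    -- the curve `K(y + t a)(w + t b')` in the vertical spaces, where `b' = b - (D_a K) w`
    set y := chartAt E z z with hy
    set K := chartRep P (chartAt E z) with hKdef
    set b' := b - fderiv ℝ K y a w with hb'
    set α : ℝ → E := fun t => y + t • a with hα
    set β : ℝ → E := fun t => K (α t) (w + t • b') with hβ
    have hα0 : α 0 = y := by simp [hα]
    have hβ0 : β 0 = w := by simp only [hβ, hα0, zero_smul, add_zero, hK.fix w hw]
    have dα : HasFDerivAt α (ContinuousLinearMap.smulRight (1 : ℝ →L[ℝ] ℝ) a) 0 :=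
      ((hasFDerivAt_id (0 : ℝ)).smul_const a).const_add _
    have cα : ContDiffAt ℝ ∞ α 0 := by fun_prop
    have cK : ContDiffAt ℝ ∞ K (α 0) := by rw [hα0]; exact hK.smooth
    have cβ : ContDiffAt ℝ ∞ β 0 :=
      (cK.comp (0 : ℝ) cα).clm_apply (show ContDiffAt ℝ ∞ (fun t : ℝ => w + t • b') 0 by fun_prop)
    have hyt : α 0 ∈ (chartAt E z).target := by rw [hα0]; exact mem_chart_target E z
    have hc := hs.contMDiffAt_ofChartVec (J := 𝓘(ℝ, ℝ)) hyt cα.contMDiffAt cβ.contMDiffAt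
    have h0 : ofChartVec (chartAt E z) (α 0) (β 0) = (⟨z, w⟩ : TangentBundle 𝓘(ℝ, E) Z) := by
      rw [hα0, hβ0]
      have := hs.ofChartVec_chartVec (v := (⟨z, w⟩ : TangentBundle 𝓘(ℝ, E) Z))
        (mem_chart_source E z)
      rwa [show chartVec (chartAt E z) (⟨z, w⟩ : TangentBundle 𝓘(ℝ, E) Z) = w from
        chartVec_chartAt_self z w] at this
    have ht : ∀ᶠ t in 𝓝 (0 : ℝ), α t ∈ (chartAt E z).target :=
      cα.continuousAt.eventually_mem ((chartAt E z).open_target.mem_nhds hyt)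
    refine ⟨fun t => ofChartVec (chartAt E z) (α t) (β t), hc, ?_, ?_⟩
    · have hev := eventually_mem_charts (EB := EB) hpr.continuous hc.continuousAt
        (congrArg TotalSpace.proj h0)
      have hv := cα.continuousAt.eventually (by rw [hα0]; exact hK.vertical)
      filter_upwards [hev, ht, hv] with t h1 h2 h3
      rw [mem_verticalBundle_iff hpr h1.1 h1.2, hs.chartVec_ofChartVec h2]
      have h4 : chartAt E z (ofChartVec (E := E) (chartAt E z) (α t) (β t)).proj = α t :=
        (chartAt E z).right_inv h2
      rw [h4]
      exact h3 _
    · rw [velocity_tangentBundle hc h0]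
      have e1 : (fun s => chartAt E z (ofChartVec (E := E) (chartAt E z) (α s) (β s)).proj)
          =ᶠ[𝓝 0] α := by
        filter_upwards [ht] with t h2 using (chartAt E z).right_inv h2
      have e2 : (fun s => chartVec (chartAt E z) (ofChartVec (E := E) (chartAt E z) (α s) (β s)))
          =ᶠ[𝓝 0] β := by
        filter_upwards [ht] with t h2 using hs.chartVec_ofChartVec h2 _
      have dK : HasFDerivAt K (fderiv ℝ K y) (α 0) := by rw [hα0]; exact hK.hasFDerivAt
      have dβ := (dK.comp (0 : ℝ) dα).clm_apply
        (((hasFDerivAt_id (0 : ℝ)).smul_const b').const_add w)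
      simp only
      rw [e1.fderiv_eq, e2.fderiv_eq, dα.fderiv, show fderiv ℝ β 0 = _ from dβ.fderiv]
      have hfin : K y b' + fderiv ℝ K y a w = b := by
        rw [hb', hK.apply_sub_fderiv hw hb]; abel
      simp [hα0, hfin]

/-- The induced connection is a connection on the vertical bundle. -/
theorem IsConnection.isVerticalConnection_induced (hP : IsConnection (EB := EB) pr P)
    (hpr : ContMDiff 𝓘(ℝ, E) 𝓘(ℝ, EB) ∞ pr) :
    IsVerticalConnection (EB := EB) pr (inducedConnection P) := by
  refine ⟨(contMDiff_inducedConnection hP.smooth).contMDiffOn, ?_, ?_⟩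
  · rintro ⟨⟨z, (w : E)⟩, (ξ : E × E)⟩ -
    obtain ⟨a, b⟩ := ξ
    have hK := hP.isLocalConnection_chartAt hpr z
    rw [inducedConnection_toMap, inducedMatrix_apply, inducedConnection_toMap, inducedMatrix_apply,
      hK.idem_self, map_add, hK.idem_self, ← add_assoc, hK.fderiv_idem]
  · rintro ⟨⟨z, (w : E)⟩, (η : E × E)⟩ hη
    obtain ⟨a, b⟩ := η
    have hK := hP.isLocalConnection_chartAt hpr z
    constructor
    · rintro ⟨⟨⟨z', (w' : E)⟩, (ξ : E × E)⟩, hξ, h⟩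
      obtain ⟨a', b'⟩ := ξ
      have h1 := (TotalSpace.mk.inj h).1
      obtain rfl : z' = z := congrArg TotalSpace.proj h1
      obtain rfl : w' = w := eq_of_heq (TotalSpace.mk.inj h1).2
      rw [← h, inducedConnection_toMap, inducedMatrix_apply, mem_doubleVerticalBundle_iff hpr,
        hP.mem_tangentVerticalBundle_iff hpr]
      obtain ⟨hw, hb⟩ := (hP.mem_tangentVerticalBundle_iff hpr _ _ _ _).1 hξ
      refine ⟨⟨hw, ?_⟩, hK.vertical_self _⟩
      rw [map_add, hK.vertical_self, add_zero, hK.fderiv_fderiv_proj_symm]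
      exact hK.fderiv_vertical w' a'
    · intro h
      obtain ⟨h1, h2⟩ := (mem_doubleVerticalBundle_iff hpr _ _ _ _).1 h
      obtain ⟨hw, hb⟩ := (hP.mem_tangentVerticalBundle_iff hpr _ _ _ _).1 h1
      refine ⟨_, h1, ?_⟩
      rw [inducedConnection_toMap, inducedMatrix_apply, hK.fix a h2,
        hK.fderiv_apply_add_apply h2 hb]

end Vertical

/-! ### Covariant derivatives of variations -/

section Variation

variable {EB : Type*} [NormedAddCommGroup EB] [NormedSpace ℝ EB]
  {M : Type*} [TopologicalSpace M] [ChartedSpace EB M]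
  {E : Type*} [NormedAddCommGroup E] [NormedSpace ℝ E]
  {Z : Type*} [TopologicalSpace Z] [ChartedSpace E Z]

/-- The components of the velocity of a curve. -/
theorem IsSmoothChart.chartVec_velocity {E' : Type*} [NormedAddCommGroup E'] [NormedSpace ℝ E']
    {φ : OpenPartialHomeomorph Z E'} (h : IsSmoothChart (E := E) φ) {c : ℝ → Z} {t : ℝ}
    (hc : MDifferentiableAt 𝓘(ℝ, ℝ) 𝓘(ℝ, E) c t) (ht : c t ∈ φ.source) :
    chartVec φ (velocity 𝓘(ℝ, E) c t) = fderiv ℝ (fun s => φ (c s)) t 1 :=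
  ((isSmoothChart_chartAt (E := ℝ) t).chartVec_mfderiv h (v := (⟨t, (1 : ℝ)⟩ :
    TangentBundle 𝓘(ℝ, ℝ) ℝ)) hc (mem_chart_source ℝ t) ht).trans
      (congrArg (fderiv ℝ (fun s => φ (c s)) t) (chartVec_chartAt_self t (1 : ℝ)))

variable [IsManifold 𝓘(ℝ, EB) ∞ M] [IsManifold 𝓘(ℝ, E) ∞ Z]

/-- The derivative of a map, in the preferred charts. -/
theorem mfderiv_eq_fderiv_chartAt {f : M → Z} {p : M}
    (hf : MDifferentiableAt 𝓘(ℝ, EB) 𝓘(ℝ, E) f p) (X : EB) :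
    mfderiv 𝓘(ℝ, EB) 𝓘(ℝ, E) f p X =
      fderiv ℝ (chartAt E (f p) ∘ f ∘ (chartAt EB p).symm) (chartAt EB p p) X := by
  have h := (isSmoothChart_chartAt (E := EB) p).chartVec_mfderiv
    (isSmoothChart_chartAt (E := E) (f p)) (v := (⟨p, X⟩ : TangentBundle 𝓘(ℝ, EB) M)) hf
    (mem_chart_source EB p) (mem_chart_source E (f p))
  exact (chartVec_chartAt_self (E := E) (f p) _).symm.trans
    (h.trans (congrArg _ (chartVec_chartAt_self p X)))

/-- A map into the vertical bundle has its derivatives in the tangent bundle of the vertical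
bundle. -/
theorem mem_tangentVerticalBundle_of_mfderiv {pr : Z → M} {V : M → TangentBundle 𝓘(ℝ, E) Z} {p : M}
    (hV : ContMDiffAt 𝓘(ℝ, EB) (𝓘(ℝ, E).tangent) ∞ V p)
    (hv : ∀ᶠ q in 𝓝 p, V q ∈ verticalBundle (EB := EB) pr) (X : EB) :
    (⟨V p, mfderiv 𝓘(ℝ, EB) (𝓘(ℝ, E).tangent) V p X⟩ : TT E Z) ∈
      tangentVerticalBundle (EB := EB) pr := by
  set ψ := chartAt EB p with hψ
  have hs : IsSmoothChart (E := EB) ψ := isSmoothChart_chartAt p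
  set c : ℝ → M := fun t => ψ.symm (ψ p + t • X) with hc
  have hc0 : c 0 = p := by
    simp only [hc, zero_smul, add_zero]
    exact ψ.left_inv (mem_chart_source EB p)
  have hline : ContDiffAt ℝ ∞ (fun t : ℝ => ψ p + t • X) 0 := by fun_prop
  have hcs : ContMDiffAt 𝓘(ℝ, ℝ) 𝓘(ℝ, EB) ∞ c 0 := by
    refine ContMDiffAt.comp (0 : ℝ) (hs.contMDiffAt_symm ?_) hline.contMDiffAt
    rw [zero_smul, add_zero]
    exact mem_chart_target EB p
  have hVc0 : ContMDiffAt 𝓘(ℝ, EB) (𝓘(ℝ, E).tangent) ∞ V (c 0) := by rwa [hc0]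
  have hVc : ContMDiffAt 𝓘(ℝ, ℝ) (𝓘(ℝ, E).tangent) ∞ (V ∘ c) 0 := hVc0.comp (0 : ℝ) hcs
  refine ⟨V ∘ c, hVc, ?_, ?_⟩
  · have : ∀ᶠ q in 𝓝 (c 0), V q ∈ verticalBundle (EB := EB) pr := by rwa [hc0]
    exact hcs.continuousAt.eventually this
  · have h1 : (V ∘ c) 0 = V p := congrArg V hc0
    refine (velocity_tangentBundle hVc h1).trans (Eq.trans ?_ (mk_mfderiv_eq hV rfl X).symm)
    have hpt : ψ p ∈ ψ.target := mem_chart_target EB p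
    have hV' : ContMDiffAt 𝓘(ℝ, EB) (𝓘(ℝ, E).tangent) ∞ V (ψ.symm (ψ p)) := by
      rwa [ψ.left_inv (mem_chart_source EB p)]
    have hVψ := hV'.comp (ψ p) (hs.contMDiffAt_symm hpt)
    have hsz : IsSmoothChart (E := E) (chartAt E (V p).proj) := isSmoothChart_chartAt _
    have hmem : (V (ψ.symm (ψ p))).proj ∈ (chartAt E (V p).proj).source := by
      rw [ψ.left_inv (mem_chart_source EB p)]; exact mem_chart_source E _
    have d1 : DifferentiableAt ℝ (fun s => chartAt E (V p).proj (V (ψ.symm s)).proj) (ψ p) := by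
      rw [← mdifferentiableAt_iff_differentiableAt]
      exact ((hsz.contMDiffAt hmem).comp (ψ p)
        ((contMDiff_proj (TangentSpace 𝓘(ℝ, E))).contMDiffAt.comp (ψ p) hVψ)).mdifferentiableAt
          (by simp)
    have d2 : DifferentiableAt ℝ (fun s => chartVec (chartAt E (V p).proj) (V (ψ.symm s)))
        (ψ p) := by
      rw [← mdifferentiableAt_iff_differentiableAt]
      exact ((hsz.contMDiffAt_chartVec hmem).comp (ψ p) hVψ).mdifferentiableAt (by simp)
    have key : ∀ F : EB → E, DifferentiableAt ℝ F (ψ p) →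
        fderiv ℝ (fun t : ℝ => F (ψ p + t • X)) 0 1 = fderiv ℝ F (ψ p) X := by
      intro F hF
      have e1 : HasFDerivAt (fun t : ℝ => ψ p + t • X)
          (ContinuousLinearMap.smulRight (1 : ℝ →L[ℝ] ℝ) X) 0 :=
        ((hasFDerivAt_id (0 : ℝ)).smul_const X).const_add _
      have e2 : HasFDerivAt F (fderiv ℝ F (ψ p)) (ψ p + (0 : ℝ) • X) := by
        simpa using hF.hasFDerivAt
      have e3 : fderiv ℝ (fun t : ℝ => F (ψ p + t • X)) 0 = _ := (e2.comp (0 : ℝ) e1).fderiv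
      rw [e3]
      simp
    exact congrArg (TotalSpace.mk (V p)) (Prod.ext (key _ d1) (key _ d2))

namespace IsSectionFamily

variable {pr : Z → M} {U : Set M} {f : ℝ → M → Z}
  (hf : IsSectionFamily (EB := EB) (EZ := E) pr U f)
include hf

omit [IsManifold 𝓘(ℝ, EB) ∞ M] [IsManifold 𝓘(ℝ, E) ∞ Z] in
theorem contMDiffAt (ε : ℝ) {q : M} (hq : q ∈ U) :
    ContMDiffAt (𝓘(ℝ, ℝ).prod 𝓘(ℝ, EB)) 𝓘(ℝ, E) ∞ (fun q : ℝ × M => f q.1 q.2) (ε, q) :=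
  hf.smooth.contMDiffAt ((isOpen_univ.prod hf.isOpen).mem_nhds ⟨trivial, hq⟩)

omit [IsManifold 𝓘(ℝ, EB) ∞ M] [IsManifold 𝓘(ℝ, E) ∞ Z] in
theorem contMDiffAt_curve (ε : ℝ) {q : M} (hq : q ∈ U) :
    ContMDiffAt 𝓘(ℝ, ℝ) 𝓘(ℝ, E) ∞ (fun ε => f ε q) ε :=
  (hf.contMDiffAt ε hq).comp ε (f := fun ε : ℝ => (ε, q)) (contMDiffAt_id.prodMk contMDiffAt_const)

omit [IsManifold 𝓘(ℝ, EB) ∞ M] [IsManifold 𝓘(ℝ, E) ∞ Z] in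
theorem contMDiffAt_section (ε : ℝ) {q : M} (hq : q ∈ U) :
    ContMDiffAt 𝓘(ℝ, EB) 𝓘(ℝ, E) ∞ (f ε) q :=
  (hf.contMDiffAt ε hq).comp q (f := fun q : M => (ε, q)) (contMDiffAt_const.prodMk contMDiffAt_id)

omit [IsManifold 𝓘(ℝ, EB) ∞ M] [IsManifold 𝓘(ℝ, E) ∞ Z] in
/-- A variation of sections is a vertical field. -/
theorem variation_mem (hpr : ContMDiff 𝓘(ℝ, E) 𝓘(ℝ, EB) ∞ pr) {q : M} (hq : q ∈ U) :
    variation (EZ := E) f q ∈ verticalBundle (EB := EB) pr := by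
  have h1 := ((hf.contMDiffAt_curve 0 hq).mdifferentiableAt (by simp)).hasMFDerivAt
  have h2 := ((hpr.mdifferentiable (by simp) (f 0 q)).hasMFDerivAt.comp (0 : ℝ) h1).mfderiv
  have h3 : pr ∘ (fun ε => f ε q) = fun _ => q := funext fun ε => hf.proj_eq ε q hq
  rw [h3, mfderiv_const] at h2
  exact (congrArg (fun A : ℝ →L[ℝ] EB => A 1) h2).symm

/-- A family of sections in the preferred charts. -/
theorem contDiffAt_chart {p : M} (hp : p ∈ U) :
    ContDiffAt ℝ ∞ (fun q : ℝ × EB => chartAt E (f 0 p) (f q.1 ((chartAt EB p).symm q.2)))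
      (0, chartAt EB p p) := by
  have hl : (chartAt EB p).symm (chartAt EB p p) = p := symm_chartAt_self p
  rw [← contMDiffAt_iff_contDiffAt]
  have h1 : ContMDiffAt 𝓘(ℝ, ℝ × EB) (𝓘(ℝ, ℝ).prod 𝓘(ℝ, EB)) ∞
      (fun q : ℝ × EB => (q.1, (chartAt EB p).symm q.2)) (0, chartAt EB p p) := by
    refine contDiff_fst.contMDiff.contMDiffAt.prodMk ?_
    exact ((isSmoothChart_chartAt (E := EB) p).contMDiffAt_symm (mem_chart_target EB p)).comp
      ((0, chartAt EB p p) : ℝ × EB) contDiff_snd.contMDiff.contMDiffAt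
  have h2 : ContMDiffAt (𝓘(ℝ, ℝ).prod 𝓘(ℝ, EB)) 𝓘(ℝ, E) ∞ (fun q : ℝ × M => f q.1 q.2)
      (0, (chartAt EB p).symm (chartAt EB p p)) := by rw [hl]; exact hf.contMDiffAt 0 hp
  have h3 : ContMDiffAt 𝓘(ℝ, E) 𝓘(ℝ, E) ∞ (chartAt E (f 0 p))
      (f 0 ((chartAt EB p).symm (chartAt EB p p))) := by
    rw [hl]
    exact (isSmoothChart_chartAt (E := E) (f 0 p)).contMDiffAt (mem_chart_source E _)
  exact h3.comp ((0, chartAt EB p p) : ℝ × EB) (h2.comp ((0, chartAt EB p p) : ℝ × EB) h1)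

/-- The components of the variation. -/
theorem chartVec_variation {p : M} (hp : p ∈ U) :
    ∀ᶠ x in 𝓝 (chartAt EB p p),
      chartVec (chartAt E (f 0 p)) (variation (EZ := E) f ((chartAt EB p).symm x)) =
        fderiv ℝ (fun q : ℝ × EB => chartAt E (f 0 p) (f q.1 ((chartAt EB p).symm q.2)))
          (0, x) (1, 0) := by
  have hl : (chartAt EB p).symm (chartAt EB p p) = p := symm_chartAt_self p
  have hcs := (chartAt EB p).continuousAt_symm (mem_chart_target EB p)
  have h1 : ∀ᶠ x in 𝓝 (chartAt EB p p), (chartAt EB p).symm x ∈ U :=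
    hcs.eventually_mem (by rw [hl]; exact hf.isOpen.mem_nhds hp)
  have h2 : ∀ᶠ x in 𝓝 (chartAt EB p p), f 0 ((chartAt EB p).symm x) ∈
      (chartAt E (f 0 p)).source := by
    have h3 : ContinuousAt (f 0) ((chartAt EB p).symm (chartAt EB p p)) := by
      rw [hl]; exact (hf.contMDiffAt_section 0 hp).continuousAt
    exact (h3.comp hcs).eventually_mem ((chartAt E (f 0 p)).open_source.mem_nhds (by
      simp [hl]))
  have h4 := ((hf.contDiffAt_chart hp).of_le (m := 1) (by simp)).eventually (by simp)
  have h5 : Filter.Tendsto (fun x : EB => ((0 : ℝ), x)) (𝓝 (chartAt EB p p))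
      (𝓝 (0, chartAt EB p p)) := (by fun_prop : Continuous fun x : EB => ((0 : ℝ), x)).tendsto _
  filter_upwards [h1, h2, h5.eventually h4] with x hU hsrc hd
  refine ((isSmoothChart_chartAt (E := E) (f 0 p)).chartVec_velocity
    ((hf.contMDiffAt_curve 0 hU).mdifferentiableAt (by simp)) hsrc).trans ?_
  have e1 := (HasFDerivAt.comp (f := fun ε : ℝ => (ε, x)) (0 : ℝ)
    (hd.differentiableAt one_ne_zero).hasFDerivAt
    (hasFDerivAt_prodMk_left (𝕜 := ℝ) (0 : ℝ) x)).fderiv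
  exact (congrArg (fun A : ℝ →L[ℝ] E => A 1) e1).trans (by simp)

theorem contMDiffAt_variation {p : M} (hp : p ∈ U) :
    ContMDiffAt 𝓘(ℝ, EB) (𝓘(ℝ, E).tangent) ∞ (variation (EZ := E) f) p := by
  refine contMDiffAt_tangentBundle (hf.contMDiffAt_section 0 hp) ?_
  have hs : IsSmoothChart (E := EB) (chartAt EB p) := isSmoothChart_chartAt p
  have hps := mem_chart_source EB p
  have h1 : ContDiffAt ℝ ∞ (fun x => fderiv ℝ (fun q : ℝ × EB =>
      chartAt E (f 0 p) (f q.1 ((chartAt EB p).symm q.2))) (0, x) (1, 0)) (chartAt EB p p) :=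
    (((hf.contDiffAt_chart hp).fderiv_right (m := ∞) (by simp)).comp (chartAt EB p p)
      (f := fun x : EB => ((0 : ℝ), x)) (by fun_prop)).clm_apply contDiffAt_const
  refine (ContMDiffAt.comp p h1.contMDiffAt (hs.contMDiffAt hps)).congr_of_eventuallyEq ?_
  have h2 := (hs.contMDiffAt hps).continuousAt.eventually (hf.chartVec_variation hp)
  filter_upwards [h2, (chartAt EB p).open_source.mem_nhds hps] with q hq hqs
  rw [(chartAt EB p).left_inv hqs] at hq
  exact hq

/-- The derivative of a variation is given by mixed second derivatives of the family. -/
theorem mk_mfderiv_variation {p : M} (hp : p ∈ U) (X : EB) :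
    (⟨variation f p, mfderiv 𝓘(ℝ, EB) (𝓘(ℝ, E).tangent) (variation f) p X⟩ : TT E Z) =
      ⟨⟨f 0 p, (fderiv ℝ (fun q : ℝ × EB => chartAt E (f 0 p) (f q.1 ((chartAt EB p).symm q.2)))
          (0, chartAt EB p p) (1, 0) : E)⟩,
        ((fderiv ℝ (fun q : ℝ × EB => chartAt E (f 0 p) (f q.1 ((chartAt EB p).symm q.2)))
            (0, chartAt EB p p) (0, X),
          fderiv ℝ (fderiv ℝ (fun q : ℝ × EB =>
            chartAt E (f 0 p) (f q.1 ((chartAt EB p).symm q.2)))) (0, chartAt EB p p)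
              (0, X) (1, 0)) :
          E × E)⟩ := by
  have hh := hf.contDiffAt_chart hp
  have hev := hf.chartVec_variation hp
  have e0 : variation f p = (⟨f 0 p, (fderiv ℝ (fun q : ℝ × EB => chartAt E (f 0 p)
      (f q.1 ((chartAt EB p).symm q.2))) (0, chartAt EB p p) (1, 0) : E)⟩ :
        TangentBundle 𝓘(ℝ, E) Z) := by
    have e1 := hev.self_of_nhds
    rw [(chartAt EB p).left_inv (mem_chart_source EB p)] at e1
    exact congrArg (TotalSpace.mk (f 0 p))
      ((chartVec_chartAt_self (f 0 p) (variation (EZ := E) f p).snd).symm.trans e1)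
  refine (mk_mfderiv_eq (hf.contMDiffAt_variation hp) e0 X).trans ?_
  refine congrArg (TotalSpace.mk _) (Prod.ext ?_ ?_)
  · have e1 := ((hh.differentiableAt (by simp)).hasFDerivAt.comp (chartAt EB p p)
      (hasFDerivAt_prodMk_right (0 : ℝ) (chartAt EB p p))).fderiv
    exact (congrArg (fun A : EB →L[ℝ] E => A X) e1).trans (by simp)
  · have e1 := ((((hh.fderiv_right (m := ∞) (by simp)).differentiableAt
      (by simp)).hasFDerivAt.comp (chartAt EB p p)
      (hasFDerivAt_prodMk_right (0 : ℝ) (chartAt EB p p))).clm_apply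
        (hasFDerivAt_const ((1 : ℝ), (0 : EB)) (chartAt EB p p))).congr_of_eventuallyEq hev
    exact (congrArg (fun A : EB →L[ℝ] E => A X) e1.fderiv).trans (by simp)

/-- The induced connection differentiates variations as required: both sides have the components
`(K ∂f, (D_{f'}K) ∂f + K ∂f')`, where `∂` is the derivative along `X`. -/
theorem covDeriv_inducedConnection [FiniteDimensional ℝ E] {P : EndField 𝓘(ℝ, E) Z}
    (hP : ContMDiff (𝓘(ℝ, E).tangent) (𝓘(ℝ, E).tangent) ∞ P.toMap)
    {p : M} (hp : p ∈ U) (X : ∀ p : M, TangentSpace 𝓘(ℝ, EB) p) :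
    covDeriv (inducedConnection P) X (variation f) p =
      canonicalFlip (velocity (𝓘(ℝ, E).tangent) (fun ε => covDeriv P X (f ε) p) 0) := by
  have hs : IsSmoothChart (E := E) (chartAt E (f 0 p)) := isSmoothChart_chartAt (f 0 p)
  have hh := hf.contDiffAt_chart hp
  have hl : (chartAt EB p).symm (chartAt EB p p) = p := symm_chartAt_self p
  have hcurve := hf.contMDiffAt_curve 0 hp
  have hK := hs.contDiffAt_chartRep hP (mem_chart_target E (f 0 p))
  have hline : Filter.Tendsto (fun ε : ℝ => (ε, chartAt EB p p)) (𝓝 0) (𝓝 (0, chartAt EB p p)) :=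
    (by fun_prop : Continuous fun ε : ℝ => (ε, chartAt EB p p)).tendsto _
  set h := fun q : ℝ × EB => chartAt E (f 0 p) (f q.1 ((chartAt EB p).symm q.2)) with hdef
  set K := chartRep P (chartAt E (f 0 p)) with hKdef
  set x₀ := chartAt EB p p with hx₀
  have hsrc : ∀ᶠ ε in 𝓝 (0 : ℝ), f ε p ∈ (chartAt E (f 0 p)).source :=
    hcurve.continuousAt.eventually_mem ((chartAt E (f 0 p)).open_source.mem_nhds
      (mem_chart_source E _))
  have h4 := (hh.of_le (m := 1) (by simp)).eventually (by simp)
  -- the components of `D_X f_ε` at `p`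
  have hpush : ∀ᶠ ε in 𝓝 (0 : ℝ),
      chartVec (chartAt E (f 0 p)) (⟨f ε p, mfderiv 𝓘(ℝ, EB) 𝓘(ℝ, E) (f ε) p (X p)⟩ :
        TangentBundle 𝓘(ℝ, E) Z) = fderiv ℝ h (ε, x₀) (0, X p) := by
    filter_upwards [hsrc, hline.eventually h4] with ε h1 h2
    have e1 := (isSmoothChart_chartAt (E := EB) p).chartVec_mfderiv hs
      (v := (⟨p, X p⟩ : TangentBundle 𝓘(ℝ, EB) M))
      ((hf.contMDiffAt_section ε hp).mdifferentiableAt (by simp)) (mem_chart_source EB p) h1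
    refine e1.trans ((congrArg _ (chartVec_chartAt_self p (X p))).trans ?_)
    have e2 := ((h2.differentiableAt one_ne_zero).hasFDerivAt.comp x₀
      (hasFDerivAt_prodMk_right ε x₀)).fderiv
    exact (congrArg (fun A : EB →L[ℝ] E => A (X p)) e2).trans rfl
  have hcov : ∀ᶠ ε in 𝓝 (0 : ℝ), chartVec (chartAt E (f 0 p)) (covDeriv P X (f ε) p) =
      K (h (ε, x₀)) (fderiv ℝ h (ε, x₀) (0, X p)) := by
    filter_upwards [hsrc, hpush] with ε h1 h2
    have e1 := hs.chartVec_toMap P (v := (⟨f ε p, mfderiv 𝓘(ℝ, EB) 𝓘(ℝ, E) (f ε) p (X p)⟩ :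
        TangentBundle 𝓘(ℝ, E) Z)) h1
    rw [h2] at e1
    have e2 : h (ε, x₀) = chartAt E (f 0 p) (f ε p) := by simp only [hdef, hl]
    rw [e2]
    exact e1
  have hh0 : h (0, x₀) = chartAt E (f 0 p) (f 0 p) := by simp only [hdef, hl]
  have hl' : ContDiffAt ℝ ∞ (fun ε : ℝ => (ε, x₀)) 0 := by fun_prop
  have hK' : ContDiffAt ℝ ∞ K (h (0, x₀)) := by rw [hh0]; exact hK
  have hcomp : ContDiffAt ℝ ∞ (fun ε : ℝ => K (h (ε, x₀)) (fderiv ℝ h (ε, x₀) (0, X p))) 0 := by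
    exact (hK'.comp (0 : ℝ) (hh.comp (0 : ℝ) hl')).clm_apply
      (((hh.fderiv_right (m := ∞) (by simp)).comp (0 : ℝ) hl').clm_apply contDiffAt_const)
  have hsm : ContMDiffAt 𝓘(ℝ, ℝ) (𝓘(ℝ, E).tangent) ∞ (fun ε => covDeriv P X (f ε) p) 0 :=
    contMDiffAt_tangentBundle hcurve (hcomp.contMDiffAt.congr_of_eventuallyEq hcov)
  have hbase : covDeriv P X (f 0) p = (⟨f 0 p, (K (chartAt E (f 0 p) (f 0 p))
      (fderiv ℝ h (0, x₀) (0, X p)) : E)⟩ : TangentBundle 𝓘(ℝ, E) Z) := by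
    have e1 := hcov.self_of_nhds
    rw [hh0] at e1
    exact congrArg (TotalSpace.mk (f 0 p))
      ((chartVec_chartAt_self (E := E) (f 0 p) _).symm.trans e1)
  obtain ⟨Xp, hXp⟩ : ∃ Y : EB, Y = X p := ⟨_, rfl⟩
  have hcov' : ∀ᶠ ε in 𝓝 (0 : ℝ), chartVec (chartAt E (f 0 p)) (covDeriv P X (f ε) p) =
      K (h (ε, x₀)) (fderiv ℝ h (ε, x₀) (0, Xp)) := by rw [hXp]; exact hcov
  have dh := (hh.differentiableAt (by simp)).hasFDerivAt
  have ddh := ((hh.fderiv_right (m := ∞) (by simp)).differentiableAt (by simp)).hasFDerivAt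
  have dl := hasFDerivAt_prodMk_left (𝕜 := ℝ) (0 : ℝ) x₀
  have dK := (hK'.differentiableAt (by simp)).hasFDerivAt
  have dhl := HasFDerivAt.comp (f := fun ε : ℝ => (ε, x₀)) (0 : ℝ) dh dl
  have ddhl := HasFDerivAt.comp (f := fun ε : ℝ => (ε, x₀)) (0 : ℝ) ddh dl
  have e1 := ((HasFDerivAt.comp (f := fun ε : ℝ => h (ε, x₀)) (0 : ℝ) dK dhl).clm_apply
    (ddhl.clm_apply (hasFDerivAt_const ((0 : ℝ), Xp) (0 : ℝ)))).congr_of_eventuallyEq hcov'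
  have hsymm := (hh.isSymmSndFDerivAt (by simpa using ENat.LEInfty.out)) (1, 0) (0, Xp)
  have eα : fderiv ℝ (fun s => chartAt E (f 0 p) (f s p)) 0 1 = fderiv ℝ h (0, x₀) (1, 0) := by
    have e2 : (fun s => chartAt E (f 0 p) (f s p)) = fun ε : ℝ => h (ε, x₀) :=
      funext fun s => by simp only [hdef, hl]
    rw [e2]
    exact congrArg (fun A : ℝ →L[ℝ] E => A 1) dhl.fderiv
  have eβ : fderiv ℝ (fun s => chartVec (chartAt E (f 0 p)) (covDeriv P X (f s) p)) 0 1 =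
      fderiv ℝ K (h (0, x₀)) (fderiv ℝ h (0, x₀) (1, 0)) (fderiv ℝ h (0, x₀) (0, Xp)) +
        K (h (0, x₀)) (fderiv ℝ (fderiv ℝ h) (0, x₀) (0, Xp) (1, 0)) :=
    (congrArg (fun A : ℝ →L[ℝ] E => A 1) e1.fderiv).trans (by rw [← hsymm]; simp [add_comm])
  have hvel := (velocity_tangentBundle hsm hbase).trans
    (congrArg₂ (fun a b : E => (⟨⟨f 0 p, (K (chartAt E (f 0 p) (f 0 p))
      (fderiv ℝ h (0, x₀) (0, X p)) : E)⟩, ((a, b) : E × E)⟩ : TT E Z)) eα eβ)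
  refine Eq.trans ?_ (congrArg canonicalFlip hvel).symm
  refine (congrArg (inducedConnection P).toMap (hf.mk_mfderiv_variation hp (X p))).trans ?_
  rw [inducedConnection_toMap, inducedMatrix_apply]
  refine congrArg (TotalSpace.mk _) (Prod.ext rfl ?_)
  rw [hh0, hXp]

end IsSectionFamily

end Variation

/-! ### Extensions of tangent vectors to vector fields and to families of sections -/

section Extension

variable {EB : Type*} [NormedAddCommGroup EB] [NormedSpace ℝ EB]
  {M : Type*} [TopologicalSpace M] [ChartedSpace EB M]
  {EF : Type*} [NormedAddCommGroup EF] [NormedSpace ℝ EF]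
  {E : Type*} [NormedAddCommGroup E] [NormedSpace ℝ E]
  {Z : Type*} [TopologicalSpace Z] [ChartedSpace E Z]

/-- Every tangent vector is the value of a global smooth vector field. -/
theorem exists_isSmoothVectorField [FiniteDimensional ℝ EB] [T2Space M] [IsManifold 𝓘(ℝ, EB) ∞ M]
    (p : M) (u : TangentSpace 𝓘(ℝ, EB) p) :
    ∃ X : ∀ p : M, TangentSpace 𝓘(ℝ, EB) p, IsSmoothVectorField 𝓘(ℝ, EB) X ∧ X p = u := by
  obtain ⟨s, hs, hext⟩ := FiberBundle.exists_contMDiffOn_extend (k := ∞) 𝓘(ℝ, EB) EB u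
  obtain ⟨t, hts, ht, hpt⟩ := mem_nhds_iff.1 hs
  obtain ⟨ρ, -, hρ⟩ := (SmoothBumpFunction.nhds_basis_tsupport (I := 𝓘(ℝ, EB)) p).mem_iff.1
    (ht.mem_nhds hpt)
  refine ⟨(ρ : M → ℝ) • FiberBundle.extend EB u,
    ContMDiffOn.smul_section_of_tsupport ρ.contMDiff.contMDiffOn ht hρ (hext.mono hts), ?_⟩
  simp

/-- A smooth fiber bundle has a fibered chart around each point: the product of a chart of the base
with a chart of the fiber, composed with a trivialization. -/
theorem IsSmoothFiberBundle.exists_isFiberedChart [IsManifold 𝓘(ℝ, EB) ∞ M]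
    [IsManifold 𝓘(ℝ, E) ∞ Z] {F : Type*} [TopologicalSpace F] [ChartedSpace EF F]
    [IsManifold 𝓘(ℝ, EF) ∞ F] {pr : Z → M}
    (h : IsSmoothFiberBundle (EB := EB) (EF := EF) (EZ := E) F pr) (z : Z) :
    ∃ (φ : OpenPartialHomeomorph Z (EB × EF)) (x : OpenPartialHomeomorph M EB),
      IsFiberedChart (EZ := E) pr φ x ∧ z ∈ φ.source := by
  obtain ⟨e, he, hsm, hsymm⟩ := h.locally_trivial (pr z)
  have hze : z ∈ e.source := e.mem_source.2 he
  refine ⟨e.toOpenPartialHomeomorph.trans ((chartAt EB (pr z)).prod (chartAt EF (e z).2)),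
    chartAt EB (pr z), ⟨?_, ?_, contMDiffOn_chart, contMDiffOn_chart_symm, ?_, ?_⟩, ?_⟩
  · have h1 : ContMDiffOn (𝓘(ℝ, EB).prod 𝓘(ℝ, EF)) 𝓘(ℝ, EB × EF) ∞
        (fun q : M × F => (chartAt EB (pr z) q.1, chartAt EF (e z).2 q.2))
        ((chartAt EB (pr z)).prod (chartAt EF (e z).2)).source :=
      (contMDiffOn_chart.comp contMDiff_fst.contMDiffOn fun y hy => hy.1).prodMk_space
        (contMDiffOn_chart.comp contMDiff_snd.contMDiffOn fun y hy => hy.2)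
    exact h1.comp (hsm.mono fun y hy => hy.1) fun y hy => hy.2
  · have h1 : ContMDiffOn 𝓘(ℝ, EB × EF) (𝓘(ℝ, EB).prod 𝓘(ℝ, EF)) ∞
        (fun q : EB × EF => ((chartAt EB (pr z)).symm q.1, (chartAt EF (e z).2).symm q.2))
        ((chartAt EB (pr z)).prod (chartAt EF (e z).2)).target :=
      (contMDiffOn_chart_symm.comp contDiff_fst.contMDiff.contMDiffOn fun y hy => hy.1).prodMk
        (contMDiffOn_chart_symm.comp contDiff_snd.contMDiff.contMDiffOn fun y hy => hy.2)
    exact hsymm.comp (h1.mono fun y hy => hy.1) fun y hy => hy.2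
  · rintro y ⟨hy, hy'⟩
    rw [← e.coe_fst hy]
    exact hy'.1
  · rintro y ⟨hy, hy'⟩
    exact congrArg (chartAt EB (pr z)) (e.coe_fst hy)
  · refine ⟨hze, ?_, mem_chart_source EF _⟩
    change (e z).1 ∈ _
    rw [e.coe_fst hze]
    exact mem_chart_source EB _

/-- Every vertical vector is the variation of a family of local sections. -/
theorem IsFiberedChart.exists_isSectionFamily [IsManifold 𝓘(ℝ, EB) ∞ M]
    [IsManifold 𝓘(ℝ, E) ∞ Z] {pr : Z → M} (hpr : ContMDiff 𝓘(ℝ, E) 𝓘(ℝ, EB) ∞ pr)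
    {φ : OpenPartialHomeomorph Z (EB × EF)} {x : OpenPartialHomeomorph M EB}
    (h : IsFiberedChart (EZ := E) pr φ x) {v : TangentBundle 𝓘(ℝ, E) Z} (hv : v.proj ∈ φ.source)
    (hvert : v ∈ verticalBundle (EB := EB) pr) :
    ∃ (U : Set M) (f : ℝ → M → Z) (p : M), IsSectionFamily (EB := EB) (EZ := E) pr U f ∧ p ∈ U ∧
      variation f p = v := by
  have hs := h.isSmoothChart
  have hb := h.isSmoothChart_base
  have hφz := φ.map_source hv
  have hpz : pr v.proj ∈ x.source := h.mapsTo _ hv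
  -- the components of `v` are of the form `(0, c)`
  obtain ⟨c, hc⟩ : ∃ c : EF, chartVec φ v = (0, c) := by
    refine ⟨(chartVec φ v).2, Prod.ext ?_ rfl⟩
    have h1 := hs.chartVec_mfderiv hb (f := pr) (hpr.mdifferentiable (by simp) _) hv hpz
    rw [h.fderiv_proj hφz] at h1
    refine h1.symm.trans ?_
    exact (congrArg (mfderiv 𝓘(ℝ, EB) 𝓘(ℝ, EB) x (pr v.proj)) hvert).trans (map_zero _)
  obtain ⟨r, hr, hball⟩ := Metric.isOpen_iff.1 φ.open_target _ hφz
  -- a bounded reparametrization keeps the family inside the chart for all `ε`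
  set δ : ℝ := r / (‖c‖ + 1) with hδ
  have hδ0 : 0 < δ := by positivity
  set k : ℝ → EF := fun ε => (φ v.proj).2 + (δ * Real.sin (ε / δ)) • c with hk
  have hkd : ContDiff ℝ ∞ k :=
    contDiff_const.add ((contDiff_const.mul (Real.contDiff_sin.comp (contDiff_id.div_const _))).smul
      contDiff_const)
  have hk0 : k 0 = (φ v.proj).2 := by simp [hk]
  have hkd0 : HasDerivAt k c 0 := by
    have h1 : HasDerivAt (fun ε : ℝ => δ * Real.sin (ε / δ)) 1 0 := by
      have h2 : HasDerivAt (fun ε : ℝ => δ * Real.sin (ε / δ))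
          (δ * (Real.cos (0 / δ) * (1 / δ))) 0 :=
        ((hasDerivAt_id (0 : ℝ)).div_const δ).sin.const_mul δ
      rwa [zero_div, Real.cos_zero, one_mul, mul_one_div_cancel hδ0.ne'] at h2
    have h2 := (h1.smul_const c).const_add (φ v.proj).2
    rwa [one_smul] at h2
  have hkb : ∀ ε, dist (k ε) (φ v.proj).2 < r := by
    intro ε
    have h1 : |δ * Real.sin (ε / δ)| ≤ δ := by
      rw [abs_mul, abs_of_pos hδ0]
      exact mul_le_of_le_one_right hδ0.le (Real.abs_sin_le_one _)
    have h2 : δ * (‖c‖ + 1) = r := div_mul_cancel₀ r (by positivity)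
    simp only [hk, dist_self_add_left, norm_smul, Real.norm_eq_abs]
    nlinarith [norm_nonneg c, mul_le_mul_of_nonneg_right h1 (norm_nonneg c)]
  set U : Set M := x.source ∩ x ⁻¹' Metric.ball (x (pr v.proj)) r with hU
  have hfst : (φ v.proj).1 = x (pr v.proj) := h.fst_eq _ hv
  have hmem : ∀ ε, ∀ q ∈ U, (x q, k ε) ∈ φ.target := by
    rintro ε q ⟨-, hq⟩
    refine hball ?_
    rw [Metric.mem_ball, Prod.dist_eq, hfst]
    exact max_lt hq (hkb ε)
  have hpU : pr v.proj ∈ U := ⟨hpz, Metric.mem_ball_self hr⟩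
  have hf : IsSectionFamily (EB := EB) (EZ := E) pr U (fun ε q => φ.symm (x q, k ε)) := by
    refine ⟨x.isOpen_inter_preimage Metric.isOpen_ball, ?_, ?_⟩
    · refine h.smooth_symm.comp (t := φ.target) ?_ fun q hq => hmem q.1 q.2 hq.2
      rw [modelWithCornersSelf_prod, ← chartedSpaceSelf_prod]
      exact (h.smooth_base.comp contMDiff_snd.contMDiffOn fun q hq => hq.2.1).prodMk
        (hkd.contMDiff.comp contMDiff_fst).contMDiffOn
    · intro ε q hq
      exact x.injOn (h.proj_symm_mem (hmem ε q hq)) hq.1 (h.proj_symm_eq (hmem ε q hq))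
  refine ⟨U, _, pr v.proj, hf, hpU, ?_⟩
  have hbase : (x (pr v.proj), k 0) = φ v.proj := Prod.ext hfst.symm hk0
  have hsrc : φ.symm (x (pr v.proj), k 0) ∈ φ.source := φ.map_target (hmem 0 _ hpU)
  have h1 := hs.chartVec_velocity ((hf.contMDiffAt_curve 0 hpU).mdifferentiableAt (by simp)) hsrc
  have h2 : (fun ε => φ (φ.symm (x (pr v.proj), k ε))) = fun ε => (x (pr v.proj), k ε) :=
    funext fun ε => φ.right_inv (hmem ε _ hpU)
  have h3 : fderiv ℝ (fun ε => (x (pr v.proj), k ε)) 0 1 = (0, c) := by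
    rw [((hasDerivAt_const (0 : ℝ) (x (pr v.proj))).prodMk hkd0).hasFDerivAt.fderiv]
    simp
  rw [h2, h3] at h1
  have h4 := hs.ofChartVec_chartVec (v := variation (EZ := E) (fun ε q => φ.symm (x q, k ε))
    (pr v.proj)) hsrc
  refine h4.symm.trans (Eq.trans ?_ (hs.ofChartVec_chartVec hv))
  exact congrArg₂ (ofChartVec φ) ((φ.right_inv (hmem 0 _ hpU)).trans hbase) (h1.trans hc.symm)

end Extension

/-! ### Uniqueness of the induced connection -/

section Uniqueness

variable {EB : Type*} [NormedAddCommGroup EB] [NormedSpace ℝ EB]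
  {M : Type*} [TopologicalSpace M] [ChartedSpace EB M] [IsManifold 𝓘(ℝ, EB) ∞ M]
  {E : Type*} [NormedAddCommGroup E] [NormedSpace ℝ E] [FiniteDimensional ℝ E]
  {Z : Type*} [TopologicalSpace Z] [ChartedSpace E Z] [IsManifold 𝓘(ℝ, E) ∞ Z]
  {pr : Z → M} {P : EndField 𝓘(ℝ, E) Z}
  {Q Q' : EndField (𝓘(ℝ, E).tangent) (TangentBundle 𝓘(ℝ, E) Z)}

omit [FiniteDimensional ℝ E] [IsManifold 𝓘(ℝ, EB) ∞ M] in
theorem proj_mem_verticalBundle {ξ : TT E Z} (hξ : ξ ∈ tangentVerticalBundle (EB := EB) pr) :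
    ξ.proj ∈ verticalBundle (EB := EB) pr := by
  obtain ⟨c, -, hc, rfl⟩ := hξ
  exact hc.self_of_nhds

omit [FiniteDimensional ℝ E] [IsManifold 𝓘(ℝ, EB) ∞ M] in
/-- A connection on the vertical bundle fixes the doubly vertical vectors. -/
theorem IsVerticalConnection.toMap_eq_self (hQ : IsVerticalConnection (EB := EB) pr Q) {ξ : TT E Z}
    (hξ : ξ ∈ doubleVerticalBundle (EB := EB) pr) : Q.toMap ξ = ξ := by
  obtain ⟨η, hη, rfl⟩ := (hQ.range_eq ξ (proj_mem_verticalBundle hξ.1)).2 hξ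
  exact hQ.idem η hη

theorem IsConnection.sub_mem_tangentVerticalBundle (hP : IsConnection (EB := EB) pr P)
    (hpr : ContMDiff 𝓘(ℝ, E) 𝓘(ℝ, EB) ∞ pr) {v : TangentBundle 𝓘(ℝ, E) Z}
    {η η' : TangentSpace (𝓘(ℝ, E).tangent) v}
    (h : (⟨v, η⟩ : TT E Z) ∈ tangentVerticalBundle (EB := EB) pr)
    (h' : (⟨v, η'⟩ : TT E Z) ∈ tangentVerticalBundle (EB := EB) pr) :
    (⟨v, η - η'⟩ : TT E Z) ∈ tangentVerticalBundle (EB := EB) pr := by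
  obtain ⟨z, (w : E)⟩ := v
  obtain ⟨a, b⟩ : E × E := η
  obtain ⟨a', b'⟩ : E × E := η'
  obtain ⟨h1, h2⟩ := (hP.mem_tangentVerticalBundle_iff hpr z w a b).1 h
  obtain ⟨-, h3⟩ := (hP.mem_tangentVerticalBundle_iff hpr z w a' b').1 h'
  refine (hP.mem_tangentVerticalBundle_iff hpr z w (a - a') (b - b')).2 ⟨h1, ?_⟩
  rw [map_sub, map_sub, sub_apply]
  linear_combination (norm := module) h2 - h3

/-- A vector tangent to the vertical bundle differs from a derivative of a variation by a doubly
vertical vector; the value of an induced connection is prescribed on both. -/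
theorem IsInducedConnection.toMap_eq_of_variation [FiniteDimensional ℝ EB] [T2Space M]
    (hP : IsConnection (EB := EB) pr P) (hpr : ContMDiff 𝓘(ℝ, E) 𝓘(ℝ, EB) ∞ pr)
    (hQ : IsInducedConnection (EB := EB) pr P Q) (hQ' : IsInducedConnection (EB := EB) pr P Q')
    {U : Set M} {f : ℝ → M → Z} (hf : IsSectionFamily (EB := EB) (EZ := E) pr U f) {p : M}
    (hp : p ∈ U) {η : TangentSpace (𝓘(ℝ, E).tangent) (variation (EZ := E) f p)}
    (hη : (⟨variation f p, η⟩ : TT E Z) ∈ tangentVerticalBundle (EB := EB) pr) :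
    Q'.toMap ⟨variation f p, η⟩ = Q.toMap ⟨variation f p, η⟩ := by
  have hVs : ContMDiffAt 𝓘(ℝ, EB) (𝓘(ℝ, E).tangent) ∞ (variation f) p := hf.contMDiffAt_variation hp
  have hVp : ∀ q ∈ U, pr (variation (EZ := E) f q).proj = q := hf.proj_eq 0
  have hπ : ContMDiff (𝓘(ℝ, E).tangent) 𝓘(ℝ, EB) ∞
      (fun v : TangentBundle 𝓘(ℝ, E) Z => pr v.proj) :=
    hpr.comp (contMDiff_proj (TangentSpace 𝓘(ℝ, E)))
  obtain ⟨X, hX, hXp⟩ := exists_isSmoothVectorField p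
    (show TangentSpace 𝓘(ℝ, EB) p from mfderiv (𝓘(ℝ, E).tangent) 𝓘(ℝ, EB)
      (fun v : TangentBundle 𝓘(ℝ, E) Z => pr v.proj) (variation (EZ := E) f p) η)
  set η₁ : TangentSpace (𝓘(ℝ, E).tangent) (variation (EZ := E) f p) :=
    mfderiv 𝓘(ℝ, EB) (𝓘(ℝ, E).tangent) (variation f) p (X p) with hη₁
  have hη₁v : (⟨variation (EZ := E) f p, η₁⟩ : TT E Z) ∈ tangentVerticalBundle (EB := EB) pr :=
    mem_tangentVerticalBundle_of_mfderiv hVs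
      (Filter.mem_of_superset (hf.isOpen.mem_nhds hp) fun q hq => hf.variation_mem hpr hq) (X p)
  have hπη₁ : mfderiv (𝓘(ℝ, E).tangent) 𝓘(ℝ, EB)
      (fun v : TangentBundle 𝓘(ℝ, E) Z => pr v.proj) (variation (EZ := E) f p) η₁ = X p := by
    have h1 := ((hπ.mdifferentiable (by simp) (variation (EZ := E) f p)).hasMFDerivAt.comp p
      (hVs.mdifferentiableAt (by simp)).hasMFDerivAt).congr_of_eventuallyEq (f₁ := id)
      (Filter.mem_of_superset (hf.isOpen.mem_nhds hp) fun q hq => (hVp q hq).symm)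
    exact congrArg (fun A : EB →L[ℝ] EB => A (X p)) (hasMFDerivAt_unique h1 (hasMFDerivAt_id p))
  have hd : (⟨variation (EZ := E) f p, η - η₁⟩ : TT E Z) ∈ doubleVerticalBundle (EB := EB) pr := by
    refine ⟨hP.sub_mem_tangentVerticalBundle hpr hη hη₁v, ?_⟩
    refine (map_sub _ _ _).trans (sub_eq_zero.2 ?_)
    exact hXp.symm.trans hπη₁.symm
  have h1 : Q' (variation (EZ := E) f p) η₁ = Q (variation (EZ := E) f p) η₁ :=
    eq_of_heq (TotalSpace.mk.inj ((hQ'.covDeriv_variation X hX U f hf p hp).trans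
      (hQ.covDeriv_variation X hX U f hf p hp).symm)).2
  have h2 : Q' (variation (EZ := E) f p) (η - η₁) = Q (variation (EZ := E) f p) (η - η₁) :=
    eq_of_heq (TotalSpace.mk.inj ((hQ'.toMap_eq_self hd).trans (hQ.toMap_eq_self hd).symm)).2
  have h3 : ∀ R : EndField (𝓘(ℝ, E).tangent) (TangentBundle 𝓘(ℝ, E) Z),
      R (variation (EZ := E) f p) η =
        R (variation (EZ := E) f p) (η - η₁) + R (variation (EZ := E) f p) η₁ := fun R => by
    rw [← map_add, sub_add_cancel]
  exact congrArg (TotalSpace.mk (variation (EZ := E) f p))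
    ((h3 Q').trans ((congrArg₂ _ h2 h1).trans (h3 Q).symm))

/-- The induced connection is determined by `P`. -/
theorem IsInducedConnection.toMap_eq [FiniteDimensional ℝ EB] [T2Space M]
    {EF : Type*} [NormedAddCommGroup EF] [NormedSpace ℝ EF]
    {F : Type*} [TopologicalSpace F] [ChartedSpace EF F] [IsManifold 𝓘(ℝ, EF) ∞ F]
    (hpr : IsSmoothFiberBundle (EB := EB) (EF := EF) (EZ := E) F pr)
    (hP : IsConnection (EB := EB) pr P)
    (hQ : IsInducedConnection (EB := EB) pr P Q) (hQ' : IsInducedConnection (EB := EB) pr P Q')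
    {ξ : TT E Z} (hξ : ξ ∈ tangentVerticalBundle (EB := EB) pr) : Q'.toMap ξ = Q.toMap ξ := by
  obtain ⟨φ, x, hφ, hz⟩ := hpr.exists_isFiberedChart ξ.proj.proj
  obtain ⟨U, f, p, hf, hp, hv⟩ := hφ.exists_isSectionFamily hpr.smooth hz
    (proj_mem_verticalBundle hξ)
  obtain ⟨v, η⟩ := ξ
  subst hv
  exact hQ.toMap_eq_of_variation hP hpr.smooth hQ' hf hp hξ

theorem IsConnection.isInducedConnection (hP : IsConnection (EB := EB) pr P)
    (hpr : ContMDiff 𝓘(ℝ, E) 𝓘(ℝ, EB) ∞ pr) :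
    IsInducedConnection (EB := EB) pr P (inducedConnection P) where
  toIsVerticalConnection := hP.isVerticalConnection_induced hpr
  covDeriv_variation X _ _ _ hf _ hp := hf.covDeriv_inducedConnection hP.smooth hp X

end Uniqueness

/-! ### The curvature identity -/

section CurvatureIdentity

variable {EB : Type*} [NormedAddCommGroup EB] [NormedSpace ℝ EB]
  {M : Type*} [TopologicalSpace M] [ChartedSpace EB M] [IsManifold 𝓘(ℝ, EB) ∞ M]
  {E : Type*} [NormedAddCommGroup E] [NormedSpace ℝ E] [FiniteDimensional ℝ E]
  {Z : Type*} [TopologicalSpace Z] [ChartedSpace E Z] [IsManifold 𝓘(ℝ, E) ∞ Z]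
  {pr : Z → M} {P : EndField 𝓘(ℝ, E) Z} {f : M → Z} {p : M}
  {X Y : ∀ p : M, TangentSpace 𝓘(ℝ, EB) p}

omit [FiniteDimensional ℝ E] in
theorem doubleProj_mk (z : Z) (w a b : E) :
    doubleProj (⟨⟨z, w⟩, (a, b)⟩ : TT E Z) = (⟨z, w⟩, ⟨z, a⟩) :=
  Prod.ext rfl (congrArg (TotalSpace.mk z) (mfderiv_proj ⟨z, w⟩ ((a, b) : E × E)))

/-- The components of a vector field in the preferred chart at `p`. -/
def fieldInChart (Y : ∀ p : M, TangentSpace 𝓘(ℝ, EB) p) (p : M) (x : EB) : EB :=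
  chartVec (chartAt EB p) (⟨(chartAt EB p).symm x, Y ((chartAt EB p).symm x)⟩ :
    TangentBundle 𝓘(ℝ, EB) M)

/-- A map in the preferred charts around `p` and its image. -/
def mapInChart (EB : Type*) [NormedAddCommGroup EB] [NormedSpace ℝ EB] [ChartedSpace EB M]
    (E : Type*) [NormedAddCommGroup E] [NormedSpace ℝ E] [ChartedSpace E Z] (f : M → Z) (p : M) :
    EB → E :=
  chartAt E (f p) ∘ f ∘ (chartAt EB p).symm

theorem contDiffAt_fieldInChart (hY : IsSmoothVectorField 𝓘(ℝ, EB) Y) (p : M) :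
    ContDiffAt ℝ ∞ (fieldInChart Y p) (chartAt EB p p) :=
  (isSmoothChart_chartAt (E := EB) p).contMDiffAt_comp_chartVec (mem_chart_target EB p)
    (hY _)

theorem fieldInChart_self (Y : ∀ p : M, TangentSpace 𝓘(ℝ, EB) p) (p : M) :
    fieldInChart Y p (chartAt EB p p) = Y p := by
  have key : ∀ q, q = p → chartVec (chartAt EB p) (⟨q, Y q⟩ : TangentBundle 𝓘(ℝ, EB) M) = Y p := by
    rintro _ rfl
    exact chartVec_chartAt_self _ _
  exact key _ (symm_chartAt_self p)

omit [FiniteDimensional ℝ E] in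
theorem contDiffAt_mapInChart (hf : ContMDiffAt 𝓘(ℝ, EB) 𝓘(ℝ, E) ∞ f p) :
    ContDiffAt ℝ ∞ (mapInChart EB E f p) (chartAt EB p p) := by
  rw [← contMDiffAt_iff_contDiffAt]
  have h1 : ContMDiffAt 𝓘(ℝ, EB) 𝓘(ℝ, E) ∞ f ((chartAt EB p).symm (chartAt EB p p)) := by
    rwa [symm_chartAt_self]
  refine ContMDiffAt.comp _ ((isSmoothChart_chartAt (E := E) (f p)).contMDiffAt ?_)
    (h1.comp _ ((isSmoothChart_chartAt (E := EB) p).contMDiffAt_symm (mem_chart_target EB p)))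
  simp only [Function.comp, symm_chartAt_self]
  exact mem_chart_source E _

omit [FiniteDimensional ℝ E] in
/-- The components of `D_Y f`. -/
theorem chartVec_covDeriv (hf : ContMDiffAt 𝓘(ℝ, EB) 𝓘(ℝ, E) ∞ f p) :
    ∀ᶠ x in 𝓝 (chartAt EB p p),
      chartVec (chartAt E (f p)) (covDeriv P Y f ((chartAt EB p).symm x)) =
        chartRep P (chartAt E (f p)) (mapInChart EB E f p x)
          (fderiv ℝ (mapInChart EB E f p) x (fieldInChart Y p x)) := by
  have hψ : IsSmoothChart (E := EB) (chartAt EB p) := isSmoothChart_chartAt p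
  have hφ : IsSmoothChart (E := E) (chartAt E (f p)) := isSmoothChart_chartAt (f p)
  have hcs := (chartAt EB p).continuousAt_symm (mem_chart_target EB p)
  have hd : ∀ᶠ q in 𝓝 p, MDifferentiableAt 𝓘(ℝ, EB) 𝓘(ℝ, E) f q := by
    have : IsManifold 𝓘(ℝ, EB) 1 M := IsManifold.of_le (n := ∞) (by simp)
    have : IsManifold 𝓘(ℝ, E) 1 Z := IsManifold.of_le (n := ∞) (by simp)
    have h1 := (contMDiffAt_iff_contMDiffAt_nhds (n := 1) (by simp)).1 (hf.of_le (by simp))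
    exact h1.mono fun q hq => hq.mdifferentiableAt one_ne_zero
  have hsrc : ∀ᶠ q in 𝓝 p, f q ∈ (chartAt E (f p)).source :=
    hf.continuousAt.eventually_mem ((chartAt E (f p)).open_source.mem_nhds (mem_chart_source E _))
  have h2 : ∀ᶠ q in 𝓝 ((chartAt EB p).symm (chartAt EB p p)),
      MDifferentiableAt 𝓘(ℝ, EB) 𝓘(ℝ, E) f q ∧ f q ∈ (chartAt E (f p)).source := by
    rw [symm_chartAt_self]
    exact hd.and hsrc
  filter_upwards [hcs.eventually h2, (chartAt EB p).open_target.mem_nhds (mem_chart_target EB p)]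
    with x hx hxt
  have h3 := hφ.chartVec_toMap P (v := (⟨f ((chartAt EB p).symm x),
    mfderiv 𝓘(ℝ, EB) 𝓘(ℝ, E) f ((chartAt EB p).symm x) (Y ((chartAt EB p).symm x))⟩ :
      TangentBundle 𝓘(ℝ, E) Z)) hx.2
  have h4 := hψ.chartVec_mfderiv hφ (v := (⟨(chartAt EB p).symm x, Y ((chartAt EB p).symm x)⟩ :
    TangentBundle 𝓘(ℝ, EB) M)) hx.1 ((chartAt EB p).map_target hxt) hx.2
  rw [(chartAt EB p).right_inv hxt] at h4
  exact h3.trans (congrArg _ h4)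

theorem contDiffAt_chartVec_covDeriv
    (hP : ContMDiff (𝓘(ℝ, E).tangent) (𝓘(ℝ, E).tangent) ∞ P.toMap)
    (hf : ContMDiffAt 𝓘(ℝ, EB) 𝓘(ℝ, E) ∞ f p) (hY : IsSmoothVectorField 𝓘(ℝ, EB) Y) :
    ContDiffAt ℝ ∞ (fun x => chartRep P (chartAt E (f p)) (mapInChart EB E f p x)
      (fderiv ℝ (mapInChart EB E f p) x (fieldInChart Y p x))) (chartAt EB p p) := by
  have hh := contDiffAt_mapInChart hf
  have hK : ContDiffAt ℝ ∞ (chartRep P (chartAt E (f p)))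
      (mapInChart EB E f p (chartAt EB p p)) := by
    simp only [mapInChart, Function.comp, symm_chartAt_self]
    exact (isSmoothChart_chartAt (E := E) (f p)).contDiffAt_chartRep hP (mem_chart_target E _)
  exact (hK.comp _ hh).clm_apply
    ((hh.fderiv_right (m := ∞) (by simp)).clm_apply (contDiffAt_fieldInChart hY p))

theorem contMDiffAt_covDeriv
    (hP : ContMDiff (𝓘(ℝ, E).tangent) (𝓘(ℝ, E).tangent) ∞ P.toMap)
    (hf : ContMDiffAt 𝓘(ℝ, EB) 𝓘(ℝ, E) ∞ f p) (hY : IsSmoothVectorField 𝓘(ℝ, EB) Y) :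
    ContMDiffAt 𝓘(ℝ, EB) (𝓘(ℝ, E).tangent) ∞ (covDeriv P Y f) p := by
  refine contMDiffAt_tangentBundle hf ?_
  have hps := mem_chart_source EB p
  have hψ : IsSmoothChart (E := EB) (chartAt EB p) := isSmoothChart_chartAt p
  refine (ContMDiffAt.comp p (contDiffAt_chartVec_covDeriv hP hf hY).contMDiffAt
    (hψ.contMDiffAt hps)).congr_of_eventuallyEq ?_
  filter_upwards [(hψ.contMDiffAt hps).continuousAt.eventually (chartVec_covDeriv hf),
    (chartAt EB p).open_source.mem_nhds hps] with q hq hqs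
  rw [(chartAt EB p).left_inv hqs] at hq
  exact hq

/-- The derivative of `D_Y f` along `u`, in terms of the components `a`, `b` of `f_* u` and `f_* Y`
and of the derivative `s` of the latter along `u`. -/
theorem mk_mfderiv_covDeriv
    (hP : ContMDiff (𝓘(ℝ, E).tangent) (𝓘(ℝ, E).tangent) ∞ P.toMap)
    (hf : ContMDiffAt 𝓘(ℝ, EB) 𝓘(ℝ, E) ∞ f p) (hY : IsSmoothVectorField 𝓘(ℝ, EB) Y) {a b s : E}
    (u : EB) (ha : fderiv ℝ (mapInChart EB E f p) (chartAt EB p p) u = a)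
    (hb : fderiv ℝ (mapInChart EB E f p) (chartAt EB p p) (Y p) = b)
    (hs : fderiv ℝ (fun x => fderiv ℝ (mapInChart EB E f p) x (fieldInChart Y p x))
      (chartAt EB p p) u = s) :
    (⟨covDeriv P Y f p, mfderiv 𝓘(ℝ, EB) (𝓘(ℝ, E).tangent) (covDeriv P Y f) p u⟩ : TT E Z) =
      ⟨⟨f p, (chartRep P (chartAt E (f p)) (chartAt E (f p) (f p)) b : E)⟩,
        ((a, fderiv ℝ (chartRep P (chartAt E (f p))) (chartAt E (f p) (f p)) a b +
          chartRep P (chartAt E (f p)) (chartAt E (f p) (f p)) s) : E × E)⟩ := by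
  have hev := chartVec_covDeriv (P := P) (Y := Y) hf
  have hh := contDiffAt_mapInChart hf
  have hh0 : mapInChart EB E f p (chartAt EB p p) = chartAt E (f p) (f p) := by
    simp only [mapInChart, Function.comp, symm_chartAt_self]
  have hK : ContDiffAt ℝ ∞ (chartRep P (chartAt E (f p)))
      (mapInChart EB E f p (chartAt EB p p)) := by
    rw [hh0]
    exact (isSmoothChart_chartAt (E := E) (f p)).contDiffAt_chartRep hP (mem_chart_target E _)
  have hb' : fderiv ℝ (mapInChart EB E f p) (chartAt EB p p)
      (fieldInChart Y p (chartAt EB p p)) = b := (congrArg _ (fieldInChart_self Y p)).trans hb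
  have e0 : covDeriv P Y f p =
      (⟨f p, (chartRep P (chartAt E (f p)) (chartAt E (f p) (f p)) b : E)⟩ :
        TangentBundle 𝓘(ℝ, E) Z) := by
    have e1 := hev.self_of_nhds
    rw [symm_chartAt_self, hb', hh0] at e1
    exact congrArg (TotalSpace.mk (f p)) ((chartVec_chartAt_self (E := E) (f p) _).symm.trans e1)
  refine (mk_mfderiv_eq (contMDiffAt_covDeriv hP hf hY) e0 u).trans ?_
  refine congrArg (TotalSpace.mk _) (Prod.ext ha ?_)
  have d1 : DifferentiableAt ℝ (fun x => fderiv ℝ (mapInChart EB E f p) x (fieldInChart Y p x))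
      (chartAt EB p p) :=
    ((hh.fderiv_right (m := ∞) (by simp)).clm_apply
      (contDiffAt_fieldInChart hY p)).differentiableAt (by simp)
  have e2 := ((HasFDerivAt.comp (chartAt EB p p) (hK.differentiableAt (by simp)).hasFDerivAt
    (hh.differentiableAt (by simp)).hasFDerivAt).clm_apply d1.hasFDerivAt).congr_of_eventuallyEq hev
  refine (congrArg (fun A : EB →L[ℝ] E => A u) e2.fderiv).trans ?_
  simp [ha, hb', hs, hh0, add_comm]

omit [FiniteDimensional ℝ E] [IsManifold 𝓘(ℝ, EB) ∞ M] in
/-- Covariant derivatives of sections are vertical. -/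
theorem IsConnection.covDeriv_mem (hP : IsConnection (EB := EB) pr P) (f : M → Z) (q : M) :
    covDeriv P Y f q ∈ verticalBundle (EB := EB) pr :=
  (hP.range_eq _ _).1 ⟨_, rfl⟩

/-- The second covariant derivative, computed with a connection that agrees with the induced one. -/
theorem IsConnection.covDeriv_covDeriv (hP : IsConnection (EB := EB) pr P)
    {Q : EndField (𝓘(ℝ, E).tangent) (TangentBundle 𝓘(ℝ, E) Z)}
    (hQ : ∀ ξ ∈ tangentVerticalBundle (EB := EB) pr, Q.toMap ξ = (inducedConnection P).toMap ξ)
    (hf : ContMDiffAt 𝓘(ℝ, EB) 𝓘(ℝ, E) ∞ f p) (hY : IsSmoothVectorField 𝓘(ℝ, EB) Y) {a b s : E}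
    (ha : fderiv ℝ (mapInChart EB E f p) (chartAt EB p p) (X p) = a)
    (hb : fderiv ℝ (mapInChart EB E f p) (chartAt EB p p) (Y p) = b)
    (hs : fderiv ℝ (fun x => fderiv ℝ (mapInChart EB E f p) x (fieldInChart Y p x))
      (chartAt EB p p) (X p) = s) :
    covDeriv Q X (covDeriv P Y f) p =
      (⟨⟨f p, (chartRep P (chartAt E (f p)) (chartAt E (f p) (f p)) b : E)⟩,
        ((chartRep P (chartAt E (f p)) (chartAt E (f p) (f p)) a,
          fderiv ℝ (chartRep P (chartAt E (f p))) (chartAt E (f p) (f p))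
              (chartRep P (chartAt E (f p)) (chartAt E (f p) (f p)) b) a +
            chartRep P (chartAt E (f p)) (chartAt E (f p) (f p))
              (fderiv ℝ (chartRep P (chartAt E (f p))) (chartAt E (f p) (f p)) a b +
                chartRep P (chartAt E (f p)) (chartAt E (f p) (f p)) s)) : E × E)⟩ : TT E Z) := by
  have h1 := hQ _ (mem_tangentVerticalBundle_of_mfderiv (contMDiffAt_covDeriv hP.smooth hf hY)
    (Filter.Eventually.of_forall fun q => hP.covDeriv_mem f q) (X p))
  have h2 := congrArg (inducedConnection P).toMap
    (mk_mfderiv_covDeriv hP.smooth hf hY (X p) ha hb hs)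
  exact h1.trans h2

/-- The curvature measures the failure of covariant derivatives to commute. -/
theorem IsConnection.curvature_identity [FiniteDimensional ℝ EB]
    (hP : IsConnection (EB := EB) pr P)
    (hpr : ContMDiff 𝓘(ℝ, E) 𝓘(ℝ, EB) ∞ pr)
    {Q : EndField (𝓘(ℝ, E).tangent) (TangentBundle 𝓘(ℝ, E) Z)}
    (hQv : IsVerticalConnection (EB := EB) pr Q)
    (hQ : ∀ ξ ∈ tangentVerticalBundle (EB := EB) pr, Q.toMap ξ = (inducedConnection P).toMap ξ)
    (hf : ContMDiffAt 𝓘(ℝ, EB) 𝓘(ℝ, E) ∞ f p) (hX : IsSmoothVectorField 𝓘(ℝ, EB) X)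
    (hY : IsSmoothVectorField 𝓘(ℝ, EB) Y) :
    covDeriv Q X (covDeriv P Y f) p ∈ doubleVerticalBundle (EB := EB) pr ∧
      doubleProj (covDeriv Q X (covDeriv P Y f) p) =
        doubleProj (canonicalFlip (covDeriv Q Y (covDeriv P X f) p)) ∧
      curvature P (f p) (mfderiv 𝓘(ℝ, EB) 𝓘(ℝ, E) f p (X p))
          (mfderiv 𝓘(ℝ, EB) 𝓘(ℝ, E) f p (Y p)) =
        covDerivCommutator P Q X Y f p -
          covDerivVec P (VectorField.mlieBracket 𝓘(ℝ, EB) X Y) f p := by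
  have hfd := hf.mdifferentiableAt (by simp : (∞ : WithTop ℕ∞) ≠ 0)
  obtain ⟨a, ha⟩ : ∃ a, fderiv ℝ (mapInChart EB E f p) (chartAt EB p p) (X p) = a := ⟨_, rfl⟩
  obtain ⟨b, hb⟩ : ∃ b, fderiv ℝ (mapInChart EB E f p) (chartAt EB p p) (Y p) = b := ⟨_, rfl⟩
  obtain ⟨s, hs⟩ : ∃ s, fderiv ℝ (fun x => fderiv ℝ (mapInChart EB E f p) x (fieldInChart Y p x))
      (chartAt EB p p) (X p) = s := ⟨_, rfl⟩
  obtain ⟨t, ht⟩ : ∃ t, fderiv ℝ (fun x => fderiv ℝ (mapInChart EB E f p) x (fieldInChart X p x))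
      (chartAt EB p p) (Y p) = t := ⟨_, rfl⟩
  have h1 := hP.covDeriv_covDeriv hQ hf hY ha hb hs
  have h2 := hP.covDeriv_covDeriv hQ hf hX hb ha ht
  have h2' := congrArg canonicalFlip h2
  refine ⟨?_, ?_, ?_⟩
  · have h3 := mem_tangentVerticalBundle_of_mfderiv (contMDiffAt_covDeriv hP.smooth hf hY)
      (Filter.Eventually.of_forall fun q => hP.covDeriv_mem f q) (X p)
    exact (hQv.range_eq _ (hP.covDeriv_mem f p)).1 ⟨_, h3, rfl⟩
  · refine (congrArg doubleProj h1).trans (Eq.trans ?_ (congrArg doubleProj h2').symm)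
    exact (doubleProj_mk _ _ _ _).trans (doubleProj_mk _ _ _ _).symm
  · have hK := hP.isLocalConnection_chartAt hpr (f p)
    -- the components of `f_* [X, Y]`
    have hst : s - t = mfderiv 𝓘(ℝ, EB) 𝓘(ℝ, E) f p (VectorField.mlieBracket 𝓘(ℝ, EB) X Y p) := by
      have e1 := fderiv_apply_lieBracket (contDiffAt_mapInChart hf)
        ((contDiffAt_fieldInChart hX p).differentiableAt (by simp))
        ((contDiffAt_fieldInChart hY p).differentiableAt (by simp))
      rw [fieldInChart_self, fieldInChart_self] at e1
      have e2 := (isSmoothChart_chartAt (E := EB) p).chartVec_mlieBracket (mem_chart_target EB p)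
        (hX _) (hY _)
      have e3 := (fieldInChart_self (VectorField.mlieBracket 𝓘(ℝ, EB) X Y) p).symm.trans e2
      rw [← hs, ← ht]
      refine e1.trans ((congrArg _ e3.symm).trans ?_)
      exact (mfderiv_eq_fderiv_chartAt hfd _).symm
    have hbr : covDerivVec P (VectorField.mlieBracket 𝓘(ℝ, EB) X Y) f p =
        chartRep P (chartAt E (f p)) (chartAt E (f p) (f p)) (s - t) :=
      (chartRep_chartAt_self P (f p) _).symm.trans (congrArg _ hst.symm)
    have hcomm : covDerivCommutator P Q X Y f p = _ :=
      congrArg₂ (fun ξ η : TT E Z => (ξ.snd.2 - η.snd.2 : E)) h1 h2'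
    have hcurv := IsConnection.chartVec_curvature hP hpr
      (isSmoothChart_chartAt (E := E) (f p)) (mem_chart_source E (f p))
      (mfderiv 𝓘(ℝ, EB) 𝓘(ℝ, E) f p (X p)) (mfderiv 𝓘(ℝ, EB) 𝓘(ℝ, E) f p (Y p))
    have ha' : mfderiv 𝓘(ℝ, EB) 𝓘(ℝ, E) f p (X p) = a := (mfderiv_eq_fderiv_chartAt hfd _).trans ha
    have hb' : mfderiv 𝓘(ℝ, EB) 𝓘(ℝ, E) f p (Y p) = b := (mfderiv_eq_fderiv_chartAt hfd _).trans hb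
    refine (chartVec_chartAt_self (E := E) (f p) _).symm.trans (hcurv.trans ?_)
    refine (congrArg₂ _ ((chartVec_chartAt_self (E := E) (f p) _).trans ha')
      ((chartVec_chartAt_self (E := E) (f p) _).trans hb')).trans ?_
    exact (hK.localCurvature_eq a b s t).trans (congrArg₂ _ hcomm.symm hbr.symm)

end CurvatureIdentity

end Ehresmann

end

theorem mainTheorem1
    {EB : Type*} [NormedAddCommGroup EB] [NormedSpace ℝ EB] [FiniteDimensional ℝ EB]
    {M : Type*} [TopologicalSpace M] [T2Space M] [ChartedSpace EB M] [IsManifold 𝓘(ℝ, EB) ∞ M]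
    {EF : Type*} [NormedAddCommGroup EF] [NormedSpace ℝ EF] [FiniteDimensional ℝ EF]
    {F : Type*} [TopologicalSpace F] [ChartedSpace EF F] [IsManifold 𝓘(ℝ, EF) ∞ F]
    {EZ : Type*} [NormedAddCommGroup EZ] [NormedSpace ℝ EZ] [FiniteDimensional ℝ EZ]
    {Z : Type*} [TopologicalSpace Z] [ChartedSpace EZ Z] [IsManifold 𝓘(ℝ, EZ) ∞ Z]
    (pr : Z → M) (hpr : IsSmoothFiberBundle (EB := EB) (EF := EF) (EZ := EZ) F pr)
    (P : EndField 𝓘(ℝ, EZ) Z) (hP : IsConnection (EB := EB) pr P) :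
    -- The curvature is a well-defined tensor, given by the simplified expression.
    (∀ (z : Z) (A B : ∀ y : Z, TangentSpace 𝓘(ℝ, EZ) y),
      IsSmoothVectorFieldAt 𝓘(ℝ, EZ) A z → IsSmoothVectorFieldAt 𝓘(ℝ, EZ) B z →
      nijenhuis P A B z = curvature P z (A z) (B z) ∧
      curvature P z (A z) (B z) =
        -P z (VectorField.mlieBracket 𝓘(ℝ, EZ)
          (fun y => A y - P y (A y)) (fun y => B y - P y (B y)) z)) ∧
    -- The induced connection on the vertical tangent bundle exists and is unique.
    (∃ Q : EndField (𝓘(ℝ, EZ).tangent) (TangentBundle 𝓘(ℝ, EZ) Z),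
      IsInducedConnection (EB := EB) pr P Q ∧
      ∀ Q', IsInducedConnection (EB := EB) pr P Q' →
        ∀ ξ ∈ tangentVerticalBundle (EB := EB) pr, Q'.toMap ξ = Q.toMap ξ) ∧
    -- The curvature identity.
    (∀ Q : EndField (𝓘(ℝ, EZ).tangent) (TangentBundle 𝓘(ℝ, EZ) Z),
      IsInducedConnection (EB := EB) pr P Q →
      ∀ X Y : (∀ p : M, TangentSpace 𝓘(ℝ, EB) p),
      IsSmoothVectorField 𝓘(ℝ, EB) X → IsSmoothVectorField 𝓘(ℝ, EB) Y →
      ∀ (U : Set M) (f : M → Z), IsLocalSection (EB := EB) (EZ := EZ) pr U f → ∀ p ∈ U,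
        covDeriv Q X (covDeriv P Y f) p ∈ doubleVerticalBundle (EB := EB) pr ∧
        doubleProj (covDeriv Q X (covDeriv P Y f) p) =
          doubleProj (canonicalFlip (covDeriv Q Y (covDeriv P X f) p)) ∧
        curvature P (f p) (mfderiv 𝓘(ℝ, EB) 𝓘(ℝ, EZ) f p (X p))
            (mfderiv 𝓘(ℝ, EB) 𝓘(ℝ, EZ) f p (Y p)) =
          covDerivCommutator P Q X Y f p -
            covDerivVec P (VectorField.mlieBracket 𝓘(ℝ, EB) X Y) f p) ∧
    -- The coefficients of the curvature in terms of the Christoffel symbols.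
    (∀ (φ : OpenPartialHomeomorph Z (EB × EF)) (x : OpenPartialHomeomorph M EB),
      IsFiberedChart (EZ := EZ) pr φ x → ∀ y ∈ φ.target, ∀ u v : EB,
        mfderiv 𝓘(ℝ, EZ) 𝓘(ℝ, EB × EF) φ (φ.symm y)
            (curvature P (φ.symm y) (coordVector φ y u) (coordVector φ y v)) =
          ((0, fderiv ℝ (fun y' => christoffel P φ y' v) y (u, 0)
            - fderiv ℝ (fun y' => christoffel P φ y' u) y (v, 0)
            + (fderiv ℝ (fun y' => christoffel P φ y' u) y (0, christoffel P φ y v)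
              - fderiv ℝ (fun y' => christoffel P φ y' v) y (0, christoffel P φ y u))) :
            EB × EF)) := by
  refine ⟨fun z A B hA hB => hP.nijenhuis_eq hpr.smooth hA hB, ?_, ?_, ?_⟩
  · exact ⟨inducedConnection P, hP.isInducedConnection hpr.smooth, fun Q' hQ' ξ hξ =>
      (hP.isInducedConnection hpr.smooth).toMap_eq hpr hP hQ' hξ⟩
  · intro Q hQ X Y hX hY U f hf p hp
    exact hP.curvature_identity hpr.smooth hQ.toIsVerticalConnection
      (fun ξ hξ => (hP.isInducedConnection hpr.smooth).toMap_eq hpr hP hQ hξ)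
      (hf.smooth.contMDiffAt (hf.isOpen.mem_nhds hp)) hX hY
  · intro φ x h y hy u v
    exact h.mfderiv_curvature hP hpr.smooth hy u v
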